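/- Let $k$ be a field, $\otimes=\otimes_k$, and let $G$ be a finite group acting by algebra automorphisms on a $k$-algebra $S$. Write ${}^g s$ for the action, and let $S\rtimes G$ be the skew group algebra, free as a left $S$-module with basis $G$ and with $(sg)(s'g')=s({}^gs')gg'$. For a $k$-algebra $A$ put $\overline A=A/k1$ and let $\overline B_A$ be its reduced bar resolution, $(\overline B_A)_n=A\otimes\overline A^{\otimes n}\otimes A$ with $d(a_0\otimes\cdots\otimes a_{n+1})=\sum_{j=0}^{n}(-1)^j a_0\otimes\cdots\otimes a_ja_{j+1}\otimes\cdots\otimes a_{n+1}$; write $\overline B_G=\overline B_{kG}$, which is $G$-graded by $\deg(g_0\otimes\cdots\otimes g_{n+1})=g_0\cdots g_{n+1}$. $G$ acts diagonally on $\overline B_S$. Let $C$ be a projective resolution of $kG$ by $kG$-bimodules that is $G$-graded (differentials and augmentation preserve the grading) with $g_1\big((C_i)_{g_2}\big)g_3=(C_i)_{g_1g_2g_3}$. Let $D$ be a projective resolution of $S$ by $S$-bimodules with a $k$-linear action of $G$ on each $D_j$, commuting with the differentials and the augmentation, such that $g(s\cdot d\cdot s')={}^gs\cdot gd\cdot{}^gs'$.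 The twisted product resolution $C\otimes^GD$ of $S\rtimes G$ is the total complex $(C\otimes^GD)_n=\bigoplus_{i+j=n}C_i\otimes D_j$ with $d(c\otimes x)=dc\otimes x+(-1)^i c\otimes dx$ for $c\in C_i$, with the $(S\rtimes G)$-bimodule structure $$s\cdot(c\otimes x)=c\otimes({}^{g^{-1}}s)x\ \ (c\in C_g),\quad h\cdot(c\otimes x)=hc\otimes x,\quad (c\otimes x)\cdot s=c\otimes xs,\quad (c\otimes x)\cdot h=ch\otimes{}^{h^{-1}}x,$$ augmented by $c\otimes x\mapsto\varepsilon_C(c)\varepsilon_D(x)\in S\rtimes G$. Let $\overline B_G\otimes^G\overline B_S$ denote the same construction for the reduced bar resolutions. Let $\mathrm{AW}^G:\overline B_{S\rtimes G}\to\overline B_G\otimes^G\overline B_S$ be the $(S\rtimes G)$-bimodule map with $$\mathrm{AW}^G_n(1\otimes s_1g_1\otimes\cdots\otimes s_ng_n\otimes1)=\sum_{\ell=0}^n(-1)^{\ell(n-\ell)}\,(g_1\cdots g_\ell\otimes g_{\ell+1}\otimes\cdots\otimes g_n\otimes1)\otimes(1\otimes u_1\otimes\cdots\otimes u_\ell\otimes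 u_{\ell+1}u_{\ell+2}\cdots u_n),$$ where $u_i={}^{(g_ig_{i+1}\cdots g_n)^{-1}}s_i$. Let $\mathrm{EZ}^G:\overline B_G\otimes^G\overline B_S\to\overline B_{S\rtimes G}$ be the $(S\rtimes G)$-bimodule map sending $(1\otimes g_1\otimes\cdots\otimes g_{m}\otimes1)\otimes(1\otimes s_1\otimes\cdots\otimes s_\ell\otimes1)$, $m+\ell=n$, to $\sum_\sigma \operatorname{sgn}(\sigma)\,1\otimes y_{\sigma(1)}\otimes\cdots\otimes y_{\sigma(n)}\otimes1$. The sum is over the permutations $\sigma$ of $\{1,\dots,n\}$ such that $\sigma^{-1}$ is increasing on $\{1,\dots,m\}$ and on $\{m+1,\dots,n\}$. Here $y_i=g_i$ for $i\le m$, and $y_{m+i}={}^{h}s_i$ with $h$ the product, in order of increasing $j$, of the $g_{\sigma(j)}$ with $j>\sigma^{-1}(m+i)$ and $\sigma(j)\le m$. Suppose given chain maps $\iota_G:C\to\overline B_G$, $\pi_G:\overline B_G\to C$ of $kG$-bimodules and $\iota_S:D\to\overline B_S$, $\pi_S:\overline B_S\to D$ of $S$-bimodules, with $\iota_S,\pi_S$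 also $kG$-linear, such that $\pi_G\iota_G=1$ and $\pi_S\iota_S=1$ in each degree. Then $$\iota=\mathrm{EZ}^G(\iota_G\otimes\iota_S):C\otimes^GD\to\overline B_{S\rtimes G},\qquad \pi=(\pi_G\otimes\pi_S)\mathrm{AW}^G:\overline B_{S\rtimes G}\to C\otimes^GD$$ are $k$-linear chain maps, and $\pi_n\iota_n$ is the identity of $(C\otimes^GD)_n$ for every $n$. If $\iota_G$ (respectively $\pi_G$) preserves the $G$-gradings, then $\iota$ (respectively $\pi$) is a map of $(S\rtimes G)$-bimodules. If $\iota_G,\iota_S$ (respectively $\pi_G,\pi_S$) commute with the augmentations, then so does $\iota$ (respectively $\pi$). Finally, let $S=\bigoplus_m S_m$ be graded by a commutative monoid and let $G$ act by degree-preserving automorphisms. Grade each $D_j$ as a vector space, put $G$ and $C$ in degree $0$, grade $(C\otimes^G D)_n$ by the degree in $D$, and grade $\overline B_S$ and $\overline B_{S\rtimes G}$ by total degree. If $\iota_S$ (respectively $\pi_S$) is a graded map, then $\iota$ (respectively $\pi$) is a graded map. -/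

import Mathlib

open scoped TensorProduct
open MulOpposite

namespace GroupTwisted

/-! ### Ordered products of tuples -/

/-- For `φ : Fin N → Fin M`, the tuple whose `j`-th entry is the product, in increasing order of
`i`, of the entries `v i` with `φ i = j`. -/
def blockProd {A : Type*} [Monoid A] {N M : ℕ} (φ : Fin N → Fin M) (v : Fin N → A) :
    Fin M → A :=
  fun j => (((List.finRange N).filter (fun i => φ i = j)).map v).prod

/-- The product `v 0 * v 1 * ⋯` of all entries of a tuple. -/
def fullProd {A : Type*} [Monoid A] {N : ℕ} (v : Fin N → A) : A := (List.ofFn v).prod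

/-- The product `v i * v (i + 1) * ⋯` of the entries from the index `i` on. -/
def tailProd {A : Type*} [Monoid A] {N : ℕ} (v : Fin N → A) (i : Fin N) : A :=
  (((List.finRange N).filter (fun j => i ≤ j)).map v).prod

/-- The product of the entries whose index is strictly larger than `i`, in increasing order. -/
def afterProd {A : Type*} [Monoid A] {N : ℕ} (v : Fin N → A) (i : Fin N) : A :=
  (((List.finRange N).filter (fun j => i < j)).map v).prod

/-- Precomposition of a multilinear map `f` with a map `T` of tuples for which changing one
argument changes one entry, and changes it linearly. -/
def compTuple {k S A P : Type*} [CommSemiring k] [AddCommMonoid S] [Module k S] [AddCommMonoid A]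
    [Module k A] [AddCommMonoid P] [Module k P] {M N : ℕ}
    (f : MultilinearMap k (fun _ : Fin N => A) P) (T : (Fin M → S) → Fin N → A)
    (hT : ∀ w i, ∃ (q : Fin N) (L : S →ₗ[k] A), ∀ x,
      T (Function.update w i x) = Function.update (T w) q (L x)) :
    MultilinearMap k (fun _ : Fin M => S) P :=
  MultilinearMap.mk' (fun w => f (T w))
    (fun w i x y => by
      obtain ⟨q, L, h⟩ := hT w i
      rw [h, h, h, map_add, f.map_update_add])
    (fun w i c x => by
      obtain ⟨q, L, h⟩ := hT w i
      rw [h, h, map_smul, f.map_update_smul])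

theorem blockProd_update (k : Type*) {A : Type*} [CommSemiring k] [Semiring A] [Algebra k A]
    {N M : ℕ} (φ : Fin N → Fin M) (v : Fin N → A) (i : Fin N) :
    ∃ (q : Fin M) (L : A →ₗ[k] A), ∀ x,
      blockProd φ (Function.update v i x) = Function.update (blockProd φ v) q (L x) := by
  have hmem : i ∈ (List.finRange N).filter (fun i' => φ i' = φ i) := by simp
  obtain ⟨l₁, l₂, hl⟩ := List.append_of_mem hmem
  have hnd : (l₁ ++ i :: l₂).Nodup := hl ▸ (List.nodup_finRange N).filter _
  have h₁ : ∀ j ∈ l₁, j ≠ i := by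
    rintro j hj rfl
    simp only [List.nodup_append, List.mem_cons] at hnd
    exact hnd.2.2 _ hj _ (Or.inl rfl) rfl
  have h₂ : ∀ j ∈ l₂, j ≠ i := by
    rintro j hj rfl
    simp only [List.nodup_append, List.nodup_cons] at hnd
    exact hnd.2.1.1 hj
  refine ⟨φ i, (LinearMap.mulLeft k (l₁.map v).prod).comp
    (LinearMap.mulRight k (l₂.map v).prod), fun x => ?_⟩
  funext j
  by_cases hj : j = φ i
  · subst hj
    have e₁ : l₁.map (Function.update v i x) = l₁.map v :=
      List.map_congr_left fun a ha => Function.update_of_ne (h₁ a ha) _ _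
    have e₂ : l₂.map (Function.update v i x) = l₂.map v :=
      List.map_congr_left fun a ha => Function.update_of_ne (h₂ a ha) _ _
    simp [blockProd, hl, e₁, e₂]
  · rw [Function.update_of_ne hj]
    refine congrArg List.prod (List.map_congr_left fun a ha => Function.update_of_ne ?_ _ _)
    rintro rfl
    simp at ha
    exact hj ha.symm

/-! ### The reduced bar resolution -/

section Bar

variable (k : Type*) [Field k] (A : Type*) [Ring A] [Algebra k A]

/-- The vector space `A / (k · 1)`. -/
abbrev Reduced : Type _ := A ⧸ Submodule.span k {(1 : A)}

/-- A choice of linear section of `A → A / (k · 1)`. -/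
noncomputable def reducedSection : Reduced k A →ₗ[k] A :=
  ((Submodule.mkQ (Submodule.span k {(1 : A)})).exists_rightInverse_of_surjective
    (Submodule.range_mkQ _)).choose

/-- Degree `n` of the reduced bar resolution, `A ⊗ (A / k1)^{⊗ n} ⊗ A`. -/
def Bar (n : ℕ) : Type _ := A ⊗[k] ((⨂[k] _ : Fin n, Reduced k A) ⊗[k] A)

namespace Bar

variable (n : ℕ)

noncomputable instance : AddCommGroup (Bar k A n) :=
  inferInstanceAs (AddCommGroup (A ⊗[k] ((⨂[k] _ : Fin n, Reduced k A) ⊗[k] A)))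

noncomputable instance : Module k (Bar k A n) :=
  inferInstanceAs (Module k (A ⊗[k] ((⨂[k] _ : Fin n, Reduced k A) ⊗[k] A)))

/-- Multiplication on the leftmost tensor factor. -/
noncomputable instance : Module A (Bar k A n) :=
  inferInstanceAs (Module A (A ⊗[k] ((⨂[k] _ : Fin n, Reduced k A) ⊗[k] A)))

/-- Right multiplication on the rightmost tensor factor. -/
noncomputable instance : Module Aᵐᵒᵖ (Bar k A n) :=
  Module.compHom (A ⊗[k] ((⨂[k] _ : Fin n, Reduced k A) ⊗[k] A))
    (((Module.End.lTensorAlgHom k ((⨂[k] _ : Fin n, Reduced k A) ⊗[k] A) A).comp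
      ((Module.End.lTensorAlgHom k A (⨂[k] _ : Fin n, Reduced k A)).comp
        (Algebra.lsmul k k A : Aᵐᵒᵖ →ₐ[k] Module.End k A))).toRingHom)

variable {n}

theorem last_ne_middle {n : ℕ} (i : Fin n) : Fin.last (n + 1) ≠ i.castSucc.succ := by
  intro h
  have h' := congrArg Fin.val h
  simp at h'
  omega

theorem update_middle (v : Fin (n + 2) → A) (i : Fin n) (x : A) :
    (fun j : Fin n => (Submodule.Quotient.mk
      (Function.update v i.castSucc.succ x j.castSucc.succ) : Reduced k A)) =
    Function.update (fun j : Fin n => (Submodule.Quotient.mk (v j.castSucc.succ) : Reduced k A)) i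
      (Submodule.Quotient.mk x) := by
  funext j
  by_cases h : j = i
  · subst h; simp
  · rw [Function.update_of_ne h, Function.update_of_ne (by simpa using h)]

/-- The element `a₀ ⊗ a₁ ⊗ ⋯ ⊗ aₙ ⊗ aₙ₊₁` (with `a₁, …, aₙ` read modulo `k · 1`), as a
multilinear map of `a₀, …, aₙ₊₁`. -/
noncomputable def tuple : MultilinearMap k (fun _ : Fin (n + 2) => A) (Bar k A n) :=
  show MultilinearMap k (fun _ : Fin (n + 2) => A)
      (A ⊗[k] ((⨂[k] _ : Fin n, Reduced k A) ⊗[k] A)) from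
  MultilinearMap.mk'
    (fun v => v 0 ⊗ₜ[k] (PiTensorProduct.tprod k
      (fun i : Fin n => (Submodule.Quotient.mk (v i.castSucc.succ) : Reduced k A)) ⊗ₜ[k]
        v (Fin.last (n + 1))))
    (fun v i x y => by
      induction i using Fin.cases with
      | zero => simp [TensorProduct.add_tmul]
      | succ i =>
        induction i using Fin.lastCases with
        | last => simp [TensorProduct.tmul_add]
        | cast i =>
          simp only [update_middle, Function.update_of_ne (last_ne_middle i)]
          simp [TensorProduct.tmul_add, TensorProduct.add_tmul, (Fin.succ_ne_zero _).symm])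
    (fun v i c x => by
      induction i using Fin.cases with
      | zero => simp [TensorProduct.smul_tmul']
      | succ i =>
        induction i using Fin.lastCases with
        | last => simp
        | cast i =>
          simp only [update_middle, Function.update_of_ne (last_ne_middle i)]
          simp [← TensorProduct.smul_tmul', (Fin.succ_ne_zero _).symm])

theorem tuple_eq_zero (v : Fin (n + 2) → A) (i : Fin n) (hv : v i.castSucc.succ = 1) :
    tuple k A v = 0 := by
  have h : (PiTensorProduct.tprod k
      (fun i : Fin n => (Submodule.Quotient.mk (v i.castSucc.succ) : Reduced k A))) = 0 := by
    refine MultilinearMap.map_coord_zero _ i ?_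
    rw [hv, Submodule.Quotient.mk_eq_zero]
    exact Submodule.mem_span_singleton_self _
  change v 0 ⊗ₜ[k] (PiTensorProduct.tprod k
      (fun i : Fin n => (Submodule.Quotient.mk (v i.castSucc.succ) : Reduced k A)) ⊗ₜ[k]
        v (Fin.last (n + 1))) = _
  rw [h, TensorProduct.zero_tmul, TensorProduct.tmul_zero]
  rfl

variable {k A} {N : Type*} [AddCommGroup N] [Module k N]

/-- The linear map on `A ⊗ (A / k1)^{⊗ n} ⊗ A` given by a multilinear expression in
`a₀, …, aₙ₊₁`, where the classes in `A / k1` are represented through the chosen section. The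
expressions used below vanish when one of `a₁, …, aₙ` is `1`, so that the section is immaterial
(`lift_tuple`). -/
noncomputable def lift (F : MultilinearMap k (fun _ : Fin (n + 2) => A) N) : Bar k A n →ₗ[k] N :=
  TensorProduct.lift
    (((TensorProduct.uncurry (RingHom.id k) _ _ _).comp
      ((PiTensorProduct.lift : MultilinearMap k (fun _ : Fin n => Reduced k A) (A →ₗ[k] N) ≃ₗ[k] _).toLinearMap.comp
        ((MultilinearMap.compLinearMapₗ (fun _ : Fin n => reducedSection k A)).comp
          (multilinearCurryRightEquiv k (fun _ : Fin (n + 1) => A) N).toLinearMap))).comp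
      F.curryLeft)

theorem mk_reducedSection (x : Reduced k A) :
    (Submodule.Quotient.mk (reducedSection k A x) : Reduced k A) = x :=
  LinearMap.congr_fun
    ((Submodule.mkQ (Submodule.span k {(1 : A)})).exists_rightInverse_of_surjective
      (Submodule.range_mkQ _)).choose_spec x

theorem lift_tuple_eq (F : MultilinearMap k (fun _ : Fin (n + 2) => A) N) (v : Fin (n + 2) → A) :
    lift F (tuple k A v) = F (Fin.cons (v 0) (Fin.snoc (α := fun _ => A)
      (fun i : Fin n => reducedSection k A (Submodule.Quotient.mk (v i.castSucc.succ)))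
      (v (Fin.last (n + 1))))) := by
  have h : lift F (tuple k A v) = PiTensorProduct.lift
      (((F.curryLeft (v 0)).curryRight).compLinearMap (fun _ : Fin n => reducedSection k A))
      (PiTensorProduct.tprod k
        (fun i : Fin n => (Submodule.Quotient.mk (v i.castSucc.succ) : Reduced k A)))
      (v (Fin.last (n + 1))) := rfl
  rw [h, PiTensorProduct.lift.tprod]
  rfl

/-- The chosen section is immaterial for multilinear expressions that vanish as soon as one of
`a₁, …, aₙ` equals `1`. -/
theorem lift_tuple (F : MultilinearMap k (fun _ : Fin (n + 2) => A) N)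
    (hF : ∀ (v : Fin (n + 2) → A) (i : Fin n), v i.castSucc.succ = 1 → F v = 0)
    (v : Fin (n + 2) → A) : lift F (tuple k A v) = F v := by
  classical
  rw [lift_tuple_eq]
  set w : Fin (n + 2) → A := Fin.cons (v 0) (Fin.snoc (α := fun _ => A)
      (fun i : Fin n => reducedSection k A (Submodule.Quotient.mk (v i.castSucc.succ)))
      (v (Fin.last (n + 1)))) with hw
  have hmid : ∀ i : Fin n, ∃ c : k, w i.castSucc.succ = v i.castSucc.succ + c • (1 : A) := by
    intro i
    have h1 : w i.castSucc.succ =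
        reducedSection k A (Submodule.Quotient.mk (v i.castSucc.succ)) := by simp [hw]
    have h2 := mk_reducedSection (k := k) (A := A) (Submodule.Quotient.mk (v i.castSucc.succ))
    rw [← h1, Submodule.Quotient.eq, Submodule.mem_span_singleton] at h2
    obtain ⟨c, hc⟩ := h2
    exact ⟨c, by rw [hc]; abel⟩
  have key : ∀ s : Finset (Fin n),
      F (fun j => if ∃ i ∈ s, j = i.castSucc.succ then w j else v j) = F v := by
    intro s
    induction s using Finset.induction_on with
    | empty => simp
    | insert a s ha ih =>
      obtain ⟨c, hc⟩ := hmid a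
      set u : Fin (n + 2) → A := fun j => if ∃ i ∈ s, j = i.castSucc.succ then w j else v j
        with hu
      have hua : u a.castSucc.succ = v a.castSucc.succ := by
        simp only [hu]
        rw [if_neg]
        rintro ⟨i, hi, h⟩
        simp at h
        exact ha (h ▸ hi)
      have e : (fun j => if ∃ i ∈ insert a s, j = i.castSucc.succ then w j else v j) =
          Function.update u a.castSucc.succ (u a.castSucc.succ + c • (1 : A)) := by
        funext j
        by_cases hj : j = a.castSucc.succ
        · subst hj
          simp [hc, hua]
        · simp [hu, hj]
      rw [e, F.map_update_add, F.map_update_smul, Function.update_eq_self,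
        hF (Function.update u a.castSucc.succ 1) a (Function.update_self _ _ _), ih, smul_zero, add_zero]
  rw [← key Finset.univ]
  congr 1
  funext j
  split_ifs with h
  · rfl
  · induction j using Fin.cases with
    | zero => simp [hw]
    | succ j =>
      induction j using Fin.lastCases with
      | last => simp [hw]
      | cast j => exact absurd ⟨j, Finset.mem_univ _, rfl⟩ h

theorem contractNth_update (j : Fin (n + 2)) (v : Fin (n + 3) → A) (i : Fin (n + 3)) :
    ∃ (q : Fin (n + 2)) (L : A →ₗ[k] A), ∀ x,
      Fin.contractNth j.castSucc (· * ·) (Function.update v i x) =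
        Function.update (Fin.contractNth j.castSucc (· * ·) v) q (L x) := by
  have h : (∃ q : Fin (n + 2), q < j ∧ i = q.castSucc) ∨ i = j.castSucc ∨ i = j.succ ∨
      (∃ q : Fin (n + 2), j < q ∧ i = q.succ) := by
    rcases lt_trichotomy (i : ℕ) j with h | h | h
    · exact Or.inl ⟨⟨i, by omega⟩, h, rfl⟩
    · exact Or.inr (Or.inl (Fin.ext h))
    · by_cases h' : (i : ℕ) = j + 1
      · exact Or.inr (Or.inr (Or.inl (Fin.ext h')))
      · exact Or.inr (Or.inr (Or.inr ⟨⟨i - 1, by omega⟩, by simp [Fin.lt_def]; omega,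
          Fin.ext (by simp; omega)⟩))
  rcases h with ⟨q, hq, rfl⟩ | rfl | rfl | ⟨q, hq, rfl⟩
  · refine ⟨q, LinearMap.id, fun x => funext fun r => ?_⟩
    simp only [Fin.contractNth, Function.update_apply, Fin.ext_iff, Fin.lt_def, Fin.val_castSucc,
      Fin.val_succ, LinearMap.id_apply] at hq ⊢
    grind
  · refine ⟨j, LinearMap.mulRight k (v j.succ), fun x => funext fun r => ?_⟩
    simp only [Fin.contractNth, Function.update_apply, Fin.ext_iff, Fin.val_castSucc,
      Fin.val_succ, LinearMap.mulRight_apply]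
    grind
  · refine ⟨j, LinearMap.mulLeft k (v j.castSucc), fun x => funext fun r => ?_⟩
    simp only [Fin.contractNth, Function.update_apply, Fin.ext_iff, Fin.val_castSucc,
      Fin.val_succ, LinearMap.mulLeft_apply]
    grind
  · refine ⟨q, LinearMap.id, fun x => funext fun r => ?_⟩
    simp only [Fin.contractNth, Function.update_apply, Fin.ext_iff, Fin.lt_def, Fin.val_castSucc,
      Fin.val_succ, LinearMap.id_apply] at hq ⊢
    grind

theorem contractNth_degenerate (v : Fin (n + 3) → A) (i : Fin (n + 1))
    (hv : v i.castSucc.succ = 1) :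
    Fin.contractNth i.castSucc.castSucc (· * ·) v =
      Fin.contractNth i.succ.castSucc (· * ·) v := by
  have e : ∀ q : Fin (n + 3), (q : ℕ) = i + 1 → v q = 1 := fun q hq => by
    rw [← hv]; congr 1; exact Fin.ext (by simpa using hq)
  funext r
  simp only [Fin.contractNth, Fin.val_castSucc, Fin.val_succ]
  grind

theorem exists_contractNth_eq_one (v : Fin (n + 3) → A) (i : Fin (n + 1))
    (hv : v i.castSucc.succ = 1) (j : Fin (n + 2)) (h1 : j ≠ i.castSucc) (h2 : j ≠ i.succ) :
    ∃ q : Fin n, Fin.contractNth j.castSucc (· * ·) v q.castSucc.succ = 1 := by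
  have e : ∀ q : Fin (n + 3), (q:ℕ) = i + 1 → v q = 1 := fun q hq => by
    rw [← hv]; congr 1; exact Fin.ext (by simpa using hq)
  simp only [ne_eq, Fin.ext_iff, Fin.val_castSucc, Fin.val_succ] at h1 h2
  rcases lt_or_gt_of_ne h1 with h | h
  · refine ⟨⟨i - 1, by omega⟩, ?_⟩
    simp only [Fin.contractNth, Fin.val_castSucc, Fin.val_succ]
    rw [if_neg (by omega), if_neg (by omega)]
    exact e _ (by simp; omega)
  · refine ⟨⟨i, by omega⟩, ?_⟩
    simp only [Fin.contractNth, Fin.val_castSucc, Fin.val_succ]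
    rw [if_pos (by omega)]
    exact e _ (by simp)

variable (k A) in
/-- The differential `a₀ ⊗ ⋯ ⊗ aₙ₊₂ ↦ ∑ⱼ (-1)ʲ a₀ ⊗ ⋯ ⊗ aⱼ aⱼ₊₁ ⊗ ⋯ ⊗ aₙ₊₂`. -/
noncomputable def d (n : ℕ) : Bar k A (n + 1) →ₗ[k] Bar k A n :=
  lift (∑ j : Fin (n + 2), (-1 : k) ^ (j : ℕ) •
    compTuple (tuple k A) (fun v => Fin.contractNth j.castSucc (· * ·) v)
      (contractNth_update j))

theorem d_tuple (v : Fin (n + 3) → A) :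
    d k A n (tuple k A v) =
      ∑ j : Fin (n + 2), (-1 : k) ^ (j : ℕ) •
        tuple k A (Fin.contractNth j.castSucc (· * ·) v) := by
  unfold d
  rw [lift_tuple]
  · simp [compTuple]
  · intro v i hv
    have hne : i.castSucc ≠ i.succ := by simp [Fin.ext_iff]
    simp only [compTuple, sum_apply, smul_apply]
    rw [Finset.sum_eq_add_of_mem i.castSucc i.succ (Finset.mem_univ _) (Finset.mem_univ _) hne]
    · change (-1 : k) ^ (i.castSucc : ℕ) •
          tuple k A (Fin.contractNth i.castSucc.castSucc (· * ·) v) +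
        (-1 : k) ^ (i.succ : ℕ) • tuple k A (Fin.contractNth i.succ.castSucc (· * ·) v) = 0
      rw [contractNth_degenerate v i hv]
      simp [pow_succ]
    · rintro j - ⟨h1, h2⟩
      obtain ⟨q, hq⟩ := exists_contractNth_eq_one v i hv j h1 h2
      exact (congrArg _ (tuple_eq_zero k A _ q hq)).trans (smul_zero _)

variable (k A) in
/-- The augmentation `a₀ ⊗ a₁ ↦ a₀ a₁`. -/
noncomputable def aug : Bar k A 0 →ₗ[k] A :=
  lift (MultilinearMap.mkPiAlgebraFin k 2 A)

variable (k A n) in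
/-- The diagonal action on the bar resolution of a group acting on `A` by automorphisms. -/
noncomputable def groupAct {G : Type*} [Group G] [MulSemiringAction G A] [SMulCommClass G k A]
    (g : G) : Bar k A n →ₗ[k] Bar k A n :=
  lift ((tuple k A).compLinearMap (fun _ => DistribSMul.toLinearMap k A g))

/-- For a graded algebra `A = ⨁ₘ 𝒜 m`, the degree `m` part of the bar resolution: it is spanned
by the tensors of homogeneous elements whose degrees add up to `m`. -/
noncomputable def degreePart {Γ : Type*} [AddCommMonoid Γ] (𝒜 : Γ → Submodule k A) (n : ℕ) (m : Γ) :
    Submodule k (Bar k A n) :=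
  Submodule.span k {t | ∃ (e : Fin (n + 2) → Γ) (v : Fin (n + 2) → A),
    (∀ i, v i ∈ 𝒜 (e i)) ∧ ∑ i, e i = m ∧ t = tuple k A v}

variable (k) in
/-- The `G`-grading of the bar resolution of `kG`: the component of `g` is spanned by the tensors
`g₀ ⊗ ⋯ ⊗ gₙ₊₁` with `g₀ ⋯ gₙ₊₁ = g`. -/
noncomputable def groupPart {G : Type*} [Group G] (n : ℕ) (g : G) :
    Submodule k (Bar k (MonoidAlgebra k G) n) :=
  Submodule.span k {t | ∃ v : Fin (n + 2) → G, fullProd v = g ∧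
    t = tuple k (MonoidAlgebra k G) (fun i => MonoidAlgebra.of k G (v i))}

end Bar
end Bar
/-! ### Tensor products of complexes -/

section Total

variable (k : Type*) [Field k]

/-- The pairs `(i, j)` with `i + j = n`. -/
abbrev Bidegree (n : ℕ) : Type := {p : ℕ × ℕ // p ∈ Finset.HasAntidiagonal.antidiagonal n}

theorem Bidegree.add_eq {n : ℕ} (p : Bidegree n) : p.1.1 + p.1.2 = n :=
  Finset.HasAntidiagonal.mem_antidiagonal.mp p.2

/-- The pair `(i, j)` as an element of `Bidegree n`. -/
def Bidegree.mk {n : ℕ} (i j : ℕ) (h : i + j = n) : Bidegree n :=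
  ⟨(i, j), Finset.HasAntidiagonal.mem_antidiagonal.mpr h⟩

/-- Degree `n` of the total complex of `X ⊗ Y`: the (finite) direct sum of the `X i ⊗ Y j` with
`i + j = n`. -/
abbrev Total (X Y : ℕ → Type*) [∀ n, AddCommGroup (X n)] [∀ n, Module k (X n)]
    [∀ n, AddCommGroup (Y n)] [∀ n, Module k (Y n)] (n : ℕ) : Type _ :=
  (p : Bidegree n) → X p.1.1 ⊗[k] Y p.1.2

variable {k} {X Y X' Y' : ℕ → Type*}
  [∀ n, AddCommGroup (X n)] [∀ n, Module k (X n)] [∀ n, AddCommGroup (Y n)] [∀ n, Module k (Y n)]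
  [∀ n, AddCommGroup (X' n)] [∀ n, Module k (X' n)]
  [∀ n, AddCommGroup (Y' n)] [∀ n, Module k (Y' n)]

/-- The differential `d (x ⊗ y) = dx ⊗ y + (-1)ⁱ x ⊗ dy` for `x` of degree `i`, written
component by component. -/
noncomputable def Total.d (dX : ∀ n, X (n + 1) →ₗ[k] X n) (dY : ∀ n, Y (n + 1) →ₗ[k] Y n)
    (n : ℕ) : Total k X Y (n + 1) →ₗ[k] Total k X Y n :=
  LinearMap.pi fun p =>
    (dX p.1.1).rTensor (Y p.1.2) ∘ₗ LinearMap.proj (R := k)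
        (φ := fun q : Bidegree (n + 1) => X q.1.1 ⊗[k] Y q.1.2)
        (Bidegree.mk (p.1.1 + 1) p.1.2 (by have := p.add_eq; omega)) +
      (-1 : k) ^ p.1.1 • ((dY p.1.2).lTensor (X p.1.1) ∘ₗ LinearMap.proj (R := k)
        (φ := fun q : Bidegree (n + 1) => X q.1.1 ⊗[k] Y q.1.2)
        (Bidegree.mk p.1.1 (p.1.2 + 1) (by have := p.add_eq; omega)))

/-- The map `f ⊗ g` of total complexes. -/
noncomputable def Total.map (f : ∀ n, X n →ₗ[k] X' n) (g : ∀ n, Y n →ₗ[k] Y' n) (n : ℕ) :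
    Total k X Y n →ₗ[k] Total k X' Y' n :=
  LinearMap.pi fun p => TensorProduct.map (f p.1.1) (g p.1.2) ∘ₗ LinearMap.proj (R := k)
    (φ := fun q : Bidegree n => X q.1.1 ⊗[k] Y q.1.2) p

/-- The family `f` of linear maps commutes with the differentials. -/
def IsChainMap (dX : ∀ n, X (n + 1) →ₗ[k] X n) (dY : ∀ n, Y (n + 1) →ₗ[k] Y n)
    (f : ∀ n, X n →ₗ[k] Y n) : Prop :=
  ∀ n x, f n (dX n x) = dY n (f (n + 1) x)

end Total

/-- `f` commutes with the left and the right action of `A`. -/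
def IsBimoduleMap (A : Type*) {M N : Type*} [SMul A M] [SMul Aᵐᵒᵖ M] [SMul A N] [SMul Aᵐᵒᵖ N]
    (f : M → N) : Prop :=
  (∀ (a : A) x, f (a • x) = a • f x) ∧ ∀ (a : A) x, f (op a • x) = op a • f x

/-! ### Group-twisted Alexander-Whitney and Eilenberg-Zilber maps -/

section Maps

variable (k S G : Type*) [Field k] [Ring S] [Algebra k S] [Group G]
  [MulSemiringAction G S] [SMulCommClass G k S]

/-- The coefficient of `g` in an element `∑ s_g g` of `S ⋊ G`. -/
noncomputable def skewCoeff (g : G) : SkewMonoidAlgebra S G →ₗ[k] S :=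
  Finsupp.lapply g ∘ₗ (SkewMonoidAlgebra.coeffLinearEquiv (S := k)).toLinearMap

/-- The coefficient of `g` in an element of `kG`. -/
noncomputable def groupCoeff (g : G) : MonoidAlgebra k G →ₗ[k] k :=
  Finsupp.lapply g ∘ₗ (MonoidAlgebra.coeffLinearEquiv k).toLinearMap

variable {G}

/-- For group elements `γ = (g₀, …, gₙ₊₁)` and `n = m + l`, the multilinear map sending
`(s₀, …, sₙ₊₁)` to
`(-1)^(l m) (g₀ ⋯ g_l ⊗ g_{l+1} ⊗ ⋯ ⊗ gₙ₊₁) ⊗ (u₀ ⊗ ⋯ ⊗ u_l ⊗ u_{l+1} ⋯ uₙ₊₁)`,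
where `uᵢ` is the result of letting `(gᵢ ⋯ gₙ₊₁)⁻¹` act on `sᵢ`. -/
noncomputable def awTerm {n : ℕ} (m l : ℕ) (h : m + l = n) (γ : Fin (n + 2) → G) :
    MultilinearMap k (fun _ : Fin (n + 2) => S)
      (Bar k (MonoidAlgebra k G) m ⊗[k] Bar k S l) :=
  ((-1 : k) ^ (l * m) • TensorProduct.mk k _ _
      (Bar.tuple k (MonoidAlgebra k G) (fun j => MonoidAlgebra.of k G
        (blockProd (fun i : Fin (n + 2) => (⟨i - l, by omega⟩ : Fin (m + 2))) γ j)))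
    ).compMultilinearMap
    ((compTuple (Bar.tuple k S)
      (blockProd (fun i : Fin (n + 2) => (⟨min i (l + 1), by omega⟩ : Fin (l + 2))))
      (fun w i => blockProd_update k _ w i)).compLinearMap
        (fun i => DistribSMul.toLinearMap k S (tailProd γ i)⁻¹))

/-- The group-twisted Alexander-Whitney map
`AW : (B̄_{S ⋊ G})ₙ → (B̄_G ⊗ B̄_S)ₙ`. On `s₀g₀ ⊗ s₁g₁ ⊗ ⋯ ⊗ sₙ₊₁gₙ₊₁` its component in bidegree
`(m, l)` is the value of `awTerm`; for `s₀g₀ = sₙ₊₁gₙ₊₁ = 1` this is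
`(-1)^(l(n-l)) (g₁ ⋯ g_l ⊗ g_{l+1} ⊗ ⋯ ⊗ gₙ ⊗ 1) ⊗ (1 ⊗ u₁ ⊗ ⋯ ⊗ u_l ⊗ u_{l+1} ⋯ uₙ)`, where `uᵢ`
is the result of letting `(gᵢ ⋯ gₙ)⁻¹` act on `sᵢ`. -/
noncomputable def AW [Fintype G] (n : ℕ) :
    Bar k (SkewMonoidAlgebra S G) n →ₗ[k]
      Total k (fun i => Bar k (MonoidAlgebra k G) i) (fun j => Bar k S j) n :=
  LinearMap.pi fun p => Bar.lift (∑ γ : Fin (n + 2) → G,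
    (awTerm k S p.1.1 p.1.2 p.add_eq γ).compLinearMap
      (fun i => skewCoeff k S G (γ i)))

variable {k S}

/-- `τ` is an `(m, n - m)`-shuffle: it is increasing on the first `m` and on the remaining
indices. -/
def IsShuffle {n : ℕ} (m : ℕ) (τ : Equiv.Perm (Fin n)) : Prop :=
  ∀ i j : Fin n, i < j → ((j : ℕ) < m ∨ m ≤ (i : ℕ)) → τ i < τ j

/-- For `γ = (a, g₁, …, g_m, b)`, the tuple `(g₁, …, g_m, 1, …, 1)` of length `n`. -/
def ezGroup {n : ℕ} (m : ℕ) (γ : Fin (m + 2) → G) (i : Fin n) : G :=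
  if h : (i : ℕ) < m then γ ⟨i + 1, by omega⟩ else 1

/-- For `γ = (a, g₁, …, g_m, b)`, `w = (s, s₁, …, s_l, t)` and a permutation `σ`, the tuple
`(g₁, …, g_m, h₁s₁, …, h_l s_l)` of elements of `S ⋊ G`, where each entry `s_i`, which `σ` places at
position `q`, is acted upon by the product of the `g`'s placed to the right of `q`, times `b`. -/
noncomputable def ezLetter {n : ℕ} (m l : ℕ) (h : m + l = n) (σ : Equiv.Perm (Fin n))
    (γ : Fin (m + 2) → G) (w : Fin (l + 2) → S) (i : Fin n) : SkewMonoidAlgebra S G :=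
  if hi : (i : ℕ) < m then SkewMonoidAlgebra.single (γ ⟨i + 1, by omega⟩) 1
  else SkewMonoidAlgebra.single 1
    ((afterProd (ezGroup m γ ∘ σ) (σ⁻¹ i) * γ (Fin.last (m + 1))) •
      w ⟨i - m + 1, by omega⟩)

/-- For `γ = (a, g₁, …, g_m, b)` and `w = (s, s₁, …, s_l, t)`, the tuple whose middle entries are
the entries of `ezLetter` in the order prescribed by `σ`, whose first entry is `s' a` with `s'` the
image of `s` under `a g₁ ⋯ g_m b`, and whose last entry is `t' b = b t` with `t'` the image of `t`
under `b`. -/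
noncomputable def ezTuple {n : ℕ} (m l : ℕ) (h : m + l = n) (σ : Equiv.Perm (Fin n))
    (γ : Fin (m + 2) → G) (w : Fin (l + 2) → S) : Fin (n + 2) → SkewMonoidAlgebra S G :=
  Fin.cons (SkewMonoidAlgebra.single (γ 0) (fullProd γ • w 0))
    (Fin.snoc (α := fun _ => SkewMonoidAlgebra S G)
      (fun q : Fin n => ezLetter m l h σ γ w (σ q))
      (SkewMonoidAlgebra.single (γ (Fin.last (m + 1)))
        (γ (Fin.last (m + 1)) • w (Fin.last (l + 1)))))

theorem ezTuple_update (k : Type*) [Field k] [Algebra k S] [SMulCommClass G k S]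
    {n : ℕ} (m l : ℕ) (h : m + l = n) (σ : Equiv.Perm (Fin n))
    (γ : Fin (m + 2) → G) (w : Fin (l + 2) → S) (i : Fin (l + 2)) :
    ∃ (q : Fin (n + 2)) (L : S →ₗ[k] SkewMonoidAlgebra S G), ∀ x,
      ezTuple m l h σ γ (Function.update w i x) =
        Function.update (ezTuple m l h σ γ w) q (L x) := by
  induction i using Fin.cases with
  | zero =>
    refine ⟨0, SkewMonoidAlgebra.lsingle (R := k) (γ 0) ∘ₗ
      DistribSMul.toLinearMap k S (fullProd γ), fun x => ?_⟩
    have h0 : Fin.last (l + 1) ≠ 0 := Fin.last_pos.ne'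
    have h1 : ezLetter m l h σ γ (Function.update w 0 x) = ezLetter m l h σ γ w := by
      funext i
      simp [ezLetter, Fin.ext_iff]
    simp only [ezTuple, h1, Function.update_self, Function.update_of_ne h0, Fin.update_cons_zero]
    rfl
  | succ i =>
    induction i using Fin.lastCases with
    | last =>
      refine ⟨Fin.last (n + 1), SkewMonoidAlgebra.lsingle (R := k) (γ (Fin.last (m + 1))) ∘ₗ
        DistribSMul.toLinearMap k S (γ (Fin.last (m + 1))), fun x => ?_⟩
      have h1 : ezLetter m l h σ γ (Function.update w (Fin.last (l + 1)) x) =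
          ezLetter m l h σ γ w := by
        funext i
        have : ¬ ((i : ℕ) - m = l ∧ m ≤ (i : ℕ)) := by omega
        simp only [ezLetter, Function.update_apply, Fin.ext_iff]
        split_ifs with h2 h3
        · rfl
        · simp at h3
          omega
        · rfl
      simp only [ezTuple, Fin.succ_last, Nat.succ_eq_add_one, h1, Function.update_self]
      rw [Function.update_of_ne (Fin.last_pos.ne), ← Fin.succ_last n, ← Fin.cons_update,
        Fin.update_snoc_last]
      rfl
    | cast i =>
      refine ⟨(σ⁻¹ ⟨m + i, by omega⟩).castSucc.succ,
        SkewMonoidAlgebra.lsingle (R := k) 1 ∘ₗ DistribSMul.toLinearMap k S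
          (afterProd (ezGroup m γ ∘ σ) (σ⁻¹ ⟨m + i, by omega⟩) * γ (Fin.last (m + 1))),
        fun x => ?_⟩
      have h0 : Fin.last (l + 1) ≠ i.castSucc.succ := Bar.last_ne_middle i
      simp only [ezTuple]
      rw [Function.update_of_ne h0, Function.update_of_ne (Fin.succ_ne_zero _).symm,
        ← Fin.cons_update, ← Fin.snoc_update]
      congr 2
      funext q
      by_cases hq : q = σ⁻¹ ⟨m + i, by omega⟩
      · subst hq
        rw [Function.update_self]
        have e0 : σ (σ⁻¹ ⟨m + i, by omega⟩) = ⟨m + i, by omega⟩ := Equiv.apply_symm_apply σ _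
        simp only [ezLetter, e0]
        rw [dif_neg (by simp)]
        have e : (⟨m + (i : ℕ) - m + 1, by omega⟩ : Fin (l + 2)) = i.castSucc.succ :=
          Fin.ext (by simp)
        rw [e, Function.update_self]
        rfl
      · rw [Function.update_of_ne hq]
        unfold ezLetter
        split_ifs with h2
        · rfl
        · rw [Function.update_of_ne]
          intro h3
          apply hq
          rw [Equiv.Perm.eq_inv_iff_eq]
          have h4 := congrArg Fin.val h3
          simp at h4
          exact Fin.ext (by simp; omega)

variable (k S)

/-- The multilinear map sending `(s, s₁, …, s_l, t)` to the value of the group-twisted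
Eilenberg-Zilber map on `(a ⊗ g₁ ⊗ ⋯ ⊗ g_m ⊗ b) ⊗ (s ⊗ s₁ ⊗ ⋯ ⊗ s_l ⊗ t)`. -/
noncomputable def ezTerm {n : ℕ} (m l : ℕ) (h : m + l = n) (γ : Fin (m + 2) → G) :
    MultilinearMap k (fun _ : Fin (l + 2) => S) (Bar k (SkewMonoidAlgebra S G) n) :=
  open Classical in
  ∑ σ : Equiv.Perm (Fin n), if IsShuffle m σ⁻¹ then
    ((Equiv.Perm.sign σ : ℤ) : k) •
      compTuple (Bar.tuple k (SkewMonoidAlgebra S G)) (ezTuple m l h σ γ)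
        (ezTuple_update k m l h σ γ)
  else 0

variable (G)

/-- The group-twisted Eilenberg-Zilber map `EZ : (B̄_G ⊗ B̄_S)ₙ → (B̄_{S ⋊ G})ₙ`, given by `ezTerm` on
group elements in the factor `B̄_G`. On `(1 ⊗ g₁ ⊗ ⋯ ⊗ g_m ⊗ 1) ⊗ (1 ⊗ s₁ ⊗ ⋯ ⊗ s_l ⊗ 1)` it is the signed
sum over the shuffles of `1 ⊗ x₁ ⊗ ⋯ ⊗ xₙ ⊗ 1`, where `x` is the shuffled tuple of the `gᵢ` and the
`sᵢ`, each `sᵢ` being acted upon by the product of the `g`'s to its right. -/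
noncomputable def EZ [Fintype G] (n : ℕ) :
    Total k (fun i => Bar k (MonoidAlgebra k G) i) (fun j => Bar k S j) n →ₗ[k]
      Bar k (SkewMonoidAlgebra S G) n :=
  ∑ p : Bidegree n,
    TensorProduct.lift (Bar.lift (∑ γ : Fin (p.1.1 + 2) → G,
      ((MultilinearMap.mkPiAlgebra k (Fin (p.1.1 + 2)) k).compLinearMap
        (fun i => groupCoeff k G (γ i))).smulRight
          (Bar.lift (ezTerm k S p.1.1 p.1.2 p.add_eq γ)))) ∘ₗ
      LinearMap.proj p

end Maps

/-! ### Resolutions and the twisted product -/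

section Resolutions

universe u

/-- A projective resolution `⋯ → X 1 → X 0 → A → 0` of `A` by `A`-bimodules. -/
structure BimoduleResolution (k A : Type*) [Field k] [Ring A] [Algebra k A] where
  X : ℕ → Type u
  [addCommGroup : ∀ n, AddCommGroup (X n)]
  [module : ∀ n, Module k (X n)]
  [leftModule : ∀ n, Module A (X n)]
  [rightModule : ∀ n, Module Aᵐᵒᵖ (X n)]
  [leftTower : ∀ n, IsScalarTower k A (X n)]
  [rightTower : ∀ n, IsScalarTower k Aᵐᵒᵖ (X n)]
  [smulComm : ∀ n, SMulCommClass A Aᵐᵒᵖ (X n)]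
  d : ∀ n, X (n + 1) →ₗ[k] X n
  aug : X 0 →ₗ[k] A
  isBimoduleMap_d : ∀ n, IsBimoduleMap A (d n)
  isBimoduleMap_aug : IsBimoduleMap A aug
  exact_d : ∀ n, Function.Exact (d (n + 1)) (d n)
  exact_aug : Function.Exact (d 0) aug
  surjective_aug : Function.Surjective aug
  projective : ∀ n,
    letI : Module (A ⊗[k] Aᵐᵒᵖ) (X n) := TensorProduct.Algebra.module
    Module.Projective (A ⊗[k] Aᵐᵒᵖ) (X n)

attribute [instance] BimoduleResolution.addCommGroup BimoduleResolution.module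
  BimoduleResolution.leftModule BimoduleResolution.rightModule BimoduleResolution.leftTower
  BimoduleResolution.rightTower BimoduleResolution.smulComm

/-- A projective resolution of `kG` by `kG`-bimodules, together with a `G`-grading that is
compatible with the differentials and satisfies `g₁ (Cₙ)_{g₂} g₃ = (Cₙ)_{g₁ g₂ g₃}`. -/
structure GroupResolution (k G : Type*) [Field k] [Group G] [DecidableEq G] extends
    BimoduleResolution.{u} k (MonoidAlgebra k G) where
  grade : ∀ n, G → Submodule k (X n)
  isInternal : ∀ n, DirectSum.IsInternal (grade n)
  smul_mem : ∀ n (g₁ g₂ g₃ : G), ∀ x ∈ grade n g₂,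
    MonoidAlgebra.of k G g₁ • op (MonoidAlgebra.of k G g₃) • x ∈ grade n (g₁ * g₂ * g₃)
  d_mem : ∀ n g, ∀ x ∈ grade (n + 1) g, d n x ∈ grade n g
  aug_mem : ∀ g, ∀ x ∈ grade 0 g, aug x ∈ Submodule.span k {MonoidAlgebra.of k G g}

/-- A projective resolution of `S` by `S`-bimodules, together with a linear action of `G` that is
compatible with the bimodule structures and with the differentials. -/
structure EquivariantResolution (k S G : Type*) [Field k] [Ring S] [Algebra k S] [Group G]
    [MulSemiringAction G S] extends BimoduleResolution.{u} k S where
  [action : ∀ n, DistribMulAction G (X n)]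
  [action_comm : ∀ n, SMulCommClass G k (X n)]
  smul_left : ∀ n (g : G) (s : S) (x : X n), g • s • x = (g • s) • g • x
  smul_right : ∀ n (g : G) (s : S) (x : X n), g • op s • x = op (g • s) • g • x
  d_smul : ∀ n (g : G) x, d n (g • x) = g • d n x
  aug_smul : ∀ (g : G) x, aug (g • x) = g • aug x

attribute [instance] EquivariantResolution.action EquivariantResolution.action_comm

end Resolutions

section Twisted

universe u v

variable {k S G : Type*} [Field k] [Ring S] [Algebra k S] [Group G] [DecidableEq G]
  [MulSemiringAction G S]

namespace GroupResolution

variable (C : GroupResolution.{u} k G)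

theorem bijective_coeLinearMap (n : ℕ) :
    Function.Bijective (DirectSum.coeLinearMap (C.grade n)) := C.isInternal n

/-- The projection onto the component of degree `g`. -/
noncomputable def proj (n : ℕ) (g : G) : C.X n →ₗ[k] C.X n :=
  (C.grade n g).subtype ∘ₗ DirectSum.component k G (fun g => C.grade n g) g ∘ₗ
    (LinearEquiv.ofBijective (DirectSum.coeLinearMap (C.grade n)) (C.bijective_coeLinearMap n)).symm.toLinearMap

theorem proj_of_mem {n : ℕ} {g x : G} {c : C.X n} (hc : c ∈ C.grade n x) :
    C.proj n g c = if x = g then c else 0 := by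
  have h : (LinearEquiv.ofBijective (DirectSum.coeLinearMap (C.grade n)) (C.bijective_coeLinearMap n)).symm c =
      DirectSum.lof k G (fun g => C.grade n g) x ⟨c, hc⟩ := by
    rw [LinearEquiv.symm_apply_eq]
    simp
  simp only [proj, LinearMap.comp_apply, LinearEquiv.coe_coe, h]
  split_ifs with hx
  · subst hx
    simp [DirectSum.component.lof_self]
  · simp [DirectSum.component.of, hx]

theorem of_smul_mem {n : ℕ} (g : G) {x : G} {c : C.X n} (hc : c ∈ C.grade n x) :
    MonoidAlgebra.of k G g • c ∈ C.grade n (g * x) := by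
  have h := C.smul_mem n g x 1 c hc
  rwa [map_one, op_one, one_smul, mul_one] at h

theorem op_of_smul_mem {n : ℕ} (g : G) {x : G} {c : C.X n} (hc : c ∈ C.grade n x) :
    op (MonoidAlgebra.of k G g) • c ∈ C.grade n (x * g) := by
  have h := C.smul_mem n 1 x g c hc
  rwa [map_one, one_smul, one_mul] at h

/-- Linear maps on `C ⊗ Y` agree if they agree on `c ⊗ y` with `c` homogeneous. -/
theorem ext_homogeneous {n : ℕ} {Y P : Type*} [AddCommGroup Y] [Module k Y] [AddCommGroup P]
    [Module k P] {f f' : C.X n ⊗[k] Y →ₗ[k] P}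
    (h : ∀ (x : G), ∀ c ∈ C.grade n x, ∀ y, f (c ⊗ₜ y) = f' (c ⊗ₜ y)) : f = f' := by
  refine TensorProduct.ext' fun c y => ?_
  obtain ⟨z, rfl⟩ := (C.bijective_coeLinearMap n).2 c
  induction z using DirectSum.induction_on with
  | zero => simp
  | of x c => simpa using h x c c.2 y
  | add a b ha hb => simp only [map_add, TensorProduct.add_tmul, ha, hb]

end GroupResolution

variable [Fintype G] (C : GroupResolution.{u} k G) (D : EquivariantResolution.{v} k S G)

/-- The left action `s · (c ⊗ d) = c ⊗ (x⁻¹ s) · d` of `S`, for `c` homogeneous of degree `x`, as a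
linear map. -/
noncomputable def leftSLinear [SMulCommClass G k S] (i j : ℕ) :
    S →ₗ[k] Module.End k (C.X i ⊗[k] D.X j) :=
  ∑ x : G, TensorProduct.mapBilinear (RingHom.id k) _ _ _ _ (C.proj i x) ∘ₗ
    (Algebra.lsmul k k (D.X j)).toLinearMap ∘ₗ DistribSMul.toLinearMap k S x⁻¹

theorem leftSLinear_tmul [SMulCommClass G k S] {i j : ℕ} {x : G} {c : C.X i}
    (hc : c ∈ C.grade i x) (s : S) (y : D.X j) :
    leftSLinear C D i j s (c ⊗ₜ y) = c ⊗ₜ[k] ((x⁻¹ • s) • y) := by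
  simp only [leftSLinear, LinearMap.sum_apply, LinearMap.comp_apply,
    TensorProduct.mapBilinear_apply, TensorProduct.map_tmul, C.proj_of_mem hc]
  rw [Finset.sum_eq_single x]
  · simp
  · intro b _ hb
    simp [hb.symm]
  · simp

/-- The left action `s · (c ⊗ d) = c ⊗ (x⁻¹ s) · d` of `S`, for `c` homogeneous of degree `x`. -/
noncomputable def leftS [SMulCommClass G k S] (i j : ℕ) :
    S →ₐ[k] Module.End k (C.X i ⊗[k] D.X j) :=
  AlgHom.ofLinearMap (leftSLinear C D i j)
    (C.ext_homogeneous fun x c hc y => by simp [leftSLinear_tmul C D hc])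
    (fun s t => C.ext_homogeneous fun x c hc y => by
      simp [leftSLinear_tmul C D hc, mul_smul])

/-- The left action `g · (c ⊗ d) = gc ⊗ d` of `G`. -/
noncomputable def leftG (i j : ℕ) : G →* Module.End k (C.X i ⊗[k] D.X j) :=
  MonoidHom.comp ((Module.End.rTensorAlgHom k (C.X i) (D.X j)).comp
    (Algebra.lsmul k k (C.X i) : MonoidAlgebra k G →ₐ[k] _) : MonoidAlgebra k G →* _)
    (MonoidAlgebra.of k G)

/-- The right action `(c ⊗ d) · s = c ⊗ ds` of `S`. -/
noncomputable def rightS (i j : ℕ) : S →ₐ[k] (Module.End k (C.X i ⊗[k] D.X j))ᵐᵒᵖ :=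
  AlgHom.opComm.symm ((Module.End.lTensorAlgHom k (D.X j) (C.X i)).comp
    (Algebra.lsmul k k (D.X j) : Sᵐᵒᵖ →ₐ[k] _))

/-- The right action `(c ⊗ d) · g = cg ⊗ g⁻¹d` of `G`. -/
noncomputable def rightG (i j : ℕ) : G →* (Module.End k (C.X i ⊗[k] D.X j))ᵐᵒᵖ where
  toFun g := op (TensorProduct.map (Algebra.lsmul k k (C.X i) (op (MonoidAlgebra.of k G g)))
    (DistribSMul.toLinearMap k (D.X j) g⁻¹))
  map_one' := by
    refine congrArg op (TensorProduct.ext' fun c y => ?_)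
    rw [map_one, op_one, map_one]
    simp
  map_mul' g h := by
    rw [← op_mul]
    refine congrArg op (TensorProduct.ext' fun c y => ?_)
    rw [map_mul, op_mul, map_mul]
    simp [mul_smul]

variable [SMulCommClass G k S]

/-- The left action of `S ⋊ G` on `C i ⊗ D j` determined by `leftS` and `leftG`. -/
noncomputable def leftAction (i j : ℕ) :
    SkewMonoidAlgebra S G →ₐ[k] Module.End k (C.X i ⊗[k] D.X j) :=
  SkewMonoidAlgebra.liftNCAlgHom (leftS C D i j) (leftG C D i j) (fun {s g} => by
    refine C.ext_homogeneous fun x c hc y => ?_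
    have hgc := C.of_smul_mem g hc
    change leftSLinear C D i j (g • s) ((MonoidAlgebra.of k G g • c) ⊗ₜ y) =
      leftG C D i j g (leftSLinear C D i j s (c ⊗ₜ y))
    rw [leftSLinear_tmul C D hc, leftSLinear_tmul C D hgc]
    change _ = (MonoidAlgebra.of k G g • c) ⊗ₜ[k] _
    simp [mul_smul])

/-- The right action of `S ⋊ G` on `C i ⊗ D j` determined by `rightS` and `rightG`. -/
noncomputable def rightAction (i j : ℕ) :
    SkewMonoidAlgebra S G →ₐ[k] (Module.End k (C.X i ⊗[k] D.X j))ᵐᵒᵖ :=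
  SkewMonoidAlgebra.liftNCAlgHom (rightS C D i j) (rightG C D i j) (fun {s g} => by
    refine unop_injective (TensorProduct.ext' fun c y => ?_)
    change (op (MonoidAlgebra.of k G g) • c) ⊗ₜ[k] (g⁻¹ • (op (g • s) • y)) =
      (op (MonoidAlgebra.of k G g) • c) ⊗ₜ[k] (op s • (g⁻¹ • y))
    rw [D.smul_right, inv_smul_smul])

/-- The left `S ⋊ G`-module structure of the components of the twisted product. -/
noncomputable instance leftModule (i j : ℕ) :
    Module (SkewMonoidAlgebra S G) (C.X i ⊗[k] D.X j) :=
  Module.compHom _ (leftAction C D i j).toRingHom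

/-- The right `S ⋊ G`-module structure of the components of the twisted product. -/
noncomputable instance rightModule (i j : ℕ) :
    Module (SkewMonoidAlgebra S G)ᵐᵒᵖ (C.X i ⊗[k] D.X j) :=
  Module.compHom _ (AlgHom.opComm (rightAction C D i j)).toRingHom

theorem single_smul_tmul {i j : ℕ} {x : G} {c : C.X i} (hc : c ∈ C.grade i x) (s : S) (g : G)
    (y : D.X j) :
    SkewMonoidAlgebra.single g s • (c ⊗ₜ[k] y) =
      (MonoidAlgebra.of k G g • c) ⊗ₜ[k] (((g * x)⁻¹ • s) • y) := by
  have hgc := C.of_smul_mem g hc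
  change leftAction C D i j (SkewMonoidAlgebra.single g s) (c ⊗ₜ[k] y) = _
  rw [← leftSLinear_tmul C D hgc]
  have h : leftAction C D i j (SkewMonoidAlgebra.single g s) =
      leftS C D i j s * leftG C D i j g := by
    simp [leftAction, SkewMonoidAlgebra.liftNCAlgHom, SkewMonoidAlgebra.liftNCRingHom]
  rw [h]
  rfl

set_option linter.unusedSectionVars false in
theorem op_single_smul_tmul {i j : ℕ} (c : C.X i) (s : S) (g : G) (y : D.X j) :
    op (SkewMonoidAlgebra.single g s) • (c ⊗ₜ[k] y) =
      (op (MonoidAlgebra.of k G g) • c) ⊗ₜ[k] (g⁻¹ • (op s • y)) := by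
  have h : rightAction C D i j (SkewMonoidAlgebra.single g s) =
      rightS C D i j s * rightG C D i j g := by
    simp [rightAction, SkewMonoidAlgebra.liftNCAlgHom, SkewMonoidAlgebra.liftNCRingHom]
  change (rightAction C D i j (SkewMonoidAlgebra.single g s)).unop (c ⊗ₜ[k] y) = _
  rw [h]
  rfl

/-- The left and right actions of `S ⋊ G` commute. -/
instance smulCommClass (i j : ℕ) :
    SMulCommClass (SkewMonoidAlgebra S G) (SkewMonoidAlgebra S G)ᵐᵒᵖ (C.X i ⊗[k] D.X j) where
  smul_comm a b t := by
    induction b using MulOpposite.rec' with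
    | _ b =>
      induction a with
      | add a a' ha ha' => rw [add_smul, add_smul, smul_add, ha, ha']
      | single g s =>
        induction b with
        | add b b' hb hb' => rw [op_add, add_smul, add_smul, smul_add, hb, hb']
        | single h s' =>
          have key : leftAction C D i j (SkewMonoidAlgebra.single g s) *
                (rightAction C D i j (SkewMonoidAlgebra.single h s')).unop =
              (rightAction C D i j (SkewMonoidAlgebra.single h s')).unop *
                leftAction C D i j (SkewMonoidAlgebra.single g s) :=
            C.ext_homogeneous fun x c hc y => by
              change SkewMonoidAlgebra.single g s • op (SkewMonoidAlgebra.single h s') •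
                  (c ⊗ₜ[k] y) =
                op (SkewMonoidAlgebra.single h s') • SkewMonoidAlgebra.single g s • (c ⊗ₜ[k] y)
              rw [op_single_smul_tmul, single_smul_tmul C D hc,
                single_smul_tmul C D (C.op_of_smul_mem h hc), op_single_smul_tmul,
                smul_comm (MonoidAlgebra.of k G g) (op (MonoidAlgebra.of k G h)) c,
                ← smul_comm ((g * x)⁻¹ • s) (op s') y, D.smul_left,
                ← mul_smul h⁻¹, ← mul_inv_rev, mul_assoc]
          exact LinearMap.congr_fun key t

/-- The augmentation `C₀ ⊗ D₀ → S ⋊ G` of the twisted product, the product in `S ⋊ G` of the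
augmentations of `C` and `D`. -/
noncomputable def twistedAug : Total k C.X D.X 0 →ₗ[k] SkewMonoidAlgebra S G :=
  TensorProduct.lift
    ((LinearMap.mul k (SkewMonoidAlgebra S G)).compl₁₂
      ((∑ g : G, SkewMonoidAlgebra.lsingle (R := k) (M := S) g ∘ₗ
        (groupCoeff k G g).smulRight (1 : S)) ∘ₗ C.aug)
      (SkewMonoidAlgebra.lsingle (R := k) (M := S) 1 ∘ₗ D.aug)) ∘ₗ
    LinearMap.proj (R := k) (φ := fun q : Bidegree 0 => C.X q.1.1 ⊗[k] D.X q.1.2)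
      (Bidegree.mk 0 0 rfl)

/-- For gradings `𝒟 j` of the `D j`, the degree `m` part of the twisted product, where `C` sits in
degree zero. -/
noncomputable def twistedDegreePart {Γ : Type*} (𝒟 : ∀ j, Γ → Submodule k (D.X j)) (n : ℕ) (m : Γ) :
    Submodule k (Total k C.X D.X n) :=
  Submodule.pi Set.univ fun p => LinearMap.range ((𝒟 p.1.2 m).subtype.lTensor (C.X p.1.1))

end Twisted

/-- For a graded algebra `S = ⨁ₘ 𝒮 m`, the degree `m` part of `S ⋊ G`, where `G` sits in degree
zero. -/
noncomputable def skewDegreePart {k S G Γ : Type*} [Field k] [Ring S] [Algebra k S] [Group G]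
    (𝒮 : Γ → Submodule k S) (m : Γ) : Submodule k (SkewMonoidAlgebra S G) :=
  ⨅ g : G, (𝒮 m).comap (skewCoeff k S G g)

end GroupTwisted

/-!
The twisted maps become the classical ones in suitable coordinates. A tensor of elements of
`S ⋊ G` is written as `diag γ w`: its group components are `γ`, and its `S`-components are the
entries of `w`, each transported across the group elements to its right. Multiplication of
neighbours is then componentwise (`contractNth_diag`), so the bar resolution of `S ⋊ G` is the
diagonal of the product of the two bar constructions, and the twisted Alexander-Whitney map is a
signed sum of pairs (back face of `γ`, front face of `w`) (`AW_diag`). That it is a chain map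
(`isChainMap_AW`) is the classical comparison of faces, in which the two superfluous faces cancel.

For the Eilenberg-Zilber map, let `h` be the homotopy `a₀ ⊗ ⋯ ↦ 1 ⊗ a₀ ⊗ ⋯`, which contracts the
bar resolution and vanishes on tensors starting with `1` because the resolution is reduced. A
shuffle starts with the first letter of one of its two words, and therefore `EZ = h ∘ EZ ∘ d` on the
free generators of the twisted product (`ezTerm_eq_homotopy_ezd`). Together with `d h + h d = 1`,
an induction on the degree shows that `EZ` is a chain map (`isChainMap_EZ`). The same recursion
gives `AW ∘ EZ = 1` (`AW_EZ`): the components of `AW (h b)` are obtained from those of `AW b` by the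
homotopies of the two factors (`AW_homotopy_succ`, `AW_homotopy_zero`), and on generators all terms
but one vanish.

Both maps are compatible with the actions of `S ⋊ G` (`ezComponent_smul`, `ezComponent_op_smul`,
`AW_smul_diag`, `AW_op_smul`). An element of `S` acts from the left on `c ⊗ x` through the inverse of
the `G`-degree of `c`, so compatibility with the left action is a statement about homogeneous
elements, and it passes to the composites with the given maps if these preserve degrees. The
remaining assertions follow from `πG ιG = 1`, `πS ιS = 1` and the functoriality of the tensor
product of complexes, from the compatibility with augmentations in degree zero (`aug_ezComponent`,
`aug_AW`), and from the fact that both maps only multiply letters, let `G` act on them, and permute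
them, which does not affect total degrees (`ezTerm_mem_degreePart`, `AW_tuple_mem`).
-/

namespace GroupTwisted

/-! ### Products over subsets of an index set -/

section OrderedProducts

variable {A : Type*} [Monoid A] {N M : ℕ}

/-- The product, in increasing order, of the entries of `v` whose index satisfies `p`. The products
`blockProd`, `fullProd`, `tailProd` and `afterProd` are instances. -/
def prodOver (p : Fin N → Prop) [DecidablePred p] (v : Fin N → A) : A :=
  (((List.finRange N).filter (fun i => p i)).map v).prod

theorem blockProd_apply (φ : Fin N → Fin M) (v : Fin N → A) (j : Fin M) :
    blockProd φ v j = prodOver (fun i => φ i = j) v := rfl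

theorem tailProd_eq (v : Fin N → A) (i : Fin N) : tailProd v i = prodOver (fun j => i ≤ j) v := rfl

theorem afterProd_eq (v : Fin N → A) (i : Fin N) : afterProd v i = prodOver (fun j => i < j) v :=
  rfl

theorem fullProd_eq (v : Fin N → A) : fullProd v = prodOver (fun _ => True) v := by
  simp [fullProd, prodOver, List.ofFn_eq_map]

theorem prodOver_congr {p q : Fin N → Prop} [DecidablePred p] [DecidablePred q] {v w : Fin N → A}
    (hpq : ∀ i, p i ↔ q i) (hvw : ∀ i, q i → v i = w i) : prodOver p v = prodOver q w := by
  obtain rfl : p = q := funext fun i => propext (hpq i)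
  unfold prodOver
  congr 1
  convert List.map_congr_left fun i (hi : i ∈ (List.finRange N).filter (fun i => p i)) =>
    hvw i (by simpa using hi)

theorem prodOver_eq_one {p : Fin N → Prop} [DecidablePred p] {v : Fin N → A}
    (h : ∀ i, p i → v i = 1) : prodOver p v = 1 := by
  refine List.prod_eq_one fun x hx => ?_
  obtain ⟨i, hi, rfl⟩ := List.mem_map.mp hx
  exact h i (by simpa using hi)

theorem prodOver_succ (p : Fin (N + 1) → Prop) [DecidablePred p] (v : Fin (N + 1) → A) :
    prodOver p v = (if p 0 then v 0 else 1) * prodOver (fun i => p i.succ) (fun i => v i.succ) := by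
  simp only [prodOver, List.finRange_succ, List.filter_cons, List.filter_map]
  split_ifs <;> simp_all [Function.comp_def]

theorem prodOver_castSucc (p : Fin (N + 1) → Prop) [DecidablePred p] (v : Fin (N + 1) → A) :
    prodOver p v = prodOver (fun i => p i.castSucc) (fun i => v i.castSucc) *
      (if p (Fin.last N) then v (Fin.last N) else 1) := by
  simp only [prodOver, List.finRange_succ_last, List.filter_append, List.filter_map]
  by_cases h : p (Fin.last N) <;> simp [Function.comp_def, h]

theorem prodOver_split {p q r : Fin N → Prop} [DecidablePred p] [DecidablePred q] [DecidablePred r]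
    (v : Fin N → A) (hr : ∀ i, r i ↔ p i ∨ q i) (hlt : ∀ i j, p i → q j → i < j) :
    prodOver r v = prodOver p v * prodOver q v := by
  induction N with
  | zero => simp [prodOver]
  | succ N ih =>
    rw [prodOver_succ r, prodOver_succ p, prodOver_succ q,
      ih (fun i => v i.succ) (fun i => hr i.succ)
        (fun i j hi hj => Fin.succ_lt_succ_iff.mp (hlt _ _ hi hj))]
    by_cases hq : q 0
    · have hp : ∀ i, ¬ p i := fun i hi => absurd (hlt i 0 hi hq) (Fin.not_lt_zero i)
      have h1 : prodOver (fun i : Fin N => p i.succ) (fun i => v i.succ) = 1 :=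
        prodOver_eq_one fun i hi => absurd hi (hp _)
      simp only [h1, hr, if_neg (hp 0), hq, or_true, if_true, one_mul]
    · simp [hr, hq, mul_assoc]

theorem prodOver_eq_single {p : Fin N → Prop} [DecidablePred p] (v : Fin N → A) (i : Fin N)
    (hi : p i) (h : ∀ j, p j → j ≠ i → v j = 1) : prodOver p v = v i := by
  induction N with
  | zero => exact i.elim0
  | succ N ih =>
    rw [prodOver_succ]
    induction i using Fin.cases with
    | zero =>
      rw [if_pos hi, prodOver_eq_one fun j hj => h _ hj (Fin.succ_ne_zero j), mul_one]
    | succ i =>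
      rw [ih (fun i => v i.succ) i hi fun j hj hji => h _ hj (by simpa using hji)]
      split_ifs with h0
      · rw [h 0 h0 (Fin.succ_ne_zero i).symm, one_mul]
      · rw [one_mul]

theorem blockProd_eq_single (φ : Fin N → Fin M) (v : Fin N → A) (i : Fin N) (j : Fin M)
    (hi : φ i = j) (h : ∀ i', φ i' = j → i' ≠ i → v i' = 1) : blockProd φ v j = v i :=
  prodOver_eq_single v i hi h

theorem map_prodOver {B F : Type*} [Monoid B] [FunLike F A B] [MonoidHomClass F A B] (f : F)
    (p : Fin N → Prop) [DecidablePred p] (v : Fin N → A) :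
    f (prodOver p v) = prodOver p (fun i => f (v i)) := by
  simp [prodOver, map_list_prod, Function.comp_def]

theorem smul_prodOver {H : Type*} [Monoid H] [MulDistribMulAction H A] (g : H)
    (p : Fin N → Prop) [DecidablePred p] (v : Fin N → A) :
    g • prodOver p v = prodOver p (fun i => g • v i) :=
  map_prodOver (MulDistribMulAction.toMonoidHom A g) p v

theorem prodOver_mul_head (p : Fin (N + 1) → Prop) [DecidablePred p] (h0 : p 0)
    (v : Fin (N + 1) → A) (x : A) :
    prodOver p (Function.update v 0 (x * v 0)) = x * prodOver p v := by
  simp [prodOver_succ, h0, mul_assoc]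

theorem prodOver_mul_last (p : Fin (N + 1) → Prop) [DecidablePred p] (h0 : p (Fin.last N))
    (v : Fin (N + 1) → A) (x : A) :
    prodOver p (Function.update v (Fin.last N) (v (Fin.last N) * x)) = prodOver p v * x := by
  have (i : Fin N) : i.castSucc ≠ Fin.last N := (Fin.castSucc_lt_last i).ne
  simp [prodOver_castSucc, h0, mul_assoc, this]

theorem prodOver_update_of_not (p : Fin N → Prop) [DecidablePred p] {i : Fin N} (hi : ¬ p i)
    (v : Fin N → A) (x : A) : prodOver p (Function.update v i x) = prodOver p v :=
  prodOver_congr (fun _ => Iff.rfl) fun j hj =>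
    Function.update_of_ne (by rintro rfl; exact hi hj) _ _

theorem blockProd_mul_head (φ : Fin (N + 1) → Fin (M + 1)) (hφ : φ 0 = 0) (v : Fin (N + 1) → A)
    (x : A) : blockProd φ (Function.update v 0 (x * v 0)) =
      Function.update (blockProd φ v) 0 (x * blockProd φ v 0) := by
  funext j
  by_cases hj : j = 0
  · subst hj
    rw [Function.update_self]
    exact prodOver_mul_head (fun i => φ i = 0) hφ v x
  · rw [Function.update_of_ne hj]
    exact prodOver_update_of_not _ (fun h => hj (h.symm.trans hφ)) v _

theorem blockProd_mul_last (φ : Fin (N + 1) → Fin (M + 1)) (hφ : φ (Fin.last N) = Fin.last M)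
    (v : Fin (N + 1) → A) (x : A) :
    blockProd φ (Function.update v (Fin.last N) (v (Fin.last N) * x)) =
      Function.update (blockProd φ v) (Fin.last M) (blockProd φ v (Fin.last M) * x) := by
  funext j
  by_cases hj : j = Fin.last M
  · subst hj
    rw [Function.update_self]
    exact prodOver_mul_last (fun i => φ i = Fin.last M) hφ v x
  · rw [Function.update_of_ne hj]
    exact prodOver_update_of_not _ (fun h => hj (h.symm.trans hφ)) v _

/-- If the entries before the index `i` are trivial, then multiplying the entry at `i` from the left
amounts to multiplying the whole product from the left. -/
theorem prodOver_update_mul (q : Fin M → Prop) [DecidablePred q] (u : Fin M → A) (i : Fin M)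
    (hu : ∀ j, j < i → u j = 1) (x : A) :
    prodOver q (Function.update u i (x * u i)) = (if q i then x else 1) * prodOver q u := by
  induction M with
  | zero => exact i.elim0
  | succ M ih =>
    rw [prodOver_succ, prodOver_succ q u]
    induction i using Fin.cases with
    | zero => split_ifs <;> simp [mul_assoc]
    | succ i =>
      have h := ih (fun i => q i.succ) (fun i => u i.succ) i
        (fun j hj => hu _ (Fin.succ_lt_succ_iff.mpr hj))
      have e : (fun j : Fin M => Function.update u i.succ (x * u i.succ) j.succ) =
          Function.update (fun j : Fin M => u j.succ) i (x * u i.succ) := by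
        funext j
        by_cases hj : j = i
        · subst hj; simp
        · rw [Function.update_of_ne hj, Function.update_of_ne (by simpa using hj)]
      rw [e, h, Function.update_of_ne (Fin.succ_ne_zero i).symm, hu 0 (Fin.succ_pos i)]
      simp

/-- Products of products over the consecutive blocks of a monotone map are products of the original
entries. -/
theorem prodOver_blockProd (φ : Fin N → Fin M) (hφ : Monotone φ) (q : Fin M → Prop)
    [DecidablePred q] (v : Fin N → A) :
    prodOver q (blockProd φ v) = prodOver (fun i => q (φ i)) v := by
  induction N with
  | zero => exact prodOver_eq_one fun _ _ => rfl
  | succ N ih =>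
    have e : blockProd φ v = Function.update (blockProd (fun i => φ i.succ) (fun i => v i.succ))
        (φ 0) (v 0 * blockProd (fun i => φ i.succ) (fun i => v i.succ) (φ 0)) := by
      funext j
      rw [blockProd_apply, prodOver_succ]
      by_cases hj : φ 0 = j
      · subst hj
        rw [if_pos rfl, Function.update_self]
        rfl
      · rw [if_neg hj, one_mul, Function.update_of_ne (Ne.symm hj)]
        rfl
    rw [e, prodOver_update_mul, ih _ (fun a b h => hφ (Fin.succ_le_succ_iff.mpr h)),
      prodOver_succ (fun i => q (φ i))]
    intro j hj
    refine prodOver_eq_one fun i hi => absurd hj (not_lt.mpr ?_)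
    rw [← hi]
    exact hφ (Fin.zero_le _)

theorem blockProd_blockProd {L : ℕ} (φ : Fin N → Fin M) (hφ : Monotone φ) (ψ : Fin M → Fin L)
    (v : Fin N → A) : blockProd ψ (blockProd φ v) = blockProd (fun i => ψ (φ i)) v :=
  funext fun _ => prodOver_blockProd φ hφ _ v

theorem fullProd_blockProd (φ : Fin N → Fin M) (hφ : Monotone φ) (v : Fin N → A) :
    fullProd (blockProd φ v) = fullProd v := by
  rw [fullProd_eq, prodOver_blockProd φ hφ, fullProd_eq]

/-- The map of indices that merges the indices `j` and `j + 1`. The truncated subtraction subtracts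
`1` exactly from the indices larger than `j`. -/
def mergeMap (j : ℕ) (hj : j < N + 1) (i : Fin (N + 2)) : Fin (N + 1) :=
  ⟨i - min 1 (i - j), by omega⟩

theorem monotone_mergeMap (j : ℕ) (hj : j < N + 1) : Monotone (mergeMap j hj) := by
  intro a b h
  simp only [mergeMap, Fin.le_def] at h ⊢
  omega

/-- A face of a tuple is the tuple of products over the blocks of a monotone map. -/
theorem contractNth_eq_blockProd (j : Fin (N + 1)) (v : Fin (N + 2) → A) :
    Fin.contractNth j.castSucc (· * ·) v = blockProd (mergeMap j j.isLt) v := by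
  funext r
  simp only [Fin.contractNth, Fin.val_castSucc]
  rw [blockProd_apply]
  split_ifs with h1 h2
  · refine (prodOver_eq_single (p := fun i => mergeMap j j.isLt i = r) v _ (Fin.ext ?_)
      fun i hi hne => absurd (Fin.ext ?_) hne).symm
    · simp only [mergeMap, Fin.val_castSucc]; omega
    · have := congrArg Fin.val hi
      simp only [mergeMap] at this
      simp only [Fin.val_castSucc]
      omega
  · rw [prodOver_split (p := fun i => i = r.castSucc) (q := fun i => i = r.succ) v,
      prodOver_eq_single (p := fun i => i = r.castSucc) v r.castSucc rfl fun i hi h => absurd hi h,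
      prodOver_eq_single (p := fun i => i = r.succ) v r.succ rfl fun i hi h => absurd hi h]
    · intro i
      simp only [mergeMap, Fin.ext_iff, Fin.val_castSucc, Fin.val_succ]
      omega
    · rintro i i' rfl rfl
      exact Fin.castSucc_lt_succ
  · refine (prodOver_eq_single (p := fun i => mergeMap j j.isLt i = r) v _ (Fin.ext ?_)
      fun i hi hne => absurd (Fin.ext ?_) hne).symm
    · simp only [mergeMap, Fin.val_succ]
      omega
    · have := congrArg Fin.val hi
      simp only [mergeMap] at this
      simp only [Fin.val_succ]
      omega

end OrderedProducts

/-! ### Elementary properties of the reduced bar resolution -/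

namespace Bar

section Basic

variable {k A : Type*} [Field k] [Ring A] [Algebra k A] {n : ℕ}

theorem tuple_apply (v : Fin (n + 2) → A) :
    tuple k A v = (show A ⊗[k] ((⨂[k] _ : Fin n, Reduced k A) ⊗[k] A) from
      v 0 ⊗ₜ[k] (PiTensorProduct.tprod k
        (fun i : Fin n => (Submodule.Quotient.mk (v i.castSucc.succ) : Reduced k A)) ⊗ₜ[k]
          v (Fin.last (n + 1)))) := rfl

theorem span_tuple : Submodule.span k (Set.range (tuple k A (n := n))) = ⊤ := by
  suffices h : ∀ x : A ⊗[k] ((⨂[k] _ : Fin n, Reduced k A) ⊗[k] A),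
      (show Bar k A n from x) ∈ Submodule.span k (Set.range (tuple k A (n := n))) from
    eq_top_iff.mpr fun x _ => h x
  intro x
  induction x using TensorProduct.induction_on with
  | zero => exact zero_mem _
  | add x y hx hy => exact add_mem hx hy
  | tmul a x =>
    induction x using TensorProduct.induction_on with
    | zero => rw [TensorProduct.tmul_zero]; exact zero_mem _
    | add x y hx hy => rw [TensorProduct.tmul_add]; exact add_mem hx hy
    | tmul p b =>
      induction p using PiTensorProduct.induction_on with
      | smul_tprod r q =>
        choose u hu using fun i => Submodule.Quotient.mk_surjective _ (q i)
        have e : tuple k A (Fin.cons a (Fin.snoc (α := fun _ => A) u b) : Fin (n + 2) → A) =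
            (show A ⊗[k] ((⨂[k] _ : Fin n, Reduced k A) ⊗[k] A) from
              a ⊗ₜ[k] (PiTensorProduct.tprod k q ⊗ₜ[k] b)) := by
          rw [tuple_apply]
          simp only [Fin.cons_zero, Fin.cons_succ, Fin.snoc_castSucc, hu, ← Fin.succ_last,
            Fin.snoc_last]
          rfl
        rw [← TensorProduct.smul_tmul', TensorProduct.tmul_smul]
        refine Submodule.smul_mem _ r ?_
        change (show A ⊗[k] ((⨂[k] _ : Fin n, Reduced k A) ⊗[k] A) from
              a ⊗ₜ[k] (PiTensorProduct.tprod k q ⊗ₜ[k] b)) ∈ _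
        rw [← e]
        exact Submodule.subset_span ⟨_, rfl⟩
      | add p q hp hq =>
        rw [TensorProduct.add_tmul, TensorProduct.tmul_add]; exact add_mem hp hq

/-- Linear maps on the bar resolution agree if they agree on tuples. -/
theorem ext_tuple {N : Type*} [AddCommGroup N] [Module k N] {f g : Bar k A n →ₗ[k] N}
    (h : ∀ v, f (tuple k A v) = g (tuple k A v)) : f = g :=
  LinearMap.ext_on_range span_tuple h

theorem smul_tuple (a : A) (v : Fin (n + 2) → A) :
    a • tuple k A v = tuple k A (Function.update v 0 (a * v 0)) := by
  rw [tuple_apply, tuple_apply]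
  simp only [Function.update_self, ne_eq, Fin.succ_ne_zero, not_false_eq_true,
    Function.update_of_ne, Fin.last_pos.ne']
  rfl

theorem tuple_eq_smul (v : Fin (n + 2) → A) :
    tuple k A v = v 0 • tuple k A (Function.update v 0 1) := by
  simp [smul_tuple]

theorem op_smul_tuple (a : A) (v : Fin (n + 2) → A) :
    op a • tuple k A v =
      tuple k A (Function.update v (Fin.last (n + 1)) (v (Fin.last (n + 1)) * a)) := by
  rw [tuple_apply, tuple_apply]
  simp only [Function.update_self, ne_eq, (last_ne_middle _).symm, not_false_eq_true,
    Function.update_of_ne, Fin.last_pos.ne]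
  rfl

instance : SMulCommClass k A (Bar k A n) :=
  inferInstanceAs (SMulCommClass k A (A ⊗[k] ((⨂[k] _ : Fin n, Reduced k A) ⊗[k] A)))

instance : SMulCommClass k Aᵐᵒᵖ (Bar k A n) where
  smul_comm c a x := by
    exact (LinearMap.map_smul
      (Module.End.lTensorAlgHom k ((⨂[k] _ : Fin n, Reduced k A) ⊗[k] A) A
        (Module.End.lTensorAlgHom k A (⨂[k] _ : Fin n, Reduced k A) (Algebra.lsmul k k A a)))
      c (show A ⊗[k] ((⨂[k] _ : Fin n, Reduced k A) ⊗[k] A) from x)).symm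

variable (k n) in
/-- Left multiplication by `a` as a linear map. -/
noncomputable def leftMul (a : A) : Bar k A n →ₗ[k] Bar k A n where
  toFun x := a • x
  map_add' := smul_add a
  map_smul' c x := (smul_comm c a x).symm

variable (k n) in
/-- Right multiplication by `a` as a linear map. -/
noncomputable def rightMul (a : A) : Bar k A n →ₗ[k] Bar k A n where
  toFun x := op a • x
  map_add' := smul_add (op a)
  map_smul' c x := (smul_comm c (op a) x).symm

theorem groupAct_tuple {G : Type*} [Group G] [MulSemiringAction G A] [SMulCommClass G k A]
    (g : G) (v : Fin (n + 2) → A) :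
    groupAct k A n g (tuple k A v) = tuple k A (fun i => g • v i) := by
  rw [groupAct, lift_tuple]
  · rfl
  · intro v i hv
    refine tuple_eq_zero k A (fun i => g • v i) i ?_
    simp only [hv]
    exact smul_one g

theorem aug_tuple (v : Fin 2 → A) : aug k A (tuple k A v) = v 0 * v 1 := by
  rw [aug, lift_tuple]
  · simp [MultilinearMap.mkPiAlgebraFin_apply]
  · intro v i; exact i.elim0

theorem contractNth_zero_cons (x : A) (v : Fin (n + 2) → A) :
    Fin.contractNth (0 : Fin (n + 2)).castSucc (· * ·) (Fin.cons x v : Fin (n + 3) → A) =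
      Function.update v 0 (x * v 0) := by
  funext r
  induction r using Fin.cases with
  | zero => simp [Fin.contractNth]
  | succ r => simp [Fin.contractNth]

theorem contractNth_succ_cons (j : Fin (n + 2)) (x : A) (v : Fin (n + 3) → A) :
    Fin.contractNth j.succ.castSucc (· * ·) (Fin.cons x v : Fin (n + 4) → A) =
      Fin.cons x (Fin.contractNth j.castSucc (· * ·) v) := by
  funext r
  induction r using Fin.cases with
  | zero => simp [Fin.contractNth]
  | succ r => simp [Fin.contractNth]

theorem contractNth_smul_head (j : Fin (n + 2)) (a : A) (v : Fin (n + 3) → A) :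
    Fin.contractNth j.castSucc (· * ·) (Function.update v 0 (a * v 0)) =
      Function.update (Fin.contractNth j.castSucc (· * ·) v) 0
        (a * Fin.contractNth j.castSucc (· * ·) v 0) := by
  rw [contractNth_eq_blockProd, contractNth_eq_blockProd]
  exact blockProd_mul_head _ (by simp [mergeMap]) v a

theorem d_smul (a : A) (x : Bar k A (n + 1)) : d k A n (a • x) = a • d k A n x := by
  refine LinearMap.congr_fun (f := d k A n ∘ₗ leftMul k (n + 1) a) (g := leftMul k n a ∘ₗ d k A n)
    (ext_tuple fun v => ?_) x
  change d k A n (a • tuple k A v) = leftMul k n a (d k A n (tuple k A v))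
  rw [smul_tuple, d_tuple, d_tuple, map_sum]
  refine Finset.sum_congr rfl fun j _ => ?_
  rw [map_smul, contractNth_smul_head, ← smul_tuple]
  rfl

/-- The homotopy `a₀ ⊗ ⋯ ⊗ aₙ₊₁ ↦ 1 ⊗ a₀ ⊗ ⋯ ⊗ aₙ₊₁` contracting the bar resolution. -/
noncomputable def homotopy (k A : Type*) [Field k] [Ring A] [Algebra k A] (n : ℕ) :
    Bar k A n →ₗ[k] Bar k A (n + 1) :=
  lift ((tuple k A (n := n + 1)).curryLeft 1)

theorem homotopy_tuple (v : Fin (n + 2) → A) :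
    homotopy k A n (tuple k A v) = tuple k A (Fin.cons 1 v : Fin (n + 3) → A) := by
  rw [homotopy, lift_tuple]
  · rfl
  · intro v i hv
    exact tuple_eq_zero k A (n := n + 1) _ i.succ hv

/-- The homotopy vanishes on `1 ⊗ a₁ ⊗ ⋯ ⊗ aₙ₊₁`: this is where the bar resolution has to be
reduced. -/
theorem homotopy_tuple_eq_zero (v : Fin (n + 2) → A) (hv : v 0 = 1) :
    homotopy k A n (tuple k A v) = 0 := by
  rw [homotopy_tuple]
  exact tuple_eq_zero k A (n := n + 1) _ 0 hv

theorem tuple_eq_smul_homotopy (v : Fin (n + 3) → A) :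
    tuple k A v = v 0 • homotopy k A n (tuple k A (Fin.tail v)) := by
  rw [homotopy_tuple, smul_tuple]
  congr 1
  rw [Fin.cons_zero, mul_one, Fin.update_cons_zero, Fin.cons_self_tail]

theorem d_homotopy (x : Bar k A (n + 1)) :
    d k A (n + 1) (homotopy k A (n + 1) x) = x - homotopy k A n (d k A n x) := by
  refine LinearMap.congr_fun (f := d k A (n + 1) ∘ₗ homotopy k A (n + 1))
    (g := LinearMap.id - homotopy k A n ∘ₗ d k A n) (ext_tuple fun v => ?_) x
  simp only [LinearMap.comp_apply, LinearMap.sub_apply, LinearMap.id_apply]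
  rw [homotopy_tuple, d_tuple, Fin.sum_univ_succ, d_tuple, map_sum, contractNth_zero_cons,
    sub_eq_add_neg, ← Finset.sum_neg_distrib]
  congr 1
  · simp
  · refine Finset.sum_congr rfl fun j _ => ?_
    rw [contractNth_succ_cons, map_smul, homotopy_tuple, Fin.val_succ, pow_succ]
    simp

/-- The map `a ↦ 1 ⊗ a`, which completes `homotopy` to a contraction of the augmented complex. -/
noncomputable def unit (k A : Type*) [Field k] [Ring A] [Algebra k A] : A →ₗ[k] Bar k A 0 :=
  (tuple k A (n := 0)).toLinearMap (fun _ => 1) 1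

theorem d_homotopy_zero (x : Bar k A 0) :
    d k A 0 (homotopy k A 0 x) = x - unit k A (aug k A x) := by
  refine LinearMap.congr_fun (f := d k A 0 ∘ₗ homotopy k A 0)
    (g := LinearMap.id - unit k A ∘ₗ aug k A) (ext_tuple fun v => ?_) x
  simp only [LinearMap.comp_apply, LinearMap.sub_apply, LinearMap.id_apply]
  rw [homotopy_tuple, d_tuple, Fin.sum_univ_two, contractNth_zero_cons, aug_tuple,
    sub_eq_add_neg]
  congr 1
  · simp
  · simp only [Fin.val_one, pow_one, neg_smul, one_smul, neg_inj]
    change tuple k A _ = tuple k A _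
    congr 1
    funext r
    fin_cases r
    · simp [Fin.contractNth]
    · simp [Fin.contractNth]
      rfl

theorem aug_d (x : Bar k A 1) : aug k A (d k A 0 x) = 0 := by
  refine LinearMap.congr_fun (f := aug k A ∘ₗ d k A 0) (g := 0) (ext_tuple fun v => ?_) x
  simp [d_tuple, Fin.sum_univ_two, aug_tuple, Fin.contractNth, mul_assoc]

/-- Every tuple is a multiple of an element of the image of the homotopy, and there the identity
follows by induction from `d h = 1 - h d`. -/
theorem d_d (x : Bar k A (n + 2)) : d k A n (d k A (n + 1) x) = 0 := by
  induction n with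
  | zero =>
    refine LinearMap.congr_fun (f := d k A 0 ∘ₗ d k A 1) (g := 0) (ext_tuple fun v => ?_) x
    rw [LinearMap.comp_apply, tuple_eq_smul_homotopy, d_smul, d_smul, d_homotopy, map_sub,
      d_homotopy_zero, aug_d]
    simp
  | succ n ih =>
    refine LinearMap.congr_fun (f := d k A (n + 1) ∘ₗ d k A (n + 2)) (g := 0)
      (ext_tuple fun v => ?_) x
    rw [LinearMap.comp_apply, tuple_eq_smul_homotopy, d_smul, d_smul, d_homotopy, map_sub,
      d_homotopy, ih]
    simp

theorem smul_add_smul_of_eq_d {x y : Bar k A n} {z : Bar k A (n + 1)} (h : x + y = d k A n z)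
    (a : A) : a • x + a • y = d k A n (a • z) := by
  rw [← smul_add, h, d_smul]

theorem d_homotopy_of_d_eq_zero {x : Bar k A (n + 1)} (hx : d k A n x = 0) :
    d k A (n + 1) (homotopy k A (n + 1) x) = x := by
  rw [d_homotopy, hx, map_zero, sub_zero]

theorem d_homotopy_zero_of_mem_ker {x : Bar k A 0} (hx : x ∈ LinearMap.ker (aug k A)) :
    d k A 0 (homotopy k A 0 x) = x := by
  rw [d_homotopy_zero, LinearMap.mem_ker.mp hx, map_zero, sub_zero]

end Basic

end Bar

/-! ### Diagonal coordinates on the bar resolution of the skew group algebra -/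

section Diag

variable {k S G : Type*} [Field k] [Ring S] [Algebra k S] [Group G] [MulSemiringAction G S] {n : ℕ}

/-- The element `s g` of `S ⋊ G`. -/
noncomputable abbrev skewSingle (g : G) (s : S) : SkewMonoidAlgebra S G :=
  SkewMonoidAlgebra.single g s

/-- The tuple of elements of `S ⋊ G` with group components `γ i` and with the `S`-components `w i`
transported across the group elements to the right of them. In these coordinates multiplication of
neighbours is componentwise (`contractNth_diag`), so that the bar resolution of `S ⋊ G` becomes the
diagonal of the bisimplicial product of the bar constructions of `kG` and of `S`. -/
noncomputable def diag {N : ℕ} (γ : Fin N → G) (w : Fin N → S) : Fin N → SkewMonoidAlgebra S G :=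
  fun i => SkewMonoidAlgebra.single (γ i) (tailProd γ i • w i)

theorem diag_eq_one {N : ℕ} {γ : Fin N → G} {w : Fin N → S} {i : Fin N} (hγ : γ i = 1)
    (hw : w i = 1) : diag γ w i = 1 := by
  rw [diag, hγ, hw, smul_one, SkewMonoidAlgebra.one_def]

theorem tailProd_mergeMap {N : ℕ} (j : Fin (N + 1)) (γ : Fin (N + 2) → G) (r : Fin (N + 1)) :
    tailProd (blockProd (mergeMap j j.isLt) γ) r =
      tailProd γ (if (r : ℕ) ≤ j then r.castSucc else r.succ) := by
  rw [tailProd_eq, prodOver_blockProd _ (monotone_mergeMap _ _)]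
  refine prodOver_congr (fun i => ?_) fun _ _ => rfl
  simp only [mergeMap, Fin.le_def]
  split_ifs <;> simp only [Fin.val_castSucc, Fin.val_succ] <;> omega

theorem tailProd_castSucc {N : ℕ} (γ : Fin (N + 1) → G) (r : Fin N) :
    tailProd γ r.castSucc = γ r.castSucc * tailProd γ r.succ := by
  rw [tailProd_eq, prodOver_split (p := fun i => i = r.castSucc) (q := fun i => r.succ ≤ i) γ,
    prodOver_eq_single (p := fun i => i = r.castSucc) γ r.castSucc rfl fun i hi h => absurd hi h]
  · rfl
  · intro i
    simp only [Fin.le_def, Fin.ext_iff, Fin.val_castSucc, Fin.val_succ]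
    omega
  · rintro i i' rfl h
    exact Fin.castSucc_lt_succ.trans_le h

theorem contractNth_diag (j : Fin (n + 2)) (γ : Fin (n + 3) → G) (w : Fin (n + 3) → S) :
    Fin.contractNth j.castSucc (· * ·) (diag γ w) =
      diag (Fin.contractNth j.castSucc (· * ·) γ) (Fin.contractNth j.castSucc (· * ·) w) := by
  funext r
  simp only [diag]
  conv_rhs => rw [contractNth_eq_blockProd j γ, tailProd_mergeMap, ← contractNth_eq_blockProd j γ]
  simp only [Fin.contractNth, Fin.val_castSucc]
  split_ifs with h1 h2 h3 h4 h5
  · rfl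
  · omega
  · simp only [diag, SkewMonoidAlgebra.single_mul_single, smul_mul', tailProd_castSucc γ r,
      mul_smul]
  · omega
  · omega
  · rfl

/-- Linear maps on the bar resolution of `S ⋊ G` agree if they agree in diagonal coordinates. -/
theorem ext_diag [Fintype G] [SMulCommClass G k S] {N : Type*} [AddCommGroup N] [Module k N]
    {f g : Bar k (SkewMonoidAlgebra S G) n →ₗ[k] N}
    (h : ∀ γ w, f (Bar.tuple k (SkewMonoidAlgebra S G) (diag γ w)) =
      g (Bar.tuple k (SkewMonoidAlgebra S G) (diag γ w))) : f = g := by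
  classical
  refine Bar.ext_tuple fun v => ?_
  have hv : v = fun i => ∑ x : G, SkewMonoidAlgebra.single x (skewCoeff k S G x (v i)) := by
    funext i
    have := SkewMonoidAlgebra.sum_single (v i)
    rw [SkewMonoidAlgebra.sum_def, Finsupp.sum_fintype _ _ (by simp)] at this
    exact this.symm
  rw [hv, MultilinearMap.map_sum, map_sum, map_sum]
  refine Finset.sum_congr rfl fun γ _ => ?_
  have e : (fun i => SkewMonoidAlgebra.single (γ i) (skewCoeff k S G (γ i) (v i))) =
      diag γ (fun i => (tailProd γ i)⁻¹ • skewCoeff k S G (γ i) (v i)) := by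
    funext i
    rw [diag, smul_inv_smul]
  rw [e, h]

omit [Group G] [MulSemiringAction G S] in
theorem skewCoeff_single [DecidableEq G] (g x : G) (s : S) :
    skewCoeff k S G g (SkewMonoidAlgebra.single x s) = if x = g then s else 0 := by
  change (SkewMonoidAlgebra.single x s).coeff g = _
  rw [SkewMonoidAlgebra.coeff_single_apply]

omit [MulSemiringAction G S] in
theorem skewCoeff_one [DecidableEq G] (g : G) :
    skewCoeff k S G g 1 = if 1 = g then 1 else 0 := by
  rw [SkewMonoidAlgebra.one_def, skewCoeff_single]

end Diag

/-! ### The Alexander-Whitney map -/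

section AlexanderWhitney

/-- The map of indices that merges the indices `0, …, l`. -/
def backMap {n m l : ℕ} (h : m + l = n) (i : Fin (n + 2)) : Fin (m + 2) := ⟨i - l, by omega⟩

/-- The map of indices that merges all indices from `l + 1` on. -/
def frontMap {n m l : ℕ} (_ : m + l = n) (i : Fin (n + 2)) : Fin (l + 2) :=
  ⟨min i (l + 1), by omega⟩

theorem monotone_backMap {n m l : ℕ} (h : m + l = n) : Monotone (backMap h) := by
  intro a b hab
  simp only [backMap, Fin.le_def] at hab ⊢
  omega

theorem monotone_frontMap {n m l : ℕ} (h : m + l = n) : Monotone (frontMap h) := by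
  intro a b hab
  simp only [frontMap, Fin.le_def] at hab ⊢
  omega

variable {k S G : Type*} [Field k] [Ring S] [Algebra k S] [Group G] [MulSemiringAction G S]
  [SMulCommClass G k S] {n : ℕ}

/-- The basis element `g₀ ⊗ ⋯ ⊗ gₘ₊₁` of the bar resolution of `kG`. -/
noncomputable def groupTuple (k : Type*) [Field k] {G : Type*} [Group G] {m : ℕ}
    (γ : Fin (m + 2) → G) : Bar k (MonoidAlgebra k G) m :=
  Bar.tuple k (MonoidAlgebra k G) (fun j => MonoidAlgebra.of k G (γ j))

theorem groupTuple_eq_zero {m : ℕ} {γ : Fin (m + 2) → G} (i : Fin (m + 2)) (h0 : 0 < (i : ℕ))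
    (h1 : (i : ℕ) ≤ m) (hi : γ i = 1) : groupTuple k γ = 0 := by
  refine Bar.tuple_eq_zero k (MonoidAlgebra k G) _ ⟨i - 1, by omega⟩ ?_
  have e : (⟨i - 1, by omega⟩ : Fin m).castSucc.succ = i := Fin.ext (by simp; omega)
  rw [e, hi, map_one]

theorem awTerm_apply {m l : ℕ} (h : m + l = n) (γ : Fin (n + 2) → G) (s : Fin (n + 2) → S) :
    awTerm k S m l h γ s = (-1 : k) ^ (l * m) • (groupTuple k (blockProd (backMap h) γ) ⊗ₜ[k]
      Bar.tuple k S (blockProd (frontMap h) (fun i => (tailProd γ i)⁻¹ • s i))) := rfl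

/-- Depending on its position, a trivial letter stays a letter of the front face of `s` or of the
back face of `γ`. -/
theorem awTerm_eq_zero {m l : ℕ} (h : m + l = n) (γ : Fin (n + 2) → G) (s : Fin (n + 2) → S)
    (i : Fin n) (hγ : γ i.castSucc.succ = 1) (hs : s i.castSucc.succ = 1) :
    awTerm k S m l h γ s = 0 := by
  rw [awTerm_apply]
  by_cases hi : (i : ℕ) < l
  · rw [Bar.tuple_eq_zero k S _ ⟨i, hi⟩, TensorProduct.tmul_zero, smul_zero]
    rw [blockProd_eq_single _ _ i.castSucc.succ, hs, smul_one]
    · exact Fin.ext (by simp [frontMap]; omega)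
    · intro i' hi' hne
      refine absurd (Fin.ext ?_) hne
      have := congrArg Fin.val hi'
      simp only [frontMap, Fin.val_succ, Fin.val_castSucc] at this ⊢
      omega
  · rw [groupTuple_eq_zero ⟨i + 1 - l, by omega⟩ (by simp; omega) (by simp; omega),
      TensorProduct.zero_tmul, smul_zero]
    rw [blockProd_eq_single _ _ i.castSucc.succ, hγ]
    · exact Fin.ext (by simp [backMap])
    · intro i' hi' hne
      refine absurd (Fin.ext ?_) hne
      have := congrArg Fin.val hi'
      simp only [backMap, Fin.val_succ, Fin.val_castSucc] at this ⊢
      omega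

theorem AW_tuple [Fintype G] (v : Fin (n + 2) → SkewMonoidAlgebra S G) (p : Bidegree n) :
    AW k S n (Bar.tuple k (SkewMonoidAlgebra S G) v) p = ∑ γ : Fin (n + 2) → G,
      awTerm k S p.1.1 p.1.2 p.add_eq γ (fun i => skewCoeff k S G (γ i) (v i)) := by
  classical
  rw [AW, LinearMap.pi_apply, Bar.lift_tuple]
  · simp
  · intro v i hv
    rw [sum_apply]
    refine Finset.sum_eq_zero fun γ _ => ?_
    rw [MultilinearMap.compLinearMap_apply]
    by_cases hγ : 1 = γ i.castSucc.succ
    · refine awTerm_eq_zero _ _ _ i hγ.symm ?_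
      rw [hv, skewCoeff_one, if_pos hγ]
    · refine MultilinearMap.map_coord_zero _ i.castSucc.succ ?_
      rw [hv, skewCoeff_one, if_neg hγ]

theorem AW_single [Fintype G] (γ : Fin (n + 2) → G) (s : Fin (n + 2) → S) (p : Bidegree n) :
    AW k S n (Bar.tuple k (SkewMonoidAlgebra S G)
      (fun i => SkewMonoidAlgebra.single (γ i) (s i))) p = awTerm k S p.1.1 p.1.2 p.add_eq γ s := by
  classical
  rw [AW_tuple, Finset.sum_eq_single γ]
  · congr 1
    funext i
    rw [skewCoeff_single, if_pos rfl]
  · intro γ' _ hne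
    obtain ⟨i, hi⟩ := Function.ne_iff.mp hne
    refine MultilinearMap.map_coord_zero _ i ?_
    rw [skewCoeff_single, if_neg (Ne.symm hi)]
  · simp

/-- In diagonal coordinates the twisted Alexander-Whitney map is the classical one. -/
theorem AW_diag [Fintype G] (γ : Fin (n + 2) → G) (w : Fin (n + 2) → S) (p : Bidegree n) :
    AW k S n (Bar.tuple k (SkewMonoidAlgebra S G) (diag γ w)) p = (-1 : k) ^ (p.1.2 * p.1.1) •
      (groupTuple k (blockProd (backMap p.add_eq) γ) ⊗ₜ[k]
        Bar.tuple k S (blockProd (frontMap p.add_eq) w)) := by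
  unfold diag
  rw [AW_single, awTerm_apply]
  simp only [inv_smul_smul]

theorem AW_diag_mk [Fintype G] (γ : Fin (n + 2) → G) (w : Fin (n + 2) → S) {m l : ℕ}
    (h : m + l = n) :
    (AW k S n (Bar.tuple k (SkewMonoidAlgebra S G) (diag γ w)) (Bidegree.mk m l h) :
      Bar k (MonoidAlgebra k G) m ⊗[k] Bar k S l) = (-1 : k) ^ (l * m) •
      (groupTuple k (blockProd (backMap h) γ) ⊗ₜ[k]
        Bar.tuple k S (blockProd (frontMap h) w)) :=
  AW_diag γ w (Bidegree.mk m l h)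

theorem d_groupTuple {m : ℕ} (γ : Fin (m + 3) → G) :
    Bar.d k (MonoidAlgebra k G) m (groupTuple k γ) = ∑ j : Fin (m + 2), (-1 : k) ^ (j : ℕ) •
      groupTuple k (Fin.contractNth j.castSucc (· * ·) γ) := by
  rw [groupTuple, Bar.d_tuple]
  refine Finset.sum_congr rfl fun j _ => ?_
  congr 2
  exact funext fun r => (congrFun (Fin.comp_contractNth (· * ·) (· * ·)
    (f := MonoidAlgebra.of k G) (fun x y => map_mul _ x y) j.castSucc γ) r).symm

theorem d_diag (γ : Fin (n + 3) → G) (w : Fin (n + 3) → S) :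
    Bar.d k (SkewMonoidAlgebra S G) n (Bar.tuple k (SkewMonoidAlgebra S G) (diag γ w)) =
      ∑ j : Fin (n + 2), (-1 : k) ^ (j : ℕ) • Bar.tuple k _
        (diag (Fin.contractNth j.castSucc (· * ·) γ) (Fin.contractNth j.castSucc (· * ·) w)) := by
  rw [Bar.d_tuple]
  simp only [contractNth_diag]

/-- An alternating sum over `n + 2` terms splits into the first `l + 1` and the last `m + 1` terms;
the two terms added to complete the alternating sums on the right cancel. -/
theorem alternating_sum_glue {P : Type*} [AddCommGroup P] [Module k P] {m l : ℕ} (h : m + l = n)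
    (T : Fin (n + 2) → P) (a : Fin (m + 2) → P) (b : Fin (l + 2) → P)
    (hb : ∀ (j : Fin (n + 2)) (hj : (j : ℕ) ≤ l), T j = b ⟨j, by omega⟩)
    (ha : ∀ (j : Fin (n + 2)) (hj : l < (j : ℕ)), T j = a ⟨j - l, by omega⟩)
    (hab : a 0 = b (Fin.last (l + 1))) :
    ∑ j : Fin (n + 2), (-1 : k) ^ (j : ℕ) • T j =
      (-1 : k) ^ l • ∑ i : Fin (m + 2), (-1 : k) ^ (i : ℕ) • a i +
        ∑ i : Fin (l + 2), (-1 : k) ^ (i : ℕ) • b i := by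
  have hn : (l + 1) + (m + 1) = n + 2 := by omega
  rw [Fin.sum_univ_succ (fun i : Fin (m + 2) => (-1 : k) ^ (i : ℕ) • a i),
    Fin.sum_univ_castSucc (fun i : Fin (l + 2) => (-1 : k) ^ (i : ℕ) • b i),
    ← Fin.sum_congr' (fun j : Fin (n + 2) => (-1 : k) ^ (j : ℕ) • T j) hn, Fin.sum_univ_add]
  have e1 : ∑ i : Fin (l + 1), (-1 : k) ^ ((Fin.cast hn (Fin.castAdd (m + 1) i) : Fin _) : ℕ) •
      T (Fin.cast hn (Fin.castAdd (m + 1) i)) =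
      ∑ i : Fin (l + 1), (-1 : k) ^ (i.castSucc : ℕ) • b i.castSucc :=
    Finset.sum_congr rfl fun i _ => by
      rw [hb _ (by simp; omega)]
      rfl
  have e2 : ∑ i : Fin (m + 1), (-1 : k) ^ ((Fin.cast hn (Fin.natAdd (l + 1) i) : Fin _) : ℕ) •
      T (Fin.cast hn (Fin.natAdd (l + 1) i)) =
      (-1 : k) ^ l • ∑ i : Fin (m + 1), (-1 : k) ^ (i.succ : ℕ) • a i.succ := by
    rw [Finset.smul_sum]
    refine Finset.sum_congr rfl fun i _ => ?_
    rw [ha _ (by simp; omega), smul_smul, ← pow_add]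
    congr 2
    · simp; omega
    · exact Fin.ext (by simp; omega)
  rw [e1, e2, hab, smul_add, Fin.val_last, pow_succ]
  simp only [Fin.val_zero, pow_zero, one_smul, mul_neg, mul_one, neg_smul]
  abel

/-- The twisted Alexander-Whitney map is a chain map. The faces `∂ⱼ` with `j ≤ l` act on the front
faces of `w` and the faces with `j > l` on the back faces of `γ`; the two remaining faces
coincide and have opposite signs. -/
theorem isChainMap_AW [Fintype G] : IsChainMap (Bar.d k (SkewMonoidAlgebra S G))
    (Total.d (Bar.d k (MonoidAlgebra k G)) (Bar.d k S)) (AW k S (G := G)) := by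
  intro n x
  refine LinearMap.congr_fun (f := AW k S n ∘ₗ Bar.d k (SkewMonoidAlgebra S G) n)
    (g := Total.d (Bar.d k (MonoidAlgebra k G)) (Bar.d k S) n ∘ₗ AW k S (n + 1))
    (ext_diag fun γ w => funext fun p => ?_) x
  obtain ⟨⟨m, l⟩, hp⟩ := p
  have h : m + l = n := Finset.HasAntidiagonal.mem_antidiagonal.mp hp
  have h1 : m + 1 + l = n + 1 := by omega
  have h2 : m + (l + 1) = n + 1 := by omega
  have eR : Total.d (Bar.d k (MonoidAlgebra k G)) (Bar.d k S) n
      (AW k S (n + 1) (Bar.tuple k (SkewMonoidAlgebra S G) (diag γ w))) ⟨(m, l), hp⟩ =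
      (Bar.d k (MonoidAlgebra k G) m).rTensor (Bar k S l)
        (AW k S (n + 1) (Bar.tuple k (SkewMonoidAlgebra S G) (diag γ w))
          (Bidegree.mk (m + 1) l h1)) +
      (-1 : k) ^ m • (Bar.d k S l).lTensor (Bar k (MonoidAlgebra k G) m)
        (AW k S (n + 1) (Bar.tuple k (SkewMonoidAlgebra S G) (diag γ w))
          (Bidegree.mk m (l + 1) h2)) := rfl
  have eL : AW k S n (Bar.d k (SkewMonoidAlgebra S G) n
      (Bar.tuple k (SkewMonoidAlgebra S G) (diag γ w))) ⟨(m, l), hp⟩ =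
      (-1 : k) ^ (l * m) • ∑ j : Fin (n + 2), (-1 : k) ^ (j : ℕ) •
        (groupTuple k (blockProd (backMap h) (Fin.contractNth j.castSucc (· * ·) γ)) ⊗ₜ[k]
          Bar.tuple k S (blockProd (frontMap h) (Fin.contractNth j.castSucc (· * ·) w))) := by
    rw [d_diag, map_sum, Finset.sum_apply, Finset.smul_sum]
    refine Finset.sum_congr rfl fun j _ => ?_
    rw [map_smul, Pi.smul_apply, AW_diag, smul_comm]
  rw [LinearMap.comp_apply, LinearMap.comp_apply, eL, eR, AW_diag_mk, AW_diag_mk, map_smul,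
    map_smul, LinearMap.rTensor_tmul, LinearMap.lTensor_tmul, d_groupTuple, Bar.d_tuple,
    TensorProduct.sum_tmul, TensorProduct.tmul_sum]
  simp only [← TensorProduct.smul_tmul', TensorProduct.tmul_smul]
  rw [alternating_sum_glue h
    (fun j => groupTuple k (blockProd (backMap h) (Fin.contractNth j.castSucc (· * ·) γ)) ⊗ₜ[k]
      Bar.tuple k S (blockProd (frontMap h) (Fin.contractNth j.castSucc (· * ·) w)))
    (fun i => groupTuple k (Fin.contractNth i.castSucc (· * ·) (blockProd (backMap h1) γ)) ⊗ₜ[k]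
      Bar.tuple k S (blockProd (frontMap h1) w))
    (fun i => groupTuple k (blockProd (backMap h2) γ) ⊗ₜ[k]
      Bar.tuple k S (Fin.contractNth i.castSucc (· * ·) (blockProd (frontMap h2) w))), smul_add,
    smul_smul, smul_smul]
  · congr 2
    · rw [← pow_add]
      rfl
    · change _ = (-1 : k) ^ m * (-1 : k) ^ ((l + 1) * m)
      rw [add_mul, one_mul, pow_add, mul_comm ((-1 : k) ^ (l * m)), ← mul_assoc, ← mul_pow]
      simp
  all_goals
    intros
    simp only [contractNth_eq_blockProd, blockProd_blockProd _ (monotone_mergeMap _ _),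
      blockProd_blockProd _ (monotone_backMap _), blockProd_blockProd _ (monotone_frontMap _)]
    congr 3
    all_goals
      funext i
      refine Fin.ext ?_
      simp only [backMap, frontMap, mergeMap, Fin.val_zero, Fin.val_last]
      omega

end AlexanderWhitney

/-! ### Shuffles -/

section Shuffles

variable {n : ℕ}

theorem isShuffle_inv_iff {m : ℕ} {σ : Equiv.Perm (Fin n)} :
    IsShuffle m σ⁻¹ ↔ ∀ a b : Fin n, a < b →
      ((σ a : ℕ) < m ∧ (σ b : ℕ) < m ∨ m ≤ (σ a : ℕ) ∧ m ≤ (σ b : ℕ)) → σ a < σ b := by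
  constructor
  · intro h a b hab hm
    by_contra hlt
    have hba : σ b < σ a := lt_of_le_of_ne (not_lt.mp hlt) (fun e => hab.ne' (σ.injective e))
    have := h (σ b) (σ a) hba (by omega)
    rw [show σ⁻¹ (σ b) = b from σ.symm_apply_apply b,
      show σ⁻¹ (σ a) = a from σ.symm_apply_apply a] at this
    exact absurd hab this.not_gt
  · intro h i j hij hm
    by_contra hlt
    have hji : σ⁻¹ j < σ⁻¹ i :=
      lt_of_le_of_ne (not_lt.mp hlt) (fun e => hij.ne' (σ⁻¹.injective e))
    have hij' : (i : ℕ) < j := hij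
    have hi : σ (σ⁻¹ i) = i := σ.apply_symm_apply i
    have hj : σ (σ⁻¹ j) = j := σ.apply_symm_apply j
    have := h (σ⁻¹ j) (σ⁻¹ i) hji (by rw [hi, hj]; omega)
    rw [hi, hj] at this
    exact absurd hij this.not_gt

/-- The permutation that sends `0` to `p` and is given on the other indices by the permutation `e`
of the complement of `p`. -/
def consPerm : Fin (n + 1) × Equiv.Perm (Fin n) ≃ Equiv.Perm (Fin (n + 1)) where
  toFun x := x.1.cycleRange⁻¹ * Equiv.Perm.decomposeFin.symm (0, x.2)
  invFun σ := (σ 0, (Equiv.Perm.decomposeFin ((σ 0).cycleRange * σ)).2)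
  left_inv x := by
    have h : (x.1.cycleRange⁻¹ * Equiv.Perm.decomposeFin.symm (0, x.2)) 0 = x.1 := by
      simp [Equiv.Perm.mul_apply, Equiv.Perm.inv_def]
    refine Prod.ext h ?_
    simp only [h]
    rw [mul_inv_cancel_left, Equiv.apply_symm_apply]
  right_inv σ := by
    have h : (Equiv.Perm.decomposeFin ((σ 0).cycleRange * σ)).1 = 0 := by
      rw [← Equiv.Perm.decomposeFin_symm_apply_zero
        (Equiv.Perm.decomposeFin ((σ 0).cycleRange * σ)).1
        (Equiv.Perm.decomposeFin ((σ 0).cycleRange * σ)).2, Prod.mk.eta, Equiv.symm_apply_apply]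
      simp [Equiv.Perm.mul_apply]
    have e : ((0 : Fin (n + 1)), (Equiv.Perm.decomposeFin ((σ 0).cycleRange * σ)).2) =
        Equiv.Perm.decomposeFin ((σ 0).cycleRange * σ) := Prod.ext h.symm rfl
    simp only [e, Equiv.symm_apply_apply, inv_mul_cancel_left]

theorem consPerm_zero (p : Fin (n + 1)) (e : Equiv.Perm (Fin n)) : consPerm (p, e) 0 = p := by
  simp [consPerm, Equiv.Perm.mul_apply, Equiv.Perm.inv_def]

theorem consPerm_succ (p : Fin (n + 1)) (e : Equiv.Perm (Fin n)) (q : Fin n) :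
    consPerm (p, e) q.succ = p.succAbove (e q) := by
  simp [consPerm, Equiv.Perm.mul_apply, Equiv.Perm.inv_def]

theorem sign_consPerm (p : Fin (n + 1)) (e : Equiv.Perm (Fin n)) :
    Equiv.Perm.sign (consPerm (p, e)) = (-1) ^ (p : ℕ) * Equiv.Perm.sign e := by
  simp [consPerm, Equiv.Perm.sign_mul, Equiv.Perm.decomposeFin.symm_sign]

theorem val_succAbove (p : Fin (n + 1)) (i : Fin n) :
    (p.succAbove i : ℕ) = if (i : ℕ) < p then (i : ℕ) else i + 1 := by
  simp only [Fin.succAbove, Fin.lt_def, Fin.val_castSucc]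
  split_ifs <;> simp

/-- A shuffle starts with the first letter of the first or with the first letter of the second
word, and goes on with a shuffle of the remaining letters. -/
theorem isShuffle_consPerm_iff {m : ℕ} (hm : m ≤ n + 1) (p : Fin (n + 1)) (e : Equiv.Perm (Fin n)) :
    IsShuffle m (consPerm (p, e))⁻¹ ↔
      ((p : ℕ) = 0 ∧ 0 < m ∧ IsShuffle (m - 1) e⁻¹) ∨ ((p : ℕ) = m ∧ IsShuffle m e⁻¹) := by
  simp only [isShuffle_inv_iff]
  constructor
  · intro h
    -- `p` is the first letter of the word it belongs to
    have key : ∀ q : Fin (n + 1), ((q : ℕ) < m ∧ (p : ℕ) < m ∨ m ≤ (q : ℕ) ∧ m ≤ (p : ℕ)) →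
        p ≤ q := by
      intro q hq
      by_contra hlt
      have hb : consPerm (p, e) ((consPerm (p, e))⁻¹ q) = q := Equiv.apply_symm_apply _ q
      have h0 : (0 : Fin (n + 1)) < (consPerm (p, e))⁻¹ q := by
        refine Fin.pos_of_ne_zero fun h0 => hlt ?_
        rw [h0, consPerm_zero] at hb
        exact hb.le
      have := h _ _ h0 (by rw [consPerm_zero, hb]; omega)
      rw [consPerm_zero, hb] at this
      exact hlt this.le
    have hp : ((p : ℕ) = 0 ∧ 0 < m) ∨ (p : ℕ) = m := by
      by_cases hpm : (p : ℕ) < m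
      · have := key 0 (Or.inl ⟨by simp; omega, hpm⟩)
        rw [Fin.le_def] at this
        simp at this
        exact Or.inl ⟨by simp [this], by omega⟩
      · have := key ⟨m, by omega⟩ (Or.inr ⟨le_rfl, by omega⟩)
        rw [Fin.le_def] at this
        simp at this
        omega
    refine hp.imp (fun hp => ⟨hp.1, hp.2, fun a b hab hc => ?_⟩)
      (fun hp => ⟨hp, fun a b hab hc => ?_⟩)
    all_goals
      have := h a.succ b.succ (Fin.succ_lt_succ_iff.mpr hab)
      simp only [consPerm_succ, Fin.lt_def, val_succAbove] at this ⊢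
      split_ifs at this <;> omega
  · rintro (⟨hp, hm0, h⟩ | ⟨hp, h⟩) a b hab hc
    all_goals
      obtain ⟨b, rfl⟩ : ∃ b', b = Fin.succ b' :=
        (Fin.exists_succ_eq.mpr (Fin.ne_zero_of_lt hab)).imp fun _ h => h.symm
      induction a using Fin.cases with
      | zero =>
        simp only [consPerm_succ, consPerm_zero, Fin.lt_def, val_succAbove] at hc ⊢
        split_ifs at hc ⊢ <;> omega
      | succ a =>
        have := h a b (Fin.succ_lt_succ_iff.mp hab)
        simp only [consPerm_succ, Fin.lt_def, val_succAbove] at this hc ⊢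
        split_ifs at hc ⊢ <;> omega

variable {G : Type*} [Group G]

theorem prodOver_pos {A : Type*} [Monoid A] (v : Fin (n + 1) → A) :
    prodOver (fun i => 0 < i) v = fullProd (fun i : Fin n => v i.succ) := by
  rw [prodOver_succ, if_neg (lt_irrefl 0), one_mul, fullProd_eq]
  exact prodOver_congr (fun i => by simp) fun _ _ => rfl

theorem afterProd_succ {A : Type*} [Monoid A] (v : Fin (n + 1) → A) (q : Fin n) :
    afterProd v q.succ = afterProd (fun i : Fin n => v i.succ) q := by
  rw [afterProd_eq, prodOver_succ, if_neg (by simp), one_mul]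
  exact prodOver_congr (fun i => by simp) fun _ _ => rfl

theorem fullProd_succ {A : Type*} [Monoid A] (v : Fin (n + 1) → A) :
    fullProd v = v 0 * fullProd (Fin.tail v) := by
  rw [fullProd_eq, prodOver_succ, if_pos trivial, fullProd_eq]
  rfl

theorem ezGroup_consPerm_left (m : ℕ) (γ : Fin (m + 3) → G) (e : Equiv.Perm (Fin n)) (q : Fin n) :
    ezGroup (m + 1) γ (consPerm (0, e) q.succ) = ezGroup m (Fin.tail γ) (e q) := by
  rw [consPerm_succ, Fin.succAbove_zero]
  by_cases h : (e q : ℕ) < m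
  · rw [ezGroup, ezGroup, dif_pos h, dif_pos (by simpa using h)]
    rfl
  · rw [ezGroup, ezGroup, dif_neg h, dif_neg (by simpa using h)]

theorem ezGroup_consPerm_right (m : ℕ) (γ : Fin (m + 2) → G) (p : Fin (n + 1)) (hp : (p : ℕ) = m)
    (e : Equiv.Perm (Fin n)) (q : Fin n) :
    ezGroup m γ (consPerm (p, e) q.succ) = ezGroup m γ (e q) := by
  rw [consPerm_succ]
  have hv := val_succAbove p (e q)
  by_cases h : (e q : ℕ) < m
  · rw [if_pos (by omega)] at hv
    rw [ezGroup, ezGroup, dif_pos h, dif_pos (by omega)]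
    congr 1
    exact Fin.ext (by simp [hv])
  · rw [if_neg (by omega)] at hv
    rw [ezGroup, ezGroup, dif_neg h, dif_neg (by omega)]

/-- A shuffle does not change the order of the group elements. -/
theorem fullProd_shuffle {m l : ℕ} (h : m + l = n) (σ : Equiv.Perm (Fin n))
    (hσ : IsShuffle m σ⁻¹) (γ : Fin (m + 2) → G) :
    γ 0 * (fullProd (fun q => ezGroup m γ (σ q)) * γ (Fin.last (m + 1))) = fullProd γ := by
  induction n generalizing m l with
  | zero =>
    obtain rfl : m = 0 := by omega
    simp [fullProd]
  | succ n ih =>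
    obtain ⟨⟨p, e⟩, rfl⟩ := consPerm.surjective σ
    rw [isShuffle_consPerm_iff (by omega)] at hσ
    rw [fullProd_succ (fun q => ezGroup m γ (consPerm (p, e) q)), consPerm_zero]
    obtain ⟨hp, hm, hσ⟩ | ⟨hp, hσ⟩ := hσ
    · obtain ⟨m, rfl⟩ : ∃ m', m = m' + 1 := ⟨m - 1, by omega⟩
      obtain rfl : p = 0 := Fin.ext hp
      have := ih (l := l) (by omega) e hσ (Fin.tail γ)
      rw [fullProd_succ γ, ← this]
      simp only [Fin.tail_def, ezGroup_consPerm_left]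
      rw [ezGroup, dif_pos (by simp), mul_assoc]
      rfl
    · by_cases hm : m ≤ n
      · rw [← ih (l := n - m) (by omega) e hσ γ]
        simp only [Fin.tail_def, ezGroup_consPerm_right m γ p hp]
        rw [ezGroup, dif_neg (by omega), one_mul]
      · omega

end Shuffles

/-! ### The Eilenberg-Zilber map on tuples -/

section EilenbergZilber

variable {k S G : Type*} [Field k] [Ring S] [Algebra k S] [Group G] [MulSemiringAction G S]
  {n : ℕ}

theorem ezTuple_zero {m l : ℕ} (h : m + l = n) (σ : Equiv.Perm (Fin n)) (γ : Fin (m + 2) → G)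
    (w : Fin (l + 2) → S) :
    ezTuple m l h σ γ w 0 = SkewMonoidAlgebra.single (γ 0) (fullProd γ • w 0) := rfl

theorem ezTuple_last {m l : ℕ} (h : m + l = n) (σ : Equiv.Perm (Fin n)) (γ : Fin (m + 2) → G)
    (w : Fin (l + 2) → S) :
    ezTuple m l h σ γ w (Fin.last (n + 1)) = SkewMonoidAlgebra.single (γ (Fin.last (m + 1)))
      (γ (Fin.last (m + 1)) • w (Fin.last (l + 1))) := by
  rw [ezTuple, ← Fin.succ_last n, Fin.cons_succ, Fin.snoc_last]

theorem ezTuple_middle {m l : ℕ} (h : m + l = n) (σ : Equiv.Perm (Fin n)) (γ : Fin (m + 2) → G)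
    (w : Fin (l + 2) → S) (q : Fin n) :
    ezTuple m l h σ γ w q.castSucc.succ = if hq : (σ q : ℕ) < m then
        SkewMonoidAlgebra.single (γ ⟨σ q + 1, by omega⟩) 1
      else SkewMonoidAlgebra.single 1 ((afterProd (fun i => ezGroup m γ (σ i)) q *
        γ (Fin.last (m + 1))) • w ⟨σ q - m + 1, by omega⟩) := by
  rw [ezTuple, Fin.cons_succ, Fin.snoc_castSucc, ezLetter,
    show σ⁻¹ (σ q) = q from σ.symm_apply_apply q]
  rfl

variable [SMulCommClass G k S]

open Classical in
theorem ezTerm_apply {m l : ℕ} (h : m + l = n) (γ : Fin (m + 2) → G) (w : Fin (l + 2) → S) :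
    ezTerm k S m l h γ w = ∑ σ : Equiv.Perm (Fin n), if IsShuffle m σ⁻¹ then
      ((Equiv.Perm.sign σ : ℤ) : k) • Bar.tuple k (SkewMonoidAlgebra S G) (ezTuple m l h σ γ w)
    else 0 := by
  rw [ezTerm, sum_apply]
  refine Finset.sum_congr rfl fun σ _ => ?_
  split_ifs <;> rfl

theorem ezTerm_eq_zero_of_group {m l : ℕ} (h : m + l = n) (γ : Fin (m + 2) → G)
    (w : Fin (l + 2) → S) (i : Fin m) (hi : γ i.castSucc.succ = 1) : ezTerm k S m l h γ w = 0 := by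
  rw [ezTerm_apply]
  refine Finset.sum_eq_zero fun σ _ => ?_
  split_ifs
  · rw [Bar.tuple_eq_zero k (SkewMonoidAlgebra S G) _ (σ⁻¹ ⟨i, by omega⟩), smul_zero]
    have e : σ (σ⁻¹ ⟨i, by omega⟩) = ⟨i, by omega⟩ := σ.apply_symm_apply _
    rw [ezTuple_middle, dif_pos (by simp)]
    simp only [e]
    rw [SkewMonoidAlgebra.one_def, ← hi]
    rfl
  · rfl

theorem ezTerm_eq_zero_of_ring {m l : ℕ} (h : m + l = n) (γ : Fin (m + 2) → G)
    (w : Fin (l + 2) → S) (i : Fin l) (hi : w i.castSucc.succ = 1) : ezTerm k S m l h γ w = 0 := by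
  rw [ezTerm_apply]
  refine Finset.sum_eq_zero fun σ _ => ?_
  split_ifs
  · rw [Bar.tuple_eq_zero k (SkewMonoidAlgebra S G) _ (σ⁻¹ ⟨m + i, by omega⟩), smul_zero]
    have e : σ (σ⁻¹ ⟨m + i, by omega⟩) = ⟨m + i, by omega⟩ := σ.apply_symm_apply _
    rw [ezTuple_middle, dif_neg (by simp)]
    have ew : w ⟨(σ (σ⁻¹ ⟨m + i, by omega⟩) : ℕ) - m + 1, by omega⟩ = 1 := by
      rw [← hi]
      congr 1
      exact Fin.ext (by simp)
    rw [ew, smul_one, SkewMonoidAlgebra.one_def]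
  · rfl

/-- The part of a shuffle product of `γ` and `w` starting with the first letter of `γ`. -/
noncomputable def ezLeft (k : Type*) [Field k] [Algebra k S] [SMulCommClass G k S] :
    ∀ (m l : ℕ) (_ : m + l = n + 1) (_ : Fin (m + 2) → G) (_ : Fin (l + 2) → S),
      Bar k (SkewMonoidAlgebra S G) n
  | 0, _, _, _, _ => 0
  | m + 1, l, h, γ, w => ezTerm k S m l (by omega) (Fin.tail γ) w

/-- The part of a shuffle product of `γ` and `w` starting with the first letter of `w`. -/
noncomputable def ezRight (k : Type*) [Field k] [Algebra k S] [SMulCommClass G k S] :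
    ∀ (m l : ℕ) (_ : m + l = n + 1) (_ : Fin (m + 2) → G) (_ : Fin (l + 2) → S),
      Bar k (SkewMonoidAlgebra S G) n
  | _, 0, _, _, _ => 0
  | m, l + 1, h, γ, w => (-1 : k) ^ m • ezTerm k S m l (by omega) γ (Fin.tail w)

theorem ezTuple_consPerm_left {m l : ℕ} (h : m + 1 + l = n + 1) (h' : m + l = n)
    (e : Equiv.Perm (Fin n))
    (γ : Fin (m + 3) → G) (w : Fin (l + 2) → S) (hγ : γ 0 = 1) (hw : w 0 = 1) :
    ezTuple (m + 1) l h (consPerm (0, e)) γ w =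
      Fin.cons 1 (ezTuple m l h' e (Fin.tail γ) w) := by
  funext r
  induction r using Fin.cases with
  | zero => rw [ezTuple_zero, hγ, hw, smul_one, Fin.cons_zero, SkewMonoidAlgebra.one_def]
  | succ r =>
    rw [Fin.cons_succ]
    induction r using Fin.lastCases with
    | last => rw [Fin.succ_last, ezTuple_last, ezTuple_last]; rfl
    | cast r =>
      rw [ezTuple_middle]
      induction r using Fin.cases with
      | zero =>
        rw [Fin.castSucc_zero, ezTuple_zero, hw, smul_one, dif_pos (by simp [consPerm_zero])]
        simp only [consPerm_zero]
        rfl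
      | succ q =>
        rw [Fin.castSucc_succ, ezTuple_middle, afterProd_succ]
        simp only [ezGroup_consPerm_left]
        have e1 : (consPerm (0, e) q.succ : ℕ) = e q + 1 := by
          rw [consPerm_succ, Fin.succAbove_zero, Fin.val_succ]
        by_cases hq : (e q : ℕ) < m
        · rw [dif_pos hq, dif_pos (by omega)]
          simp only [e1]
          rfl
        · rw [dif_neg hq, dif_neg (by omega)]
          simp only [e1, Nat.add_sub_add_right]
          rfl

theorem ezTuple_consPerm_right {m l : ℕ} (h : m + (l + 1) = n + 1) (h' : m + l = n)
    (p : Fin (n + 1)) (hp : (p : ℕ) = m) (e : Equiv.Perm (Fin n)) (he : IsShuffle m e⁻¹)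
    (γ : Fin (m + 2) → G) (w : Fin (l + 3) → S) (hγ : γ 0 = 1) (hw : w 0 = 1) :
    ezTuple m (l + 1) h (consPerm (p, e)) γ w = Fin.cons 1 (ezTuple m l h' e γ (Fin.tail w)) := by
  funext r
  induction r using Fin.cases with
  | zero => rw [ezTuple_zero, hγ, hw, smul_one, Fin.cons_zero, SkewMonoidAlgebra.one_def]
  | succ r =>
    rw [Fin.cons_succ]
    induction r using Fin.lastCases with
    | last => rw [Fin.succ_last, ezTuple_last, ezTuple_last]; rfl
    | cast r =>
      rw [ezTuple_middle]
      induction r using Fin.cases with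
      | zero =>
        have hf := fullProd_shuffle h' e he γ
        rw [hγ, one_mul] at hf
        rw [Fin.castSucc_zero, ezTuple_zero, dif_neg (by simp [consPerm_zero, hp]),
          afterProd_eq, prodOver_pos]
        simp only [ezGroup_consPerm_right m γ p hp, hf, consPerm_zero, hp, hγ, Nat.sub_self]
        rfl
      | succ q =>
        rw [Fin.castSucc_succ, ezTuple_middle, afterProd_succ]
        simp only [ezGroup_consPerm_right m γ p hp]
        have e1 := val_succAbove p (e q)
        rw [← consPerm_succ] at e1
        by_cases hq : (e q : ℕ) < m
        · rw [if_pos (by omega)] at e1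
          rw [dif_pos hq, dif_pos (by omega)]
          simp only [e1]
        · rw [if_neg (by omega)] at e1
          rw [dif_neg hq, dif_neg (by omega)]
          have e2 : (⟨(consPerm (p, e) q.succ : ℕ) - m + 1, by omega⟩ : Fin (l + 3)) =
            (⟨(e q : ℕ) - m + 1, by omega⟩ : Fin (l + 2)).succ := Fin.ext (by simp; omega)
          rw [e2]
          rfl

/-- The recursion for shuffle products: a shuffle starts with the first letter of `γ` or with the
first letter of `w`. In the shorter shuffle product this letter becomes the coefficient on the left,
which is moved into the tensor by the homotopy. -/
theorem ezTerm_eq_homotopy {m l : ℕ} (h : m + l = n + 1) (γ : Fin (m + 2) → G)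
    (w : Fin (l + 2) → S) (hγ : γ 0 = 1) (hw : w 0 = 1) :
    ezTerm k S m l h γ w =
      Bar.homotopy k (SkewMonoidAlgebra S G) n (ezLeft k m l h γ w) +
        Bar.homotopy k (SkewMonoidAlgebra S G) n (ezRight k m l h γ w) := by
  classical
  rw [ezTerm_apply, ← consPerm.sum_comp, Fintype.sum_prod_type]
  have hother : ∀ p : Fin (n + 1), ((p : ℕ) = 0 → m = 0) → (p : ℕ) ≠ m →
      (∑ e : Equiv.Perm (Fin n), if IsShuffle m (consPerm (p, e))⁻¹ then
        ((Equiv.Perm.sign (consPerm (p, e)) : ℤ) : k) • Bar.tuple k (SkewMonoidAlgebra S G)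
          (ezTuple m l h (consPerm (p, e)) γ w) else 0) = 0 := by
    intro p h0 hm
    refine Finset.sum_eq_zero fun e _ => if_neg ?_
    rw [isShuffle_consPerm_iff (by omega)]
    rintro (⟨hp, hm', -⟩ | ⟨hp, -⟩)
    · exact hm'.ne' (h0 hp)
    · exact hm hp
  have hleft : ∀ hm : 0 < m,
      (∑ e : Equiv.Perm (Fin n), if IsShuffle m (consPerm (0, e))⁻¹ then
        ((Equiv.Perm.sign (consPerm (0, e)) : ℤ) : k) • Bar.tuple k (SkewMonoidAlgebra S G)
          (ezTuple m l h (consPerm (0, e)) γ w) else 0) =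
        Bar.homotopy k (SkewMonoidAlgebra S G) n (ezLeft k m l h γ w) := by
    intro hm
    obtain ⟨m, rfl⟩ : ∃ m', m = m' + 1 := ⟨m - 1, by omega⟩
    rw [ezLeft, ezTerm_apply, map_sum]
    refine Finset.sum_congr rfl fun e _ => ?_
    have hs : IsShuffle (m + 1) (consPerm (0, e))⁻¹ ↔ IsShuffle m e⁻¹ := by
      rw [isShuffle_consPerm_iff (by omega)]
      simp
    simp only [hs]
    split_ifs
    · rw [map_smul, Bar.homotopy_tuple, ezTuple_consPerm_left h (by omega) e γ w hγ hw,
        sign_consPerm]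
      simp
    · rw [map_zero]
  have hright : ∀ (hl : 0 < l) (p : Fin (n + 1)) (hp : (p : ℕ) = m),
      (∑ e : Equiv.Perm (Fin n), if IsShuffle m (consPerm (p, e))⁻¹ then
        ((Equiv.Perm.sign (consPerm (p, e)) : ℤ) : k) • Bar.tuple k (SkewMonoidAlgebra S G)
          (ezTuple m l h (consPerm (p, e)) γ w) else 0) =
        Bar.homotopy k (SkewMonoidAlgebra S G) n (ezRight k m l h γ w) := by
    intro hl p hp
    obtain ⟨l, rfl⟩ : ∃ l', l = l' + 1 := ⟨l - 1, by omega⟩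
    rw [ezRight, ezTerm_apply, Finset.smul_sum, map_sum]
    refine Finset.sum_congr rfl fun e _ => ?_
    have hs : IsShuffle m (consPerm (p, e))⁻¹ ↔ IsShuffle m e⁻¹ := by
      rw [isShuffle_consPerm_iff (by omega)]
      constructor
      · rintro (⟨h1, h2, -⟩ | h1)
        · omega
        · exact h1.2
      · exact fun h1 => Or.inr ⟨hp, h1⟩
    simp only [hs]
    split_ifs with he
    · rw [map_smul, map_smul, Bar.homotopy_tuple,
        ezTuple_consPerm_right h (by omega) p hp e he γ w hγ hw, sign_consPerm, hp, smul_smul]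
      congr 1
      simp
    · rw [smul_zero, map_zero]
  rcases Nat.eq_zero_or_pos m with hm | hm
  · rw [Finset.sum_eq_single 0, hright (by omega) 0 (by simp [hm])]
    · subst hm
      simp [ezLeft]
    · intro p _ hp
      exact hother p (fun _ => hm) (fun hp' => hp (Fin.ext (by simp [hp', hm])))
    · simp
  rcases Nat.eq_zero_or_pos l with hl | hl
  · rw [Finset.sum_eq_single 0, hleft hm]
    · subst hl
      simp [ezRight]
    · intro p _ hp
      refine hother p (fun hp' => absurd (Fin.ext hp') hp) (by omega)
    · simp
  · have hne : (0 : Fin (n + 1)) ≠ ⟨m, by omega⟩ := fun h0 => hm.ne (congrArg Fin.val h0)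
    rw [Finset.sum_eq_add_of_mem 0 ⟨m, by omega⟩ (Finset.mem_univ _) (Finset.mem_univ _) hne,
      hleft hm, hright hl _ rfl]
    rintro p - ⟨h1, h2⟩
    exact hother p (fun hp => absurd (Fin.ext hp) h1) (fun hp => h2 (Fin.ext hp))

end EilenbergZilber

/-! ### The Eilenberg-Zilber map on pairs of tuples -/

section EilenbergZilber

variable {k S G : Type*} [Field k] [Ring S] [Algebra k S] [Group G] [MulSemiringAction G S]
  [SMulCommClass G k S] {n : ℕ}

theorem groupCoeff_of [DecidableEq G] (g x : G) :
    groupCoeff k G g (MonoidAlgebra.of k G x) = if x = g then 1 else 0 := by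
  change (MonoidAlgebra.single x (1 : k)).coeff g = _
  rw [MonoidAlgebra.coeff_single, Finsupp.single_apply]

/-- Linear maps on the bar resolution of `kG` agree if they agree on tuples of group elements. -/
theorem ext_groupTuple [Fintype G] {m : ℕ} {N : Type*} [AddCommGroup N] [Module k N]
    {f g : Bar k (MonoidAlgebra k G) m →ₗ[k] N}
    (h : ∀ γ, f (groupTuple k γ) = g (groupTuple k γ)) : f = g := by
  classical
  refine Bar.ext_tuple fun v => ?_
  have hv : v = fun i => ∑ x : G, groupCoeff k G x (v i) • MonoidAlgebra.of k G x := by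
    funext i
    have := MonoidAlgebra.sum_coeff_single (v i)
    rw [Finsupp.sum_fintype _ _ (by simp)] at this
    conv_lhs => rw [← this]
    refine Finset.sum_congr rfl fun x _ => ?_
    simp [groupCoeff]
  rw [hv, MultilinearMap.map_sum, map_sum, map_sum]
  refine Finset.sum_congr rfl fun γ _ => ?_
  rw [MultilinearMap.map_smul_univ, map_smul, map_smul]
  exact congrArg _ (h γ)

variable (k S G) in
/-- The component of the twisted Eilenberg-Zilber map in bidegree `(m, l)`. -/
noncomputable def ezComponent [Fintype G] (m l : ℕ) (h : m + l = n) :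
    Bar k (MonoidAlgebra k G) m ⊗[k] Bar k S l →ₗ[k] Bar k (SkewMonoidAlgebra S G) n :=
  TensorProduct.lift (Bar.lift (∑ γ : Fin (m + 2) → G,
      ((MultilinearMap.mkPiAlgebra k (Fin (m + 2)) k).compLinearMap
        (fun i => groupCoeff k G (γ i))).smulRight (Bar.lift (ezTerm k S m l h γ))))

theorem EZ_apply [Fintype G]
    (t : Total k (fun i => Bar k (MonoidAlgebra k G) i) (fun j => Bar k S j) n) :
    EZ k S G n t = ∑ p : Bidegree n, ezComponent k S G p.1.1 p.1.2 p.add_eq (t p) := by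
  rw [EZ, LinearMap.sum_apply]
  rfl

theorem lift_ezTerm_tuple {m l : ℕ} (h : m + l = n) (γ : Fin (m + 2) → G) (w : Fin (l + 2) → S) :
    Bar.lift (ezTerm k S m l h γ) (Bar.tuple k S w) = ezTerm k S m l h γ w :=
  Bar.lift_tuple _ (fun w i hi => ezTerm_eq_zero_of_ring h γ w i hi) w

theorem ezComponent_tmul [Fintype G] {m l : ℕ} (h : m + l = n) (γ : Fin (m + 2) → G)
    (w : Fin (l + 2) → S) :
    ezComponent k S G m l h (groupTuple k γ ⊗ₜ Bar.tuple k S w) = ezTerm k S m l h γ w := by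
  classical
  have hcoeff : ∀ (γ' : Fin (m + 2) → G) (v : Fin (m + 2) → MonoidAlgebra k G),
      ((MultilinearMap.mkPiAlgebra k (Fin (m + 2)) k).compLinearMap
        (fun i => groupCoeff k G (γ' i))) v = ∏ i, groupCoeff k G (γ' i) (v i) := fun γ' v => by
    simp
  rw [ezComponent, TensorProduct.lift.tmul, groupTuple, Bar.lift_tuple, sum_apply,
    LinearMap.sum_apply, Finset.sum_eq_single γ]
  · rw [MultilinearMap.smulRight_apply, hcoeff, LinearMap.smul_apply, lift_ezTerm_tuple,
      Finset.prod_eq_one, one_smul]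
    intro i _
    rw [groupCoeff_of, if_pos rfl]
  · intro γ' _ hne
    obtain ⟨i, hi⟩ := Function.ne_iff.mp hne
    rw [MultilinearMap.smulRight_apply, hcoeff, Finset.prod_eq_zero (Finset.mem_univ i), zero_smul,
      LinearMap.zero_apply]
    rw [groupCoeff_of, if_neg (Ne.symm hi)]
  · simp
  · intro v i hi
    rw [sum_apply]
    refine Finset.sum_eq_zero fun γ' _ => ?_
    rw [MultilinearMap.smulRight_apply, hcoeff]
    by_cases h1 : 1 = γ' i.castSucc.succ
    · have h0 : Bar.lift (ezTerm k S m l h γ') = 0 := Bar.ext_tuple fun w => by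
        rw [lift_ezTerm_tuple, ezTerm_eq_zero_of_group h γ' w i h1.symm, LinearMap.zero_apply]
      rw [h0, smul_zero]
    · rw [Finset.prod_eq_zero (Finset.mem_univ i.castSucc.succ), zero_smul]
      rw [hi, ← map_one (MonoidAlgebra.of k G), groupCoeff_of, if_neg h1]

omit [MulSemiringAction G S] [SMulCommClass G k S] in
/-- Linear maps on the product of the two bar resolutions agree if they agree on pairs of tuples. -/
theorem ext_groupTuple_tmul [Fintype G] {m l : ℕ} {N : Type*} [AddCommGroup N] [Module k N]
    {f g : Bar k (MonoidAlgebra k G) m ⊗[k] Bar k S l →ₗ[k] N}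
    (h : ∀ γ w, f (groupTuple k γ ⊗ₜ Bar.tuple k S w) = g (groupTuple k γ ⊗ₜ Bar.tuple k S w)) :
    f = g :=
  TensorProduct.ext (ext_groupTuple fun γ => Bar.ext_tuple fun w => h γ w)

/-! ### The Eilenberg-Zilber map and the bimodule structures -/

theorem of_smul_groupTuple {m : ℕ} (g : G) (γ : Fin (m + 2) → G) :
    MonoidAlgebra.of k G g • groupTuple k γ = groupTuple k (Function.update γ 0 (g * γ 0)) := by
  rw [groupTuple, Bar.smul_tuple, groupTuple]
  congr 1
  funext i
  by_cases hi : i = 0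
  · subst hi; simp
  · simp [hi]

theorem groupTuple_eq_smul {m : ℕ} (γ : Fin (m + 2) → G) :
    groupTuple k γ = MonoidAlgebra.of k G (γ 0) • groupTuple k (Function.update γ 0 1) := by
  rw [of_smul_groupTuple]
  simp

theorem op_of_smul_groupTuple {m : ℕ} (g : G) (γ : Fin (m + 2) → G) :
    op (MonoidAlgebra.of k G g) • groupTuple k γ =
      groupTuple k (Function.update γ (Fin.last (m + 1)) (γ (Fin.last (m + 1)) * g)) := by
  rw [groupTuple, Bar.op_smul_tuple, groupTuple]
  congr 1
  funext i
  by_cases hi : i = Fin.last (m + 1)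
  · subst hi; simp
  · simp [hi]

theorem fullProd_mul_head {m : ℕ} (g : G) (γ : Fin (m + 2) → G) :
    fullProd (Function.update γ 0 (g * γ 0)) = g * fullProd γ := by
  rw [fullProd_eq, prodOver_mul_head _ trivial, fullProd_eq]

theorem fullProd_mul_last {m : ℕ} (g : G) (γ : Fin (m + 2) → G) :
    fullProd (Function.update γ (Fin.last (m + 1)) (γ (Fin.last (m + 1)) * g)) =
      fullProd γ * g := by
  rw [fullProd_eq, prodOver_mul_last _ trivial, fullProd_eq]

theorem groupTuple_mem_groupPart {m : ℕ} (γ : Fin (m + 2) → G) :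
    groupTuple k γ ∈ Bar.groupPart k m (fullProd γ) :=
  Submodule.subset_span ⟨γ, rfl, rfl⟩

/-- Linear maps agree on the degree `x` part of the bar resolution of `kG` if they agree on tuples
of group elements with product `x`. -/
theorem eqOn_groupPart {m : ℕ} {x : G} {N : Type*} [AddCommGroup N] [Module k N]
    {f g : Bar k (MonoidAlgebra k G) m →ₗ[k] N}
    (h : ∀ γ, fullProd γ = x → f (groupTuple k γ) = g (groupTuple k γ))
    {b : Bar k (MonoidAlgebra k G) m} (hb : b ∈ Bar.groupPart k m x) : f b = g b := by
  refine LinearMap.eqOn_span (f := f) (g := g) ?_ hb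
  rintro _ ⟨γ, hγ, rfl⟩
  exact h γ hγ

theorem fullProd_contractNth {m : ℕ} (j : Fin (m + 2)) (γ : Fin (m + 3) → G) :
    fullProd (Fin.contractNth j.castSucc (· * ·) γ) = fullProd γ := by
  rw [contractNth_eq_blockProd, fullProd_blockProd _ (monotone_mergeMap _ _)]

theorem d_mem_groupPart {m : ℕ} {x : G} {b : Bar k (MonoidAlgebra k G) (m + 1)}
    (hb : b ∈ Bar.groupPart k (m + 1) x) :
    Bar.d k (MonoidAlgebra k G) m b ∈ Bar.groupPart k m x := by
  refine (Submodule.span_le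
    (p := (Bar.groupPart k m x).comap (Bar.d k (MonoidAlgebra k G) m))).mpr ?_ hb
  rintro _ ⟨γ, rfl, rfl⟩
  change Bar.d k (MonoidAlgebra k G) m (groupTuple k γ) ∈ Bar.groupPart k m (fullProd γ)
  rw [d_groupTuple]
  refine Submodule.sum_mem _ fun j _ => Submodule.smul_mem _ _ ?_
  rw [← fullProd_contractNth j γ]
  exact groupTuple_mem_groupPart _

theorem ezTerm_smul {m l : ℕ} (h : m + l = n) (γ : Fin (m + 2) → G) (w : Fin (l + 2) → S)
    (g : G) (s : S) :
    ezTerm k S m l h (Function.update γ 0 (g * γ 0))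
        (Function.update w 0 (((g * fullProd γ)⁻¹ • s) * w 0)) =
      skewSingle g s • ezTerm k S m l h γ w := by
  classical
  rw [ezTerm_apply, ezTerm_apply, Finset.smul_sum]
  refine Finset.sum_congr rfl fun σ _ => ?_
  split_ifs
  · rw [← smul_comm, Bar.smul_tuple]
    congr 2
    funext r
    induction r using Fin.cases with
    | zero =>
      rw [Function.update_self, ezTuple_zero, ezTuple_zero, Function.update_self,
        Function.update_self, fullProd_mul_head, smul_mul', smul_inv_smul,
        SkewMonoidAlgebra.single_mul_single, mul_smul]
    | succ r =>
      rw [Function.update_of_ne (Fin.succ_ne_zero r)]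
      induction r using Fin.lastCases with
      | last =>
        rw [Fin.succ_last, ezTuple_last, ezTuple_last, Function.update_of_ne Fin.last_pos.ne',
          Function.update_of_ne Fin.last_pos.ne']
      | cast q =>
        have hγ : (fun i => ezGroup m (Function.update γ 0 (g * γ 0)) (σ i)) =
            fun i => ezGroup m γ (σ i) := by
          funext i
          simp [ezGroup, Fin.ext_iff]
        rw [ezTuple_middle, ezTuple_middle, hγ, Function.update_of_ne Fin.last_pos.ne']
        split_ifs
        · rw [Function.update_of_ne (by simp [Fin.ext_iff])]
        · rw [Function.update_of_ne (by simp [Fin.ext_iff])]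
  · rw [smul_zero]

theorem ezTerm_op_smul {m l : ℕ} (h : m + l = n) (γ : Fin (m + 2) → G) (w : Fin (l + 2) → S)
    (g : G) (s : S) :
    ezTerm k S m l h (Function.update γ (Fin.last (m + 1)) (γ (Fin.last (m + 1)) * g))
        (fun i => g⁻¹ • Function.update w (Fin.last (l + 1)) (w (Fin.last (l + 1)) * s) i) =
      op (skewSingle g s) • ezTerm k S m l h γ w := by
  classical
  rw [ezTerm_apply, ezTerm_apply, Finset.smul_sum]
  refine Finset.sum_congr rfl fun σ _ => ?_
  split_ifs
  · rw [← smul_comm, Bar.op_smul_tuple]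
    congr 2
    funext r
    induction r using Fin.cases with
    | zero =>
      rw [Function.update_of_ne Fin.last_pos.ne, ezTuple_zero, ezTuple_zero,
        Function.update_of_ne Fin.last_pos.ne, Function.update_of_ne Fin.last_pos.ne,
        fullProd_mul_last, smul_smul, mul_inv_cancel_right]
    | succ r =>
      induction r using Fin.lastCases with
      | last =>
        rw [Fin.succ_last, ezTuple_last, Function.update_self, Function.update_self,
          Function.update_self, ezTuple_last, SkewMonoidAlgebra.single_mul_single, smul_smul,
          mul_inv_cancel_right, smul_mul']
      | cast q =>
        have hγ : (fun i => ezGroup m (Function.update γ (Fin.last (m + 1))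
            (γ (Fin.last (m + 1)) * g)) (σ i)) = fun i => ezGroup m γ (σ i) := by
          funext i
          unfold ezGroup
          split_ifs with hi
          · rw [Function.update_of_ne (by simp [Fin.ext_iff]; omega)]
          · rfl
        have hq := (σ q).isLt
        rw [Function.update_of_ne (Bar.last_ne_middle q).symm, ezTuple_middle, ezTuple_middle, hγ,
          Function.update_self]
        split_ifs
        · rw [Function.update_of_ne (by simp [Fin.ext_iff]; omega)]
        · rw [Function.update_of_ne (by simp [Fin.ext_iff]; omega), smul_smul, ← mul_assoc,
            mul_inv_cancel_right]
  · rw [smul_zero]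

/-- On homogeneous elements the Eilenberg-Zilber map commutes with the left action of `S ⋊ G`. -/
theorem ezComponent_smul [Fintype G] {m l : ℕ} (h : m + l = n) (g x : G) (s : S)
    {b : Bar k (MonoidAlgebra k G) m} (hb : b ∈ Bar.groupPart k m x) (y : Bar k S l) :
    ezComponent k S G m l h ((MonoidAlgebra.of k G g • b) ⊗ₜ (((g * x)⁻¹ • s) • y)) =
      skewSingle g s • ezComponent k S G m l h (b ⊗ₜ y) := by
  refine eqOn_groupPart (f := ezComponent k S G m l h ∘ₗ
    (TensorProduct.mk k _ _).flip (((g * x)⁻¹ • s) • y) ∘ₗ Bar.leftMul k m (MonoidAlgebra.of k G g))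
    (g := Bar.leftMul k n (skewSingle g s) ∘ₗ ezComponent k S G m l h ∘ₗ
      (TensorProduct.mk k _ _).flip y) (fun γ hγ => ?_) hb
  subst hγ
  refine LinearMap.congr_fun (f := ezComponent k S G m l h ∘ₗ
    TensorProduct.mk k _ _ (MonoidAlgebra.of k G g • groupTuple k γ) ∘ₗ
      Bar.leftMul k l ((g * fullProd γ)⁻¹ • s))
    (g := Bar.leftMul k n (skewSingle g s) ∘ₗ ezComponent k S G m l h ∘ₗ
      TensorProduct.mk k _ _ (groupTuple k γ)) (Bar.ext_tuple fun w => ?_) y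
  change ezComponent k S G m l h ((MonoidAlgebra.of k G g • groupTuple k γ) ⊗ₜ
      (((g * fullProd γ)⁻¹ • s) • Bar.tuple k S w)) =
    skewSingle g s • ezComponent k S G m l h (groupTuple k γ ⊗ₜ Bar.tuple k S w)
  rw [of_smul_groupTuple, Bar.smul_tuple, ezComponent_tmul, ezComponent_tmul, ezTerm_smul]

theorem ezComponent_op_smul [Fintype G] {m l : ℕ} (h : m + l = n) (g : G) (s : S)
    (b : Bar k (MonoidAlgebra k G) m) (y : Bar k S l) :
    ezComponent k S G m l h ((op (MonoidAlgebra.of k G g) • b) ⊗ₜ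
      (Bar.groupAct k S l g⁻¹ (op s • y))) =
      op (skewSingle g s) • ezComponent k S G m l h (b ⊗ₜ y) := by
  refine LinearMap.congr_fun (f := ezComponent k S G m l h ∘ₗ TensorProduct.map
      (Bar.rightMul k m (MonoidAlgebra.of k G g)) (Bar.groupAct k S l g⁻¹ ∘ₗ Bar.rightMul k l s))
    (g := Bar.rightMul k n (skewSingle g s) ∘ₗ ezComponent k S G m l h)
    (ext_groupTuple_tmul fun γ w => ?_) (b ⊗ₜ y)
  change ezComponent k S G m l h ((op (MonoidAlgebra.of k G g) • groupTuple k γ) ⊗ₜ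
      (Bar.groupAct k S l g⁻¹ (op s • Bar.tuple k S w))) =
    op (skewSingle g s) •
      ezComponent k S G m l h (groupTuple k γ ⊗ₜ Bar.tuple k S w)
  rw [op_of_smul_groupTuple, Bar.op_smul_tuple, Bar.groupAct_tuple, ezComponent_tmul,
    ezComponent_tmul, ezTerm_op_smul]

end EilenbergZilber

/-! ### Total complexes -/

section Total

variable {k : Type*} [Field k] {X Y : ℕ → Type*}
  [∀ n, AddCommGroup (X n)] [∀ n, Module k (X n)] [∀ n, AddCommGroup (Y n)] [∀ n, Module k (Y n)]

/-- The inclusion of the summand of bidegree `(m, l)` into the total complex. -/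
def Total.incl (k : Type*) [Field k] (X Y : ℕ → Type*)
    [∀ n, AddCommGroup (X n)] [∀ n, Module k (X n)] [∀ n, AddCommGroup (Y n)]
    [∀ n, Module k (Y n)] {n : ℕ} (m l : ℕ) (h : m + l = n) : X m ⊗[k] Y l →ₗ[k] Total k X Y n :=
  LinearMap.single k (fun q : Bidegree n => X q.1.1 ⊗[k] Y q.1.2) (Bidegree.mk m l h)

theorem Total.ext_incl {n : ℕ} {N : Type*} [AddCommGroup N] [Module k N]
    {f g : Total k X Y n →ₗ[k] N}
    (h : ∀ m l (h : m + l = n) z, f (Total.incl k X Y m l h z) = g (Total.incl k X Y m l h z)) :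
    f = g :=
  LinearMap.pi_ext fun p z => h p.1.1 p.1.2 p.add_eq z

theorem Total.incl_self {n : ℕ} (m l : ℕ) (h : m + l = n) (z : X m ⊗[k] Y l) :
    (Total.incl k X Y m l h z (Bidegree.mk m l h) : X m ⊗[k] Y l) = z :=
  Pi.single_eq_same (M := fun q : Bidegree n => X q.1.1 ⊗[k] Y q.1.2) _ _

theorem Total.incl_of_ne {n : ℕ} (m l : ℕ) (h : m + l = n) (z : X m ⊗[k] Y l) (p : Bidegree n)
    (hp : p.1 ≠ (m, l)) : Total.incl k X Y m l h z p = 0 :=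
  Pi.single_eq_of_ne (M := fun q : Bidegree n => X q.1.1 ⊗[k] Y q.1.2)
    (fun e => hp (congrArg Subtype.val e)) _

variable (dX : ∀ n, X (n + 1) →ₗ[k] X n) (dY : ∀ n, Y (n + 1) →ₗ[k] Y n)

/-- The component `dX ⊗ 1` of the total differential on the summand of bidegree `(m, l)`. -/
def Total.dLeft {n : ℕ} : ∀ (m l : ℕ) (_ : m + l = n + 1), X m ⊗[k] Y l →ₗ[k] Total k X Y n
  | 0, _, _ => 0
  | m + 1, l, h => Total.incl k X Y m l (by omega) ∘ₗ (dX m).rTensor (Y l)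

/-- The component `± 1 ⊗ dY` of the total differential on the summand of bidegree `(m, l)`. -/
def Total.dRight {n : ℕ} : ∀ (m l : ℕ) (_ : m + l = n + 1), X m ⊗[k] Y l →ₗ[k] Total k X Y n
  | _, 0, _ => 0
  | m, l + 1, h => (-1 : k) ^ m • Total.incl k X Y m l (by omega) ∘ₗ (dY l).lTensor (X m)

theorem Total.d_apply {n : ℕ} (t : Total k X Y (n + 1)) (m l : ℕ) (h : m + l = n) :
    (Total.d dX dY n t (Bidegree.mk m l h) : X m ⊗[k] Y l) =
      (dX m).rTensor (Y l) (t (Bidegree.mk (m + 1) l (by omega))) +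
        (-1 : k) ^ m • (dY l).lTensor (X m) (t (Bidegree.mk m (l + 1) (by omega))) := rfl

theorem Total.d_incl {n : ℕ} (m l : ℕ) (h : m + l = n + 1) (z : X m ⊗[k] Y l) :
    Total.d dX dY n (Total.incl k X Y m l h z) =
      Total.dLeft dX m l h z + Total.dRight dY m l h z := by
  funext p
  obtain ⟨⟨i, j⟩, hp⟩ := p
  have hij : i + j = n := Finset.HasAntidiagonal.mem_antidiagonal.mp hp
  refine (Total.d_apply dX dY _ i j hij).trans ?_
  change _ = (Total.dLeft dX m l h z (Bidegree.mk i j hij) : X i ⊗[k] Y j) +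
    (Total.dRight dY m l h z (Bidegree.mk i j hij) : X i ⊗[k] Y j)
  congr 1
  · by_cases hm : m = i + 1
    · subst hm
      obtain rfl : l = j := by omega
      rw [Total.incl_self]
      exact (Total.incl_self i l hij _).symm
    · rw [Total.incl_of_ne _ _ _ _ _ (by simp [Bidegree.mk]; omega)]
      refine (map_zero _).trans ?_
      cases m with
      | zero => rfl
      | succ m =>
        exact (Total.incl_of_ne m l (show m + l = n by omega) _ (Bidegree.mk i j hij)
          (by simp [Bidegree.mk]; omega)).symm
  · by_cases hl : l = j + 1
    · subst hl
      obtain rfl : m = i := by omega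
      rw [Total.incl_self]
      exact congrArg _ (Total.incl_self m j hij _).symm
    · rw [Total.incl_of_ne _ _ _ _ _ (by simp [Bidegree.mk]; omega)]
      refine (congrArg _ (map_zero _)).trans ((smul_zero _).trans ?_)
      cases l with
      | zero => rfl
      | succ l =>
        refine ((congrArg (fun z : X i ⊗[k] Y j => (-1 : k) ^ m • z) (Total.incl_of_ne m l
          (show m + l = n by omega) _ (Bidegree.mk i j hij)
          (by simp [Bidegree.mk]; omega))).trans
          (smul_zero (A := X i ⊗[k] Y j) ((-1 : k) ^ m))).symm

theorem Total.d_d (hX : ∀ n x, dX n (dX (n + 1) x) = 0) (hY : ∀ n y, dY n (dY (n + 1) y) = 0)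
    (n : ℕ) (t : Total k X Y (n + 2)) : Total.d dX dY n (Total.d dX dY (n + 1) t) = 0 := by
  have hX' : ∀ n, dX n ∘ₗ dX (n + 1) = 0 := fun n => LinearMap.ext (hX n)
  have hY' : ∀ n, dY n ∘ₗ dY (n + 1) = 0 := fun n => LinearMap.ext (hY n)
  have key : ∀ (i j : ℕ) (a : X (i + 2) ⊗[k] Y j) (b : X (i + 1) ⊗[k] Y (j + 1))
      (c : X i ⊗[k] Y (j + 2)),
      (dX i).rTensor (Y j) ((dX (i + 1)).rTensor (Y j) a +
        (-1 : k) ^ (i + 1) • (dY j).lTensor (X (i + 1)) b) +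
      (-1 : k) ^ i • (dY j).lTensor (X i) ((dX i).rTensor (Y (j + 1)) b +
        (-1 : k) ^ i • (dY (j + 1)).lTensor (X i) c) = 0 := by
    intro i j a b c
    have ha : (dX i).rTensor (Y j) ((dX (i + 1)).rTensor (Y j) a) = 0 := by
      rw [← LinearMap.comp_apply, ← LinearMap.rTensor_comp, hX', LinearMap.rTensor_zero,
        LinearMap.zero_apply]
    have hc : (dY j).lTensor (X i) ((dY (j + 1)).lTensor (X i) c) = 0 := by
      rw [← LinearMap.comp_apply, ← LinearMap.lTensor_comp, hY', LinearMap.lTensor_zero,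
        LinearMap.zero_apply]
    have hb : (dX i).rTensor (Y j) ((dY j).lTensor (X (i + 1)) b) =
        (dY j).lTensor (X i) ((dX i).rTensor (Y (j + 1)) b) := by
      rw [← LinearMap.comp_apply, LinearMap.rTensor_comp_lTensor, ← LinearMap.comp_apply,
        LinearMap.lTensor_comp_rTensor]
    simp only [map_add, map_smul, map_neg, ha, hb, hc, smul_zero, add_zero, zero_add, pow_succ,
      mul_neg, mul_one, neg_smul, neg_add_cancel]
  funext p
  obtain ⟨⟨i, j⟩, hp⟩ := p
  have hij : i + j = n := Finset.HasAntidiagonal.mem_antidiagonal.mp hp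
  exact key i j (t (Bidegree.mk (i + 2) j (by omega))) (t (Bidegree.mk (i + 1) (j + 1) (by omega)))
    (t (Bidegree.mk i (j + 2) (by omega)))

theorem Total.map_d_d (hX : ∀ n x, dX n (dX (n + 1) x) = 0) (hY : ∀ n y, dY n (dY (n + 1) y) = 0)
    {n : ℕ} {N : Type*} [AddCommGroup N] [Module k N] (f : Total k X Y n →ₗ[k] N)
    (t : Total k X Y (n + 2)) : f (Total.d dX dY n (Total.d dX dY (n + 1) t)) = 0 := by
  rw [Total.d_d dX dY hX hY, map_zero]

end Total

/-! ### Augmentations of tensor products -/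

section Augmentation

variable {k A M N M' N' : Type*} [Field k] [Ring A] [Algebra k A] [AddCommGroup M] [Module k M]
  [AddCommGroup N] [Module k N] [AddCommGroup M'] [Module k M'] [AddCommGroup N'] [Module k N']
  (f : M →ₗ[k] A) (g : N →ₗ[k] A)

theorem mul'_map_lTensor (d : N' →ₗ[k] N) (hd : ∀ x, g (d x) = 0) (z : M ⊗[k] N') :
    LinearMap.mul' k A (TensorProduct.map f g (d.lTensor M z)) = 0 := by
  induction z with
  | zero => simp
  | add x y hx hy => rw [map_add, map_add, map_add, hx, hy, add_zero]
  | tmul x y => simp [hd]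

theorem mul'_map_rTensor (d : M' →ₗ[k] M) (hd : ∀ x, f (d x) = 0) (z : M' ⊗[k] N) :
    LinearMap.mul' k A (TensorProduct.map f g (d.rTensor N z)) = 0 := by
  induction z with
  | zero => simp
  | add x y hx hy => rw [map_add, map_add, map_add, hx, hy, add_zero]
  | tmul x y => simp [hd]

end Augmentation

/-! ### The Eilenberg-Zilber map is a chain map -/

section EilenbergZilberChain

variable {k S G : Type*} [Field k] [Ring S] [Algebra k S] [Group G] [MulSemiringAction G S]
  [SMulCommClass G k S] {n : ℕ} [Fintype G]

theorem EZ_incl {m l : ℕ} (h : m + l = n) (z : Bar k (MonoidAlgebra k G) m ⊗[k] Bar k S l) :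
    EZ k S G n (Total.incl k (fun i => Bar k (MonoidAlgebra k G) i) (fun j => Bar k S j) m l h z) =
      ezComponent k S G m l h z := by
  rw [EZ_apply, Finset.sum_eq_single (Bidegree.mk m l h)]
  · rw [Total.incl_self]
    rfl
  · intro p _ hp
    rw [Total.incl_of_ne, map_zero]
    exact fun e => hp (Subtype.ext e)
  · simp

omit [Fintype G] in
theorem homotopy_ezTerm {m l : ℕ} (h : m + l = n) (γ : Fin (m + 2) → G) (w : Fin (l + 2) → S)
    (hγ : γ 0 = 1) (hw : w 0 = 1) :
    Bar.homotopy k (SkewMonoidAlgebra S G) n (ezTerm k S m l h γ w) = 0 := by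
  classical
  rw [ezTerm_apply, map_sum]
  refine Finset.sum_eq_zero fun σ _ => ?_
  split_ifs
  · rw [map_smul, Bar.homotopy_tuple_eq_zero, smul_zero]
    rw [ezTuple_zero, hγ, hw, smul_one, SkewMonoidAlgebra.one_def]
  · rw [map_zero]

theorem contractNth_zero_of_eq_one {A : Type*} [Monoid A] (v : Fin (n + 3) → A) (hv : v 0 = 1) :
    Fin.contractNth (0 : Fin (n + 2)).castSucc (· * ·) v = Fin.tail v := by
  funext r
  induction r using Fin.cases with
  | zero => simp [Fin.contractNth, hv, Fin.tail]
  | succ r => simp [Fin.contractNth, Fin.tail]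

theorem contractNth_succ_zero {A : Type*} [Monoid A] (j : Fin (n + 1)) (v : Fin (n + 3) → A) :
    Fin.contractNth j.succ.castSucc (· * ·) v 0 = v 0 := by
  simp [Fin.contractNth]

local notation "BG" => fun i : ℕ => Bar k (MonoidAlgebra k G) i
local notation "BS" => fun j : ℕ => Bar k S j
local notation "dG" => Bar.d k (MonoidAlgebra k G)
local notation "dS" => Bar.d k S

/-- The composite of the part `d ⊗ 1` of the total differential with the Eilenberg-Zilber map. -/
noncomputable def ezdLeft : ∀ (m l : ℕ) (_ : m + l = n + 1),
    Bar k (MonoidAlgebra k G) m ⊗[k] Bar k S l →ₗ[k] Bar k (SkewMonoidAlgebra S G) n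
  | 0, _, _ => 0
  | m + 1, l, h => ezComponent k S G m l (by omega) ∘ₗ (dG m).rTensor (Bar k S l)

/-- The composite of the part `± 1 ⊗ d` of the total differential with the Eilenberg-Zilber map. -/
noncomputable def ezdRight : ∀ (m l : ℕ) (_ : m + l = n + 1),
    Bar k (MonoidAlgebra k G) m ⊗[k] Bar k S l →ₗ[k] Bar k (SkewMonoidAlgebra S G) n
  | _, 0, _ => 0
  | m, l + 1, h => (-1 : k) ^ m • ezComponent k S G m l (by omega) ∘ₗ
      (dS l).lTensor (Bar k (MonoidAlgebra k G) m)

theorem EZ_dLeft {m l : ℕ} (h : m + l = n + 1)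
    (z : Bar k (MonoidAlgebra k G) m ⊗[k] Bar k S l) :
    EZ k S G n (Total.dLeft (X := BG) (Y := BS) dG m l h z) = ezdLeft m l h z := by
  cases m with
  | zero => exact map_zero _
  | succ m => exact EZ_incl _ _

theorem EZ_dRight {m l : ℕ} (h : m + l = n + 1)
    (z : Bar k (MonoidAlgebra k G) m ⊗[k] Bar k S l) :
    EZ k S G n (Total.dRight (X := BG) (Y := BS) dS m l h z) = ezdRight m l h z := by
  cases l with
  | zero => exact map_zero _
  | succ l => exact (map_smul (EZ k S G n) _ _).trans (congrArg _ (EZ_incl _ _))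

theorem EZ_d_incl {m l : ℕ} (h : m + l = n + 1)
    (z : Bar k (MonoidAlgebra k G) m ⊗[k] Bar k S l) :
    EZ k S G n (Total.d dG dS n (Total.incl k BG BS m l h z)) =
      ezdLeft m l h z + ezdRight m l h z := by
  rw [← EZ_dLeft, ← EZ_dRight, Total.d_incl]
  exact map_add _ _ _

/-- Among the faces of `γ` only the one that drops the trivial first entry survives: the others
still start with a trivial entry, and the homotopy kills their images. -/
theorem homotopy_ezdLeft {m l : ℕ} (h : m + l = n + 1) (γ : Fin (m + 2) → G)
    (w : Fin (l + 2) → S) (hγ : γ 0 = 1) (hw : w 0 = 1) :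
    Bar.homotopy k (SkewMonoidAlgebra S G) n (ezdLeft m l h (groupTuple k γ ⊗ₜ Bar.tuple k S w)) =
      Bar.homotopy k (SkewMonoidAlgebra S G) n (ezLeft k m l h γ w) := by
  cases m with
  | zero => rfl
  | succ m =>
    rw [ezdLeft, LinearMap.comp_apply, LinearMap.rTensor_tmul, d_groupTuple,
      TensorProduct.sum_tmul, map_sum, map_sum, Fin.sum_univ_succ, Finset.sum_eq_zero, add_zero,
      contractNth_zero_of_eq_one γ hγ, Fin.val_zero, pow_zero, one_smul, ezComponent_tmul, ezLeft]
    intro j _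
    rw [← TensorProduct.smul_tmul', map_smul, map_smul, ezComponent_tmul, homotopy_ezTerm,
      smul_zero]
    · rw [contractNth_succ_zero, hγ]
    · exact hw

/-- The counterpart of `homotopy_ezdLeft` for the faces of `w`. -/
theorem homotopy_ezdRight {m l : ℕ} (h : m + l = n + 1) (γ : Fin (m + 2) → G)
    (w : Fin (l + 2) → S) (hγ : γ 0 = 1) (hw : w 0 = 1) :
    Bar.homotopy k (SkewMonoidAlgebra S G) n (ezdRight m l h (groupTuple k γ ⊗ₜ Bar.tuple k S w)) =
      Bar.homotopy k (SkewMonoidAlgebra S G) n (ezRight k m l h γ w) := by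
  cases l with
  | zero => rfl
  | succ l =>
    rw [ezdRight, LinearMap.smul_apply, LinearMap.comp_apply,
      LinearMap.lTensor_tmul, Bar.d_tuple, TensorProduct.tmul_sum, map_sum, map_smul, map_sum,
      Fin.sum_univ_succ, Finset.sum_eq_zero, add_zero,
      contractNth_zero_of_eq_one w hw, Fin.val_zero, pow_zero, one_smul, ezComponent_tmul, ezRight,
      map_smul]
    intro j _
    rw [TensorProduct.tmul_smul, map_smul, map_smul, ezComponent_tmul, homotopy_ezTerm, smul_zero]
    · exact hγ
    · rw [contractNth_succ_zero, hw]

/-- On generators, the Eilenberg-Zilber map is determined by its values in lower degrees. -/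
theorem ezTerm_eq_homotopy_ezd {m l : ℕ} (h : m + l = n + 1) (γ : Fin (m + 2) → G)
    (w : Fin (l + 2) → S) (hγ : γ 0 = 1) (hw : w 0 = 1) :
    ezTerm k S m l h γ w =
      Bar.homotopy k (SkewMonoidAlgebra S G) n (ezdLeft m l h (groupTuple k γ ⊗ₜ Bar.tuple k S w) +
        ezdRight m l h (groupTuple k γ ⊗ₜ Bar.tuple k S w)) := by
  rw [ezTerm_eq_homotopy h γ w hγ hw, ← homotopy_ezdLeft h γ w hγ hw,
    ← homotopy_ezdRight h γ w hγ hw]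
  exact (map_add (Bar.homotopy k (SkewMonoidAlgebra S G) n) _ _).symm

theorem ezdLeft_smul {m l : ℕ} (h : m + l = n + 1) (g x : G) (s : S)
    {b : Bar k (MonoidAlgebra k G) m} (hb : b ∈ Bar.groupPart k m x) (y : Bar k S l) :
    ezdLeft m l h ((MonoidAlgebra.of k G g • b) ⊗ₜ (((g * x)⁻¹ • s) • y)) =
    skewSingle g s • ezdLeft m l h (b ⊗ₜ y) := by
  cases m with
  | zero => exact (smul_zero _).symm
  | succ m =>
    rw [ezdLeft, LinearMap.comp_apply, LinearMap.comp_apply,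
      LinearMap.rTensor_tmul, LinearMap.rTensor_tmul, Bar.d_smul,
      ezComponent_smul _ g x s (d_mem_groupPart hb)]

theorem ezdRight_smul {m l : ℕ} (h : m + l = n + 1) (g x : G) (s : S)
    {b : Bar k (MonoidAlgebra k G) m} (hb : b ∈ Bar.groupPart k m x) (y : Bar k S l) :
    ezdRight m l h ((MonoidAlgebra.of k G g • b) ⊗ₜ (((g * x)⁻¹ • s) • y)) =
    skewSingle g s • ezdRight m l h (b ⊗ₜ y) := by
  cases l with
  | zero => exact (smul_zero _).symm
  | succ l =>
    rw [ezdRight, LinearMap.smul_apply, LinearMap.comp_apply,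
      LinearMap.smul_apply, LinearMap.comp_apply,
      LinearMap.lTensor_tmul, LinearMap.lTensor_tmul, Bar.d_smul,
      ezComponent_smul _ g x s hb, smul_comm]

variable (k G) in
/-- The algebra map `kG → S ⋊ G`, as a linear map. -/
noncomputable def groupIncl (S : Type*) [Ring S] [Algebra k S] :
    MonoidAlgebra k G →ₗ[k] SkewMonoidAlgebra S G :=
  ∑ g : G, SkewMonoidAlgebra.lsingle (R := k) (M := S) g ∘ₗ (groupCoeff k G g).smulRight (1 : S)

theorem groupIncl_of (g : G) :
    groupIncl k G S (MonoidAlgebra.of k G g) = SkewMonoidAlgebra.single g 1 := by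
  classical
  rw [groupIncl, LinearMap.sum_apply, Finset.sum_eq_single g]
  · rw [LinearMap.comp_apply, LinearMap.smulRight_apply, groupCoeff_of, if_pos rfl, one_smul,
      SkewMonoidAlgebra.lsingle_apply]
  · intro g' _ hne
    rw [LinearMap.comp_apply, LinearMap.smulRight_apply, groupCoeff_of, if_neg (Ne.symm hne),
      zero_smul, map_zero]
  · simp

omit [Fintype G] in
theorem aug_groupTuple (γ : Fin 2 → G) :
    Bar.aug k (MonoidAlgebra k G) (groupTuple k γ) = MonoidAlgebra.of k G (γ 0 * γ 1) := by
  rw [groupTuple, Bar.aug_tuple, map_mul]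

/-- The Eilenberg-Zilber map commutes with the augmentations. -/
theorem aug_ezComponent (z : Bar k (MonoidAlgebra k G) 0 ⊗[k] Bar k S 0) :
    Bar.aug k (SkewMonoidAlgebra S G) (ezComponent k S G 0 0 rfl z) =
      LinearMap.mul' k (SkewMonoidAlgebra S G) (TensorProduct.map
        (groupIncl k G S ∘ₗ Bar.aug k (MonoidAlgebra k G))
        (SkewMonoidAlgebra.lsingle (R := k) (M := S) 1 ∘ₗ Bar.aug k S) z) := by
  classical
  refine LinearMap.congr_fun (f := Bar.aug k (SkewMonoidAlgebra S G) ∘ₗ ezComponent k S G 0 0 rfl)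
    (g := LinearMap.mul' k (SkewMonoidAlgebra S G) ∘ₗ TensorProduct.map
        (groupIncl k G S ∘ₗ Bar.aug k (MonoidAlgebra k G))
        (SkewMonoidAlgebra.lsingle (R := k) (M := S) 1 ∘ₗ Bar.aug k S))
    (ext_groupTuple_tmul fun γ w => ?_) z
  have hs : IsShuffle 0 (1 : Equiv.Perm (Fin 0))⁻¹ := fun i => i.elim0
  have hγ : fullProd γ = γ 0 * γ 1 := by simp [fullProd]
  have h1 : ezTuple 0 0 rfl (1 : Equiv.Perm (Fin 0)) γ w 1 =
      SkewMonoidAlgebra.single (γ 1) (γ 1 • w 1) := ezTuple_last rfl 1 γ w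
  rw [LinearMap.comp_apply, LinearMap.comp_apply, ezComponent_tmul, ezTerm_apply,
    Fintype.sum_subsingleton _ (1 : Equiv.Perm (Fin 0)), if_pos hs, TensorProduct.map_tmul,
    LinearMap.mul'_apply, LinearMap.comp_apply, LinearMap.comp_apply, aug_groupTuple, groupIncl_of,
    Bar.aug_tuple, Equiv.Perm.sign_one, Units.val_one, Int.cast_one, one_smul, Bar.aug_tuple, h1,
    ezTuple_zero, SkewMonoidAlgebra.lsingle_apply, SkewMonoidAlgebra.single_mul_single,
    SkewMonoidAlgebra.single_mul_single, hγ, smul_mul', mul_one, one_mul, smul_smul]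

theorem groupIncl_aug_d (x : Bar k (MonoidAlgebra k G) 1) :
    (groupIncl k G S ∘ₗ Bar.aug k (MonoidAlgebra k G)) (dG 0 x) = 0 := by
  refine LinearMap.congr_fun (f := (groupIncl k G S ∘ₗ Bar.aug k (MonoidAlgebra k G)) ∘ₗ dG 0)
    (g := 0) (ext_groupTuple fun γ => ?_) x
  rw [LinearMap.comp_apply, d_groupTuple, Fin.sum_univ_two, map_add, map_smul, map_smul,
    LinearMap.comp_apply, LinearMap.comp_apply, aug_groupTuple, aug_groupTuple]
  simp [Fin.contractNth, mul_assoc]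

/-- In degree one, `EZ ∘ d` takes values in the kernel of the augmentation; this takes the place of
`d ∘ d = 0` at the start of the induction for `isChainMap_EZ`. -/
theorem aug_ezd {m l : ℕ} (h : m + l = 0 + 1) (z : Bar k (MonoidAlgebra k G) m ⊗[k] Bar k S l) :
    ezdLeft m l h z + ezdRight m l h z ∈ LinearMap.ker (Bar.aug k (SkewMonoidAlgebra S G)) := by
  refine Submodule.add_mem _ ?_ ?_
  · cases m with
    | zero => exact Submodule.zero_mem _
    | succ m =>
      obtain ⟨rfl, rfl⟩ : m = 0 ∧ l = 0 := by omega
      exact (aug_ezComponent _).trans (mul'_map_rTensor _ _ _ groupIncl_aug_d z)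
  · cases l with
    | zero => exact Submodule.zero_mem _
    | succ l =>
      obtain ⟨rfl, rfl⟩ : m = 0 ∧ l = 0 := by omega
      rw [ezdRight, pow_zero, one_smul]
      exact (aug_ezComponent _).trans (mul'_map_lTensor _ _ _ (fun x =>
        (congrArg (SkewMonoidAlgebra.lsingle (R := k) (M := S) 1) (Bar.aug_d x)).trans
          (map_zero (SkewMonoidAlgebra.lsingle (R := k) (M := S) 1))) z)

/-- By linearity, the Eilenberg-Zilber map commutes with the differentials in a given degree if it
does so on the generators of the bimodules. -/
theorem EZ_d_of_generators
    (H : ∀ (m l : ℕ) (h : m + l = n + 1) (γ : Fin (m + 2) → G) (w : Fin (l + 2) → S),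
      γ 0 = 1 → w 0 = 1 →
      ezdLeft m l h (groupTuple k γ ⊗ₜ Bar.tuple k S w) +
        ezdRight m l h (groupTuple k γ ⊗ₜ Bar.tuple k S w) =
      Bar.d k (SkewMonoidAlgebra S G) n (ezTerm k S m l h γ w))
    (t : Total k BG BS (n + 1)) :
    EZ k S G n (Total.d dG dS n t) =
      Bar.d k (SkewMonoidAlgebra S G) n (EZ k S G (n + 1) t) := by
  refine LinearMap.congr_fun (f := EZ k S G n ∘ₗ Total.d (X := BG) (Y := BS) dG dS n)
    (g := Bar.d k (SkewMonoidAlgebra S G) n ∘ₗ EZ k S G (n + 1))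
    (Total.ext_incl fun m l h z => ?_) t
  refine (EZ_d_incl h z).trans (Eq.trans ?_ (congrArg (Bar.d k (SkewMonoidAlgebra S G) n)
    (EZ_incl h z)).symm)
  refine LinearMap.congr_fun (f := ezdLeft m l h + ezdRight m l h)
    (g := Bar.d k (SkewMonoidAlgebra S G) n ∘ₗ ezComponent k S G m l h)
    (ext_groupTuple_tmul fun γ w => ?_) z
  rw [LinearMap.add_apply, LinearMap.comp_apply]
  set γ' : Fin (m + 2) → G := Function.update γ 0 1
  set w' : Fin (l + 2) → S := Function.update w 0 1
  have eγ : groupTuple k γ = MonoidAlgebra.of k G (γ 0) • groupTuple k γ' := groupTuple_eq_smul γ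
  have ew : Bar.tuple k S w = ((γ 0 * fullProd γ')⁻¹ • ((γ 0 * fullProd γ') • w 0)) •
      Bar.tuple k S w' := by
    rw [inv_smul_smul]
    exact Bar.tuple_eq_smul w
  have hb := groupTuple_mem_groupPart (k := k) γ'
  have h1 := H m l h γ' w' (Function.update_self _ _ _) (Function.update_self _ _ _)
  rw [eγ, ew, ezdLeft_smul h _ _ _ hb, ezdRight_smul h _ _ _ hb,
    ezComponent_smul h _ _ _ hb, ezComponent_tmul]
  exact Bar.smul_add_smul_of_eq_d (A := SkewMonoidAlgebra S G) h1 _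

/-- The twisted Eilenberg-Zilber map is a chain map. By linearity it is enough to consider
generators. There `EZ = h ∘ EZ ∘ d` for the contracting homotopy `h`, so that by induction
`d ∘ EZ = EZ ∘ d - h ∘ d ∘ EZ ∘ d = EZ ∘ d - h ∘ EZ ∘ d ∘ d = EZ ∘ d`. -/
theorem isChainMap_EZ :
    IsChainMap (Total.d dG dS) (Bar.d k (SkewMonoidAlgebra S G)) (EZ k S G) := by
  intro n
  induction n with
  | zero =>
    refine EZ_d_of_generators fun m l h γ w hγ hw => ?_
    rw [ezTerm_eq_homotopy_ezd h γ w hγ hw]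
    exact (Bar.d_homotopy_zero_of_mem_ker (A := SkewMonoidAlgebra S G) (aug_ezd h _)).symm
  | succ n ih =>
    refine EZ_d_of_generators fun m l h γ w hγ hw => ?_
    have h0 : Bar.d k (SkewMonoidAlgebra S G) n (EZ k S G (n + 1) (Total.d dG dS (n + 1)
        (Total.incl k BG BS m l h (groupTuple k γ ⊗ₜ Bar.tuple k S w)))) = 0 :=
      (ih _).symm.trans
        (Total.map_d_d (X := BG) (Y := BS) dG dS (fun _ => Bar.d_d (A := MonoidAlgebra k G))
          (fun _ => Bar.d_d (A := S)) (EZ k S G n) _)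
    rw [EZ_d_incl] at h0
    rw [ezTerm_eq_homotopy_ezd h γ w hγ hw]
    exact (Bar.d_homotopy_of_d_eq_zero (A := SkewMonoidAlgebra S G) h0).symm

end EilenbergZilberChain

/-! ### The Alexander-Whitney map and the bimodule structures -/

section AlexanderWhitneyBimodule

variable {k S G : Type*} [Field k] [Ring S] [Algebra k S] [Group G] [MulSemiringAction G S]
  {n : ℕ}

theorem tailProd_zero {A : Type*} [Monoid A] {N : ℕ} (v : Fin (N + 1) → A) :
    tailProd v 0 = fullProd v := by
  rw [tailProd_eq, fullProd_eq]
  exact prodOver_congr (fun i => by simp) fun _ _ => rfl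

theorem tailProd_last {A : Type*} [Monoid A] {N : ℕ} (v : Fin (N + 1) → A) :
    tailProd v (Fin.last N) = v (Fin.last N) :=
  prodOver_eq_single (p := fun i => Fin.last N ≤ i) v _ le_rfl
    fun _ hi hne => absurd (Fin.last_le_iff.mp hi) hne

theorem diag_mul_head (γ : Fin (n + 2) → G) (w : Fin (n + 2) → S) (g : G) (s : S) :
    Function.update (diag γ w) 0 (skewSingle g s * diag γ w 0) =
      diag (Function.update γ 0 (g * γ 0))
        (Function.update w 0 (((g * fullProd γ)⁻¹ • s) * w 0)) := by
  funext r
  by_cases hr : r = 0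
  · subst hr
    rw [Function.update_self, diag, diag, Function.update_self, Function.update_self, tailProd_zero,
      tailProd_zero, fullProd_mul_head, SkewMonoidAlgebra.single_mul_single, smul_mul',
      smul_inv_smul, mul_smul]
  · rw [Function.update_of_ne hr, diag, diag, Function.update_of_ne hr, Function.update_of_ne hr,
      tailProd_eq, tailProd_eq, prodOver_update_of_not _ (fun h => hr (Fin.le_zero_iff.mp h))]

theorem diag_mul_last (γ : Fin (n + 2) → G) (w : Fin (n + 2) → S) (g : G) (s : S) :
    Function.update (diag γ w) (Fin.last (n + 1)) (diag γ w (Fin.last (n + 1)) * skewSingle g s) =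
      diag (Function.update γ (Fin.last (n + 1)) (γ (Fin.last (n + 1)) * g))
        (fun i => g⁻¹ • Function.update w (Fin.last (n + 1)) (w (Fin.last (n + 1)) * s) i) := by
  funext r
  have ht : tailProd (Function.update γ (Fin.last (n + 1)) (γ (Fin.last (n + 1)) * g)) r =
      tailProd γ r * g := prodOver_mul_last _ (Fin.le_last r) _ _
  by_cases hr : r = Fin.last (n + 1)
  · subst hr
    rw [Function.update_self, diag, diag, Function.update_self, Function.update_self, ht,
      tailProd_last, SkewMonoidAlgebra.single_mul_single, smul_smul, mul_inv_cancel_right,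
      smul_mul']
  · rw [Function.update_of_ne hr, diag, diag, Function.update_of_ne hr, Function.update_of_ne hr,
      ht, smul_smul, mul_inv_cancel_right]

variable [SMulCommClass G k S] [Fintype G]

/-- In diagonal coordinates the Alexander-Whitney map commutes with the left action of `S ⋊ G`. -/
theorem AW_smul_diag (γ : Fin (n + 2) → G) (w : Fin (n + 2) → S) (g : G) (s : S)
    (p : Bidegree n) :
    AW k S n (skewSingle g s • Bar.tuple k (SkewMonoidAlgebra S G) (diag γ w)) p =
      TensorProduct.map (Bar.leftMul k p.1.1 (MonoidAlgebra.of k G g))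
        (Bar.leftMul k p.1.2 ((g * fullProd γ)⁻¹ • s))
        (AW k S n (Bar.tuple k (SkewMonoidAlgebra S G) (diag γ w)) p) := by
  rw [Bar.smul_tuple (A := SkewMonoidAlgebra S G), diag_mul_head, AW_diag, AW_diag, map_smul,
    TensorProduct.map_tmul, blockProd_mul_head (backMap p.add_eq) (Fin.ext (by simp [backMap])),
    blockProd_mul_head (frontMap p.add_eq) (Fin.ext (by simp [frontMap])), ← of_smul_groupTuple,
    ← Bar.smul_tuple]
  rfl

/-- The Alexander-Whitney map commutes with the right action of `S ⋊ G`. -/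
theorem AW_op_smul (g : G) (s : S) (b : Bar k (SkewMonoidAlgebra S G) n) (p : Bidegree n) :
    AW k S n (op (skewSingle g s) • b) p =
      TensorProduct.map (Bar.rightMul k p.1.1 (MonoidAlgebra.of k G g))
        (Bar.groupAct k S p.1.2 g⁻¹ ∘ₗ Bar.rightMul k p.1.2 s) (AW k S n b p) := by
  refine LinearMap.congr_fun (f := LinearMap.proj p ∘ₗ AW k S n ∘ₗ
      Bar.rightMul k n (skewSingle g s))
    (g := TensorProduct.map (Bar.rightMul k p.1.1 (MonoidAlgebra.of k G g))
        (Bar.groupAct k S p.1.2 g⁻¹ ∘ₗ Bar.rightMul k p.1.2 s) ∘ₗ LinearMap.proj p ∘ₗ AW k S n)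
    (ext_diag fun γ w => ?_) b
  change AW k S n (op (skewSingle g s) • Bar.tuple k (SkewMonoidAlgebra S G) (diag γ w)) p =
    TensorProduct.map (Bar.rightMul k p.1.1 (MonoidAlgebra.of k G g))
        (Bar.groupAct k S p.1.2 g⁻¹ ∘ₗ Bar.rightMul k p.1.2 s)
        (AW k S n (Bar.tuple k (SkewMonoidAlgebra S G) (diag γ w)) p)
  have hp := p.add_eq
  have hb : backMap p.add_eq (Fin.last (n + 1)) = Fin.last (p.1.1 + 1) :=
    Fin.ext (by simp [backMap]; omega)
  have hf : frontMap p.add_eq (Fin.last (n + 1)) = Fin.last (p.1.2 + 1) :=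
    Fin.ext (by simp [frontMap]; omega)
  have e : ∀ v : Fin (n + 2) → S, blockProd (frontMap p.add_eq) (fun i => g⁻¹ • v i) =
      fun j => g⁻¹ • blockProd (frontMap p.add_eq) v j :=
    fun v => funext fun j => (smul_prodOver g⁻¹ _ v).symm
  rw [Bar.op_smul_tuple (A := SkewMonoidAlgebra S G), diag_mul_last, AW_diag, AW_diag, map_smul,
    TensorProduct.map_tmul, blockProd_mul_last _ hb, e, blockProd_mul_last _ hf,
    ← op_of_smul_groupTuple, ← Bar.groupAct_tuple, ← Bar.op_smul_tuple]
  rfl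

/-- The part of total group degree `x` of the bar resolution of `S ⋊ G`. -/
noncomputable def skewPart (k S : Type*) {G : Type*} [Field k] [Ring S] [Algebra k S] [Group G]
    [MulSemiringAction G S] [SMulCommClass G k S] (n : ℕ) (x : G) :
    Submodule k (Bar k (SkewMonoidAlgebra S G) n) :=
  Submodule.span k {t | ∃ (γ : Fin (n + 2) → G) (w : Fin (n + 2) → S), fullProd γ = x ∧
    t = Bar.tuple k (SkewMonoidAlgebra S G) (diag γ w)}

/-- On homogeneous elements the Alexander-Whitney map commutes with the left action of `S ⋊ G`. -/
theorem AW_smul {g x : G} {s : S} {b : Bar k (SkewMonoidAlgebra S G) n} (hb : b ∈ skewPart k S n x)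
    (p : Bidegree n) :
    AW k S n (skewSingle g s • b) p =
      TensorProduct.map (Bar.leftMul k p.1.1 (MonoidAlgebra.of k G g))
        (Bar.leftMul k p.1.2 ((g * x)⁻¹ • s)) (AW k S n b p) := by
  refine LinearMap.eqOn_span (f := LinearMap.proj p ∘ₗ AW k S n ∘ₗ
      Bar.leftMul k n (skewSingle g s))
    (g := TensorProduct.map (Bar.leftMul k p.1.1 (MonoidAlgebra.of k G g))
        (Bar.leftMul k p.1.2 ((g * x)⁻¹ • s)) ∘ₗ LinearMap.proj p ∘ₗ AW k S n) ?_ hb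
  rintro _ ⟨γ, w, rfl, rfl⟩
  exact AW_smul_diag γ w g s p

omit [SMulCommClass G k S] [Fintype G] in
theorem exists_eq_diag (γ : Fin n → G) {v : Fin n → SkewMonoidAlgebra S G}
    (hv : ∀ i, ∃ s, v i = skewSingle (γ i) s) : ∃ w, v = diag γ w := by
  choose s hs using hv
  refine ⟨fun i => (tailProd γ i)⁻¹ • s i, funext fun i => ?_⟩
  rw [hs, diag, smul_inv_smul]

omit [Fintype G] in
/-- The Eilenberg-Zilber map preserves the total group degree. -/
theorem ezTerm_mem_skewPart {m l : ℕ} (h : m + l = n) (γ : Fin (m + 2) → G)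
    (w : Fin (l + 2) → S) : ezTerm k S m l h γ w ∈ skewPart k S n (fullProd γ) := by
  classical
  rw [ezTerm_apply]
  refine Submodule.sum_mem _ fun σ _ => ?_
  split_ifs with hσ
  · refine Submodule.smul_mem _ _ (Submodule.subset_span ?_)
    let γ' : Fin (n + 2) → G := Fin.cons (γ 0) (Fin.snoc (α := fun _ => G)
      (fun q => ezGroup m γ (σ q)) (γ (Fin.last (m + 1))))
    obtain ⟨u, hu⟩ := exists_eq_diag (S := S) γ' (v := ezTuple m l h σ γ w) (fun i => by
      induction i using Fin.cases with
      | zero => exact ⟨_, rfl⟩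
      | succ i =>
        induction i using Fin.lastCases with
        | last =>
          refine ⟨γ (Fin.last (m + 1)) • w (Fin.last (l + 1)), (ezTuple_last h σ γ w).trans ?_⟩
          simp only [γ', Fin.cons_succ, Fin.snoc_last]
        | cast q =>
          rw [ezTuple_middle]
          simp only [γ', Fin.cons_succ, Fin.snoc_castSucc, ezGroup]
          split_ifs
          · exact ⟨_, rfl⟩
          · exact ⟨_, rfl⟩)
    refine ⟨γ', u, ?_, by rw [hu]⟩
    rw [← fullProd_shuffle h σ hσ γ, fullProd_succ]
    congr 1
    rw [fullProd_eq, prodOver_castSucc, if_pos trivial, fullProd_eq]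
    congr 1
    · exact prodOver_congr (fun _ => Iff.rfl) fun i _ => by simp [γ', Fin.tail]
    · simp [γ', Fin.tail]
  · exact Submodule.zero_mem _

end AlexanderWhitneyBimodule

/-! ### The Alexander-Whitney map and the contracting homotopies -/

section AlexanderWhitneyHomotopy

variable {k S G : Type*} [Field k] [Ring S] [Algebra k S] [Group G] [MulSemiringAction G S]
  [SMulCommClass G k S] {n : ℕ} [Fintype G]

local notation "BG" => fun i : ℕ => Bar k (MonoidAlgebra k G) i
local notation "BS" => fun j : ℕ => Bar k S j

omit [SMulCommClass G k S] [Fintype G] in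
theorem cons_one_diag (γ : Fin (n + 2) → G) (w : Fin (n + 2) → S) :
    (Fin.cons 1 (diag γ w) : Fin (n + 3) → SkewMonoidAlgebra S G) =
      diag (Fin.cons 1 γ : Fin (n + 3) → G) (Fin.cons 1 w : Fin (n + 3) → S) := by
  funext r
  induction r using Fin.cases with
  | zero => rw [Fin.cons_zero, diag_eq_one rfl rfl]
  | succ r =>
    rw [Fin.cons_succ, diag, diag, Fin.cons_succ, Fin.cons_succ, tailProd_eq, tailProd_eq,
      prodOver_succ (fun j => r.succ ≤ j), if_neg (Fin.not_le.mpr (Fin.succ_pos r)), one_mul]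
    congr 2
    exact prodOver_congr (fun i => Fin.succ_le_succ_iff.symm) fun i _ => rfl

/-- The components of `AW (h b)` of positive degree in `S` come from `AW b` by the contracting
homotopy of the bar resolution of `S`. -/
theorem AW_homotopy_succ (b : Bar k (SkewMonoidAlgebra S G) n) {m l : ℕ} (h : m + l = n)
    (h' : m + (l + 1) = n + 1) :
    (AW k S (n + 1) (Bar.homotopy k (SkewMonoidAlgebra S G) n b) (Bidegree.mk m (l + 1) h') :
      Bar k (MonoidAlgebra k G) m ⊗[k] Bar k S (l + 1)) =
    (-1 : k) ^ m • (Bar.homotopy k S l).lTensor (Bar k (MonoidAlgebra k G) m)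
      (AW k S n b (Bidegree.mk m l h)) := by
  refine LinearMap.congr_fun
    (f := LinearMap.proj (R := k) (φ := fun q : Bidegree (n + 1) => BG q.1.1 ⊗[k] BS q.1.2)
      (Bidegree.mk m (l + 1) h') ∘ₗ
      AW k S (n + 1) ∘ₗ Bar.homotopy k (SkewMonoidAlgebra S G) n)
    (g := (-1 : k) ^ m • (Bar.homotopy k S l).lTensor (Bar k (MonoidAlgebra k G) m) ∘ₗ
      LinearMap.proj (R := k) (φ := fun q : Bidegree n => BG q.1.1 ⊗[k] BS q.1.2)
        (Bidegree.mk m l h) ∘ₗ AW k S n) (ext_diag fun γ w => ?_) b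
  change (AW k S (n + 1) (Bar.homotopy k (SkewMonoidAlgebra S G) n
      (Bar.tuple k (SkewMonoidAlgebra S G) (diag γ w))) (Bidegree.mk m (l + 1) h') :
      Bar k (MonoidAlgebra k G) m ⊗[k] Bar k S (l + 1)) =
    (-1 : k) ^ m • (Bar.homotopy k S l).lTensor (Bar k (MonoidAlgebra k G) m)
      (AW k S n (Bar.tuple k (SkewMonoidAlgebra S G) (diag γ w)) (Bidegree.mk m l h))
  rw [Bar.homotopy_tuple (A := SkewMonoidAlgebra S G), cons_one_diag, AW_diag_mk, AW_diag_mk,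
    map_smul, LinearMap.lTensor_tmul, Bar.homotopy_tuple, smul_smul, ← pow_add]
  have hb : blockProd (backMap h') (Fin.cons 1 γ : Fin (n + 3) → G) = blockProd (backMap h) γ := by
    funext j
    rw [blockProd_apply, prodOver_succ, Fin.cons_zero, ite_self, one_mul, blockProd_apply]
    refine prodOver_congr (fun i => ?_) fun i _ => Fin.cons_succ _ _ _
    simp only [backMap, Fin.ext_iff, Fin.val_succ]
    omega
  have hf : blockProd (frontMap h') (Fin.cons 1 w : Fin (n + 3) → S) =
      (Fin.cons 1 (blockProd (frontMap h) w) : Fin (l + 3) → S) := by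
    funext j
    rw [blockProd_apply, prodOver_succ, Fin.cons_zero, ite_self, one_mul]
    induction j using Fin.cases with
    | zero =>
      refine prodOver_eq_one fun i hi => absurd (congrArg Fin.val hi) ?_
      simp only [frontMap, Fin.val_succ, Fin.val_zero]
      omega
    | succ j =>
      rw [Fin.cons_succ, blockProd_apply]
      refine prodOver_congr (fun i => ?_) fun i _ => Fin.cons_succ _ _ _
      simp only [frontMap, Fin.ext_iff, Fin.val_succ]
      omega
  rw [hb, hf]
  congr 2
  ring

/-- The component of `AW (h b)` of degree zero in `S`: the whole `S`-part of `b` is multiplied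
together, and the homotopy acts on the `kG`-part. -/
theorem AW_homotopy_zero (b : Bar k (SkewMonoidAlgebra S G) n) (h : n + 0 = n)
    (h' : n + 1 + 0 = n + 1) :
    (AW k S (n + 1) (Bar.homotopy k (SkewMonoidAlgebra S G) n b) (Bidegree.mk (n + 1) 0 h') :
      Bar k (MonoidAlgebra k G) (n + 1) ⊗[k] Bar k S 0) =
    TensorProduct.map (Bar.homotopy k (MonoidAlgebra k G) n) (Bar.unit k S ∘ₗ Bar.aug k S)
      (AW k S n b (Bidegree.mk n 0 h)) := by
  refine LinearMap.congr_fun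
    (f := LinearMap.proj (R := k) (φ := fun q : Bidegree (n + 1) => BG q.1.1 ⊗[k] BS q.1.2)
      (Bidegree.mk (n + 1) 0 h') ∘ₗ
      AW k S (n + 1) ∘ₗ Bar.homotopy k (SkewMonoidAlgebra S G) n)
    (g := TensorProduct.map (Bar.homotopy k (MonoidAlgebra k G) n) (Bar.unit k S ∘ₗ Bar.aug k S) ∘ₗ
      LinearMap.proj (R := k) (φ := fun q : Bidegree n => BG q.1.1 ⊗[k] BS q.1.2)
        (Bidegree.mk n 0 h) ∘ₗ AW k S n) (ext_diag fun γ w => ?_) b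
  change (AW k S (n + 1) (Bar.homotopy k (SkewMonoidAlgebra S G) n
      (Bar.tuple k (SkewMonoidAlgebra S G) (diag γ w))) (Bidegree.mk (n + 1) 0 h') :
      Bar k (MonoidAlgebra k G) (n + 1) ⊗[k] Bar k S 0) =
    TensorProduct.map (Bar.homotopy k (MonoidAlgebra k G) n) (Bar.unit k S ∘ₗ Bar.aug k S)
      (AW k S n (Bar.tuple k (SkewMonoidAlgebra S G) (diag γ w)) (Bidegree.mk n 0 h))
  have hb : blockProd (backMap h') (Fin.cons 1 γ : Fin (n + 3) → G) =
      (Fin.cons 1 (blockProd (backMap h) γ) : Fin (n + 3) → G) := by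
    funext j
    rw [blockProd_apply, prodOver_succ, Fin.cons_zero, ite_self, one_mul]
    induction j using Fin.cases with
    | zero =>
      refine prodOver_eq_one fun i hi => absurd (congrArg Fin.val hi) ?_
      simp only [backMap, Fin.val_succ, Fin.val_zero]
      omega
    | succ j =>
      rw [Fin.cons_succ, blockProd_apply]
      refine prodOver_congr (fun i => ?_) fun i _ => Fin.cons_succ _ _ _
      simp only [backMap, Fin.ext_iff, Fin.val_succ]
      omega
  have hf : blockProd (frontMap h') (Fin.cons 1 w : Fin (n + 3) → S) =
      Fin.cons 1 (fun _ => blockProd (frontMap h) w 0 * blockProd (frontMap h) w 1) := by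
    funext j
    rw [blockProd_apply, prodOver_succ, Fin.cons_zero, ite_self, one_mul]
    induction j using Fin.cases with
    | zero =>
      refine prodOver_eq_one fun i hi => absurd (congrArg Fin.val hi) ?_
      simp only [frontMap, Fin.val_succ, Fin.val_zero]
      omega
    | succ j =>
      rw [Fin.cons_succ, blockProd_apply, blockProd_apply]
      simp only [Fin.cons_succ]
      refine prodOver_split _ (fun i => ?_) fun i i' hi hi' => ?_
      · simp only [frontMap, Fin.ext_iff, Fin.val_succ, Fin.val_zero, Fin.val_one]
        omega
      · simp only [frontMap, Fin.ext_iff, Fin.lt_def, Fin.val_zero, Fin.val_one] at *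
        omega
  have hG : Bar.homotopy k (MonoidAlgebra k G) n (groupTuple k (blockProd (backMap h) γ)) =
      groupTuple k (Fin.cons 1 (blockProd (backMap h) γ) : Fin (n + 3) → G) := by
    rw [groupTuple, Bar.homotopy_tuple (A := MonoidAlgebra k G), groupTuple]
    congr 1
    funext r
    induction r using Fin.cases with
    | zero => rw [Fin.cons_zero, Fin.cons_zero, map_one]
    | succ r => simp
  have hS : Bar.unit k S (Bar.aug k S (Bar.tuple k S (blockProd (frontMap h) w))) =
      Bar.tuple k S (n := 0) (Fin.cons 1
        (fun _ => blockProd (frontMap h) w 0 * blockProd (frontMap h) w 1)) := by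
    rw [Bar.aug_tuple]
    change Bar.tuple k S (Function.update (fun _ => 1) 1 _) = _
    congr 1
    funext r
    fin_cases r <;> simp
  rw [Bar.homotopy_tuple (A := SkewMonoidAlgebra S G), cons_one_diag, AW_diag_mk, AW_diag_mk,
    map_smul, TensorProduct.map_tmul, LinearMap.comp_apply, hb, hf, hG, hS, zero_mul, zero_mul]

omit [Fintype G] in
theorem ezTerm_zero (h : 0 + 0 = 0) (γ : Fin 2 → G) (w : Fin 2 → S) :
    ezTerm k S 0 0 h γ w = Bar.tuple k (SkewMonoidAlgebra S G) (diag γ w) := by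
  classical
  have hs : IsShuffle 0 (1 : Equiv.Perm (Fin 0))⁻¹ := fun i => i.elim0
  have hd : ezTuple 0 0 h (1 : Equiv.Perm (Fin 0)) γ w = diag γ w := by
    funext r
    fin_cases r
    · exact (ezTuple_zero h 1 γ w).trans (by rw [← tailProd_zero]; rfl)
    · refine (ezTuple_last h 1 γ w).trans ?_
      change _ = SkewMonoidAlgebra.single (γ (Fin.last 1))
        (tailProd γ (Fin.last 1) • w (Fin.last 1))
      rw [tailProd_last]
  rw [ezTerm_apply, Fintype.sum_subsingleton _ (1 : Equiv.Perm (Fin 0)), if_pos hs, hd,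
    Equiv.Perm.sign_one, Units.val_one, Int.cast_one, one_smul]

theorem AW_diag_zero (h : 0 + 0 = 0) (γ : Fin 2 → G) (w : Fin 2 → S) :
    (AW k S 0 (Bar.tuple k (SkewMonoidAlgebra S G) (diag γ w)) (Bidegree.mk 0 0 h) :
      Bar k (MonoidAlgebra k G) 0 ⊗[k] Bar k S 0) = groupTuple k γ ⊗ₜ Bar.tuple k S w := by
  have hb : ∀ {A : Type _} [Monoid A] (v : Fin 2 → A), blockProd (backMap h) v = v := fun v =>
    funext fun j => blockProd_eq_single _ v j j (Fin.ext (by simp [backMap]))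
      fun i' hi' hne => absurd (by simpa [backMap, Fin.ext_iff] using hi') hne
  have hf : ∀ {A : Type _} [Monoid A] (v : Fin 2 → A), blockProd (frontMap h) v = v := fun v =>
    funext fun j => blockProd_eq_single _ v j j (Fin.ext (by simp [frontMap]; omega))
      fun i' hi' hne => absurd (Fin.ext (by
        have := congrArg Fin.val hi'
        simp only [frontMap] at this
        omega)) hne
  rw [AW_diag_mk γ w h, hb, hf, pow_zero, one_smul]
  rfl

theorem AW_EZ_zero (t : Total k BG BS 0) : AW k S 0 (EZ k S G 0 t) = t := by
  refine LinearMap.congr_fun (f := AW k S 0 ∘ₗ EZ k S G 0) (g := LinearMap.id)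
    (Total.ext_incl fun m l h z => ?_) t
  obtain ⟨rfl, rfl⟩ : m = 0 ∧ l = 0 := by omega
  refine LinearMap.congr_fun (f := (AW k S 0 ∘ₗ EZ k S G 0) ∘ₗ Total.incl k BG BS 0 0 h)
    (g := Total.incl k BG BS 0 0 h) (ext_groupTuple_tmul fun γ w => ?_) z
  change AW k S 0 (EZ k S G 0 (Total.incl k BG BS 0 0 h (groupTuple k γ ⊗ₜ Bar.tuple k S w))) = _
  rw [EZ_incl, ezComponent_tmul, ezTerm_zero]
  funext p
  obtain ⟨⟨m, l⟩, hp⟩ := p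
  have hml : m + l = 0 := Finset.HasAntidiagonal.mem_antidiagonal.mp hp
  obtain ⟨rfl, rfl⟩ : m = 0 ∧ l = 0 := by omega
  exact (AW_diag_zero h γ w).trans (Total.incl_self (X := BG) (Y := BS) 0 0 h _).symm

/-- The Alexander-Whitney map commutes with the augmentations. -/
theorem aug_AW (b : Bar k (SkewMonoidAlgebra S G) 0) :
    LinearMap.mul' k (SkewMonoidAlgebra S G) (TensorProduct.map
        (groupIncl k G S ∘ₗ Bar.aug k (MonoidAlgebra k G))
        (SkewMonoidAlgebra.lsingle (R := k) (M := S) 1 ∘ₗ Bar.aug k S)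
        (AW k S 0 b (Bidegree.mk 0 0 rfl))) = Bar.aug k (SkewMonoidAlgebra S G) b := by
  refine (aug_ezComponent _).symm.trans (congrArg _ ?_)
  refine (LinearMap.congr_fun (f := ezComponent k S G 0 0 rfl ∘ₗ
      LinearMap.proj (R := k) (φ := fun q : Bidegree 0 => BG q.1.1 ⊗[k] BS q.1.2)
        (Bidegree.mk 0 0 rfl) ∘ₗ AW k S 0)
    (g := LinearMap.id) (ext_diag fun γ w => ?_) b)
  exact (congrArg (ezComponent k S G 0 0 rfl) (AW_diag_zero rfl γ w)).trans
    ((ezComponent_tmul rfl γ w).trans (ezTerm_zero rfl γ w))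

end AlexanderWhitneyHomotopy

/-! ### The Alexander-Whitney map is a retraction of the Eilenberg-Zilber map -/

theorem Total.map_incl {k : Type*} [Field k] {X Y X' Y' : ℕ → Type*}
    [∀ n, AddCommGroup (X n)] [∀ n, Module k (X n)] [∀ n, AddCommGroup (Y n)] [∀ n, Module k (Y n)]
    [∀ n, AddCommGroup (X' n)] [∀ n, Module k (X' n)]
    [∀ n, AddCommGroup (Y' n)] [∀ n, Module k (Y' n)] (f : ∀ n, X n →ₗ[k] X' n)
    (g : ∀ n, Y n →ₗ[k] Y' n) {n m l : ℕ} (h : m + l = n) (z : X m ⊗[k] Y l) :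
    Total.map f g n (Total.incl k X Y m l h z) =
      Total.incl k X' Y' m l h (TensorProduct.map (f m) (g l) z) := by
  funext p
  change TensorProduct.map (f p.1.1) (g p.1.2) (Total.incl k X Y m l h z p) = _
  by_cases hp : p.1 = (m, l)
  · obtain rfl : p = Bidegree.mk m l h := Subtype.ext hp
    rw [Total.incl_self]
    exact (Total.incl_self (X := X') (Y := Y') m l h _).symm
  · rw [Total.incl_of_ne _ _ _ _ _ hp, Total.incl_of_ne _ _ _ _ _ hp, map_zero]

section Retract

variable {k S G : Type*} [Field k] [Ring S] [Algebra k S] [Group G] [MulSemiringAction G S]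
  [SMulCommClass G k S] {n : ℕ} [Fintype G]

local notation "BG" => fun i : ℕ => Bar k (MonoidAlgebra k G) i
local notation "BS" => fun j : ℕ => Bar k S j

/-- The component of degree zero in `S` of `AW (h b)`, when `AW b = z` in bidegree `(m, l)`. -/
noncomputable def frontEdge : ∀ (m l : ℕ) (_ : m + l = n),
    Bar k (MonoidAlgebra k G) m ⊗[k] Bar k S l →ₗ[k] Total k BG BS (n + 1)
  | m, 0, h => Total.incl k BG BS (m + 1) 0 (by omega) ∘ₗ
      TensorProduct.map (Bar.homotopy k (MonoidAlgebra k G) m) (Bar.unit k S ∘ₗ Bar.aug k S)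
  | _, _ + 1, _ => 0

theorem AW_homotopy_of_incl {m l : ℕ} (h : m + l = n) (h' : m + (l + 1) = n + 1)
    {b : Bar k (SkewMonoidAlgebra S G) n} {z : Bar k (MonoidAlgebra k G) m ⊗[k] Bar k S l}
    (hb : AW k S n b = Total.incl k BG BS m l h z) :
    AW k S (n + 1) (Bar.homotopy k (SkewMonoidAlgebra S G) n b) =
      (-1 : k) ^ m • Total.incl k BG BS m (l + 1) h'
        ((Bar.homotopy k S l).lTensor (Bar k (MonoidAlgebra k G) m) z) + frontEdge m l h z := by
  funext p
  obtain ⟨⟨i, j⟩, hp⟩ := p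
  have hij : i + j = n + 1 := Finset.HasAntidiagonal.mem_antidiagonal.mp hp
  change _ = (-1 : k) ^ m • (Total.incl k BG BS m (l + 1) h'
        ((Bar.homotopy k S l).lTensor (Bar k (MonoidAlgebra k G) m) z) (Bidegree.mk i j hij) :
          Bar k (MonoidAlgebra k G) i ⊗[k] Bar k S j) +
    (frontEdge m l h z (Bidegree.mk i j hij) : Bar k (MonoidAlgebra k G) i ⊗[k] Bar k S j)
  cases j with
  | zero =>
    obtain rfl : i = n + 1 := by omega
    refine (AW_homotopy_zero b rfl hij).trans ?_
    rw [hb, Total.incl_of_ne m (l + 1) _ _ _ (by simp [Bidegree.mk])]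
    refine Eq.trans ?_ ((congrArg (· + (frontEdge m l h z (Bidegree.mk (n + 1) 0 hij) :
      Bar k (MonoidAlgebra k G) (n + 1) ⊗[k] Bar k S 0)) (smul_zero ((-1 : k) ^ m))).trans
      (zero_add _)).symm
    cases l with
    | zero =>
      obtain rfl : m = n := by omega
      rw [Total.incl_self]
      exact (Total.incl_self (X := BG) (Y := BS) (m + 1) 0 hij _).symm
    | succ l =>
      rw [Total.incl_of_ne _ _ _ _ _ (by simp [Bidegree.mk])]
      exact map_zero _
  | succ j =>
    refine (AW_homotopy_succ b (by omega) hij).trans ?_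
    have h0 : (frontEdge m l h z (Bidegree.mk i (j + 1) hij) :
        Bar k (MonoidAlgebra k G) i ⊗[k] Bar k S (j + 1)) = 0 := by
      cases l with
      | zero => exact Total.incl_of_ne (X := BG) (Y := BS) _ _ _ _ _ (by simp [Bidegree.mk])
      | succ l => rfl
    rw [h0, add_zero, hb]
    by_cases hi : i = m
    · subst hi
      obtain rfl : j = l := by omega
      rw [Total.incl_self]
      exact congrArg _ (Total.incl_self (X := BG) (Y := BS) i (j + 1) hij _).symm
    · rw [Total.incl_of_ne _ _ _ _ _ (by simp [Bidegree.mk, hi]),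
        Total.incl_of_ne _ _ _ _ _ (by simp [Bidegree.mk, hi])]
      exact (congrArg _ (map_zero _)).trans ((smul_zero _).trans (smul_zero _).symm)

theorem homotopy_tail_of_eq_one {A : Type*} [Ring A] [Algebra k A] (w : Fin (n + 3) → A)
    (hw : w 0 = 1) :
    Bar.homotopy k A n (Bar.tuple k A (Fin.tail w)) = Bar.tuple k A w := by
  rw [Bar.homotopy_tuple, ← hw, Fin.cons_self_tail]

/-- The induction step for `AW_EZ` on generators: `EZ` of a generator is the sum of the images under
the homotopy of two generators of lower degree, and of the resulting terms exactly one survives. -/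
theorem AW_ezTerm_of_eq_one (ih : ∀ t : Total k BG BS n, AW k S n (EZ k S G n t) = t)
    {m l : ℕ} (h : m + l = n + 1) (γ : Fin (m + 2) → G) (w : Fin (l + 2) → S) (hγ : γ 0 = 1)
    (hw : w 0 = 1) :
    AW k S (n + 1) (ezTerm k S m l h γ w) =
      Total.incl k BG BS m l h (groupTuple k γ ⊗ₜ Bar.tuple k S w) := by
  have ih' : ∀ {i j : ℕ} (hij : i + j = n) (γ : Fin (i + 2) → G) (w : Fin (j + 2) → S),
      AW k S n (ezTerm k S i j hij γ w) =
        Total.incl k BG BS i j hij (groupTuple k γ ⊗ₜ Bar.tuple k S w) := fun hij γ w => by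
    have := ih (Total.incl k BG BS _ _ hij (groupTuple k γ ⊗ₜ Bar.tuple k S w))
    rwa [EZ_incl, ezComponent_tmul] at this
  have hG : ∀ {m : ℕ} (γ : Fin (m + 2) → G), γ 0 = 1 →
      Bar.homotopy k (MonoidAlgebra k G) m (groupTuple k γ) = 0 := fun γ hγ =>
    Bar.homotopy_tuple_eq_zero (A := MonoidAlgebra k G) _ (by rw [hγ, map_one])
  have hG' : ∀ {m : ℕ} (γ : Fin (m + 3) → G), γ 0 = 1 →
      Bar.homotopy k (MonoidAlgebra k G) m (groupTuple k (Fin.tail γ)) = groupTuple k γ :=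
    fun γ hγ => homotopy_tail_of_eq_one (A := MonoidAlgebra k G)
      (fun i => MonoidAlgebra.of k G (γ i)) (by rw [hγ, map_one])
  have hL : ∀ {m : ℕ} (h : m + l = n) (γ : Fin (m + 2) → G),
      AW k S (n + 1) (Bar.homotopy k (SkewMonoidAlgebra S G) n (ezTerm k S m l h γ w)) =
        frontEdge m l h (groupTuple k γ ⊗ₜ Bar.tuple k S w) := fun h γ => by
    rw [AW_homotopy_of_incl h (by omega) (ih' h γ w), LinearMap.lTensor_tmul,
      Bar.homotopy_tuple_eq_zero w hw, TensorProduct.tmul_zero, map_zero, smul_zero, zero_add]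
  rw [ezTerm_eq_homotopy h γ w hγ hw, map_add]
  cases l with
  | zero =>
    obtain rfl : m = n + 1 := by omega
    rw [ezRight, map_zero, map_zero, add_zero, ezLeft, hL, frontEdge, LinearMap.comp_apply,
      TensorProduct.map_tmul, hG' γ hγ, LinearMap.comp_apply, Bar.aug_tuple, hw, one_mul]
    congr 2
    change Bar.tuple k S (Function.update (fun _ => 1) 1 _) = _
    congr 1
    funext r
    fin_cases r
    · exact hw.symm
    · simp
  | succ l =>
    have hfront : ∀ {m : ℕ} (h : m + l = n) (γ : Fin (m + 2) → G) (y : Bar k S l), γ 0 = 1 →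
        frontEdge m l h (groupTuple k γ ⊗ₜ y) = 0 := fun h γ y hγ => by
      cases l with
      | zero =>
        rw [frontEdge, LinearMap.comp_apply, TensorProduct.map_tmul, hG γ hγ,
          TensorProduct.zero_tmul, map_zero]
      | succ l => rfl
    have hleft : AW k S (n + 1) (Bar.homotopy k (SkewMonoidAlgebra S G) n
        (ezLeft k m (l + 1) h γ w)) = 0 := by
      cases m with
      | zero => rw [ezLeft, map_zero, map_zero]
      | succ m => rw [ezLeft, hL]; rfl
    rw [hleft, zero_add, ezRight, map_smul, map_smul,
      AW_homotopy_of_incl (by omega) h (ih' (by omega) γ (Fin.tail w)), LinearMap.lTensor_tmul,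
      homotopy_tail_of_eq_one w hw, hfront _ _ _ hγ, add_zero, smul_smul, ← mul_pow, neg_one_mul,
      neg_neg, one_pow, one_smul]

/-- The twisted Alexander-Whitney map is a retraction of the twisted Eilenberg-Zilber map. -/
theorem AW_EZ (n : ℕ) (t : Total k BG BS n) : AW k S n (EZ k S G n t) = t := by
  induction n with
  | zero => exact AW_EZ_zero t
  | succ n ih =>
    refine LinearMap.congr_fun (f := AW k S (n + 1) ∘ₗ EZ k S G (n + 1)) (g := LinearMap.id)
      (Total.ext_incl fun m l h z => ?_) t
    refine LinearMap.congr_fun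
      (f := (AW k S (n + 1) ∘ₗ EZ k S G (n + 1)) ∘ₗ Total.incl k BG BS m l h)
      (g := Total.incl k BG BS m l h) (ext_groupTuple_tmul fun γ w => ?_) z
    change AW k S (n + 1) (EZ k S G (n + 1)
      (Total.incl k BG BS m l h (groupTuple k γ ⊗ₜ Bar.tuple k S w))) = _
    rw [EZ_incl]
    set γ' : Fin (m + 2) → G := Function.update γ 0 1
    set w' : Fin (l + 2) → S := Function.update w 0 1
    have eγ : groupTuple k γ = MonoidAlgebra.of k G (γ 0) • groupTuple k γ' := groupTuple_eq_smul γ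
    have ew : Bar.tuple k S w = ((γ 0 * fullProd γ')⁻¹ • ((γ 0 * fullProd γ') • w 0)) •
        Bar.tuple k S w' := by
      rw [inv_smul_smul]
      exact Bar.tuple_eq_smul w
    rw [eγ, ew, ezComponent_smul h _ _ _ (groupTuple_mem_groupPart (k := k) γ'), ezComponent_tmul]
    funext p
    rw [AW_smul (ezTerm_mem_skewPart h γ' w') p,
      AW_ezTerm_of_eq_one ih h γ' w' (Function.update_self _ _ _) (Function.update_self _ _ _)]
    exact congrFun (Total.map_incl (X := BG) (Y := BS) (X' := BG) (Y' := BS)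
      (fun i => Bar.leftMul k i (MonoidAlgebra.of k G (γ 0)))
      (fun j => Bar.leftMul k j ((γ 0 * fullProd γ')⁻¹ • ((γ 0 * fullProd γ') • w 0))) h _) p

end Retract

/-! ### Internal gradings -/

section Grading

/-- Products of homogeneous elements are homogeneous. -/
theorem prodOver_mem {S Γ σ : Type*} [Semiring S] [AddCommMonoid Γ] [SetLike σ S] (𝒮 : Γ → σ)
    [SetLike.GradedMonoid 𝒮] {N : ℕ} (p : Fin N → Prop) [DecidablePred p] {v : Fin N → S}
    {e : Fin N → Γ} (hv : ∀ i, v i ∈ 𝒮 (e i)) :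
    prodOver p v ∈ 𝒮 (∑ i, if p i then e i else 0) := by
  induction N with
  | zero =>
    rw [Fin.sum_univ_zero, prodOver_eq_one fun i => i.elim0]
    exact SetLike.GradedOne.one_mem
  | succ N ih =>
    rw [prodOver_succ, Fin.sum_univ_succ]
    refine SetLike.mul_mem_graded ?_ (ih _ fun i => hv i.succ)
    split_ifs
    · exact hv 0
    · exact SetLike.GradedOne.one_mem

variable {k S G Γ : Type*} [Field k] [Ring S] [Algebra k S] [Group G] [MulSemiringAction G S]
  [SMulCommClass G k S] {n : ℕ} [AddCommMonoid Γ] {𝒮 : Γ → Submodule k S}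

omit [MulSemiringAction G S] [SMulCommClass G k S] [AddCommMonoid Γ] in
theorem single_mem_skewDegreePart {e : Γ} {s : S} (g : G) (hs : s ∈ 𝒮 e) :
    SkewMonoidAlgebra.single g s ∈ skewDegreePart (G := G) 𝒮 e := by
  classical
  rw [skewDegreePart, Submodule.mem_iInf]
  intro x
  rw [Submodule.mem_comap, skewCoeff_single]
  split_ifs
  · exact hs
  · exact Submodule.zero_mem _

/-- Shuffling permutes the homogeneous letters and inserts letters of degree zero. -/
theorem ezTerm_mem_degreePart [DecidableEq Γ] [GradedAlgebra 𝒮]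
    (hact : ∀ (g : G) (e : Γ), ∀ s ∈ 𝒮 e, g • s ∈ 𝒮 e) {m l : ℕ} (h : m + l = n)
    (γ : Fin (m + 2) → G) {w : Fin (l + 2) → S} {e : Fin (l + 2) → Γ} (hw : ∀ i, w i ∈ 𝒮 (e i)) :
    ezTerm k S m l h γ w ∈ Bar.degreePart (skewDegreePart 𝒮) n (∑ i, e i) := by
  classical
  subst h
  rw [ezTerm_apply]
  refine Submodule.sum_mem _ fun σ _ => ?_
  split_ifs
  · refine Submodule.smul_mem _ _ (Submodule.subset_span ?_)
    -- the letters from `γ` have degree zero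
    let f : Fin (m + l) → Γ := fun i =>
      if (i : ℕ) < m then 0 else e ⟨i - m + 1, by omega⟩
    refine ⟨Fin.cons (e 0) (Fin.snoc (α := fun _ => Γ) (fun q => f (σ q)) (e (Fin.last (l + 1)))),
      _, fun r => ?_, ?_, rfl⟩
    · induction r using Fin.cases with
      | zero => exact single_mem_skewDegreePart _ (hact _ _ _ (hw 0))
      | succ r =>
        rw [Fin.cons_succ]
        induction r using Fin.lastCases with
        | last =>
          rw [Fin.succ_last, ezTuple_last, Fin.snoc_last]
          exact single_mem_skewDegreePart _ (hact _ _ _ (hw _))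
        | cast q =>
          rw [ezTuple_middle, Fin.snoc_castSucc]
          simp only [f]
          split_ifs
          · exact single_mem_skewDegreePart _ SetLike.GradedOne.one_mem
          · exact single_mem_skewDegreePart _ (hact _ _ _ (hw _))
    · rw [Fin.sum_univ_succ, Fin.sum_univ_castSucc, Fin.sum_univ_succ e,
        Fin.sum_univ_castSucc (fun i => e i.succ)]
      simp only [Fin.cons_zero, Fin.cons_succ, Fin.snoc_castSucc, Fin.snoc_last]
      have h0 : ∑ i : Fin m, f (Fin.castAdd l i) = 0 :=
        Finset.sum_eq_zero fun i _ => by simp [f]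
      rw [Equiv.sum_comp σ f, Fin.sum_univ_add, h0, zero_add]
      congr 2
      refine Finset.sum_congr rfl fun i _ => ?_
      simp only [f, Fin.val_natAdd]
      rw [if_neg (by omega)]
      congr 1
      exact Fin.ext (by simp)
  · exact Submodule.zero_mem _

omit [SMulCommClass G k S] in
/-- A linear map on the bar resolution of `kG` takes values in `p` if it does so on tuples of group
elements. -/
theorem map_mem_of_groupTuple [Fintype G] {m : ℕ} {N : Type*} [AddCommGroup N] [Module k N]
    {p : Submodule k N} (f : Bar k (MonoidAlgebra k G) m →ₗ[k] N)
    (hf : ∀ γ, f (groupTuple k γ) ∈ p) (b : Bar k (MonoidAlgebra k G) m) : f b ∈ p := by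
  rw [← Submodule.Quotient.mk_eq_zero]
  exact LinearMap.congr_fun (f := p.mkQ ∘ₗ f) (g := 0)
    (ext_groupTuple fun γ => (Submodule.Quotient.mk_eq_zero p).mpr (hf γ)) b

theorem ezComponent_mem_degreePart [Fintype G] [DecidableEq Γ] [GradedAlgebra 𝒮]
    (hact : ∀ (g : G) (e : Γ), ∀ s ∈ 𝒮 e, g • s ∈ 𝒮 e) {m l : ℕ} (h : m + l = n)
    (b : Bar k (MonoidAlgebra k G) m) {e : Γ} {y : Bar k S l} (hy : y ∈ Bar.degreePart 𝒮 l e) :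
    ezComponent k S G m l h (b ⊗ₜ y) ∈ Bar.degreePart (skewDegreePart 𝒮) n e := by
  refine (Submodule.span_le (p := Submodule.comap (ezComponent k S G m l h ∘ₗ
    TensorProduct.mk k (Bar k (MonoidAlgebra k G) m) (Bar k S l) b)
    (Bar.degreePart (A := SkewMonoidAlgebra S G) (skewDegreePart 𝒮) n e))).mpr ?_ hy
  rintro _ ⟨e, w, hw, rfl, rfl⟩
  rw [SetLike.mem_coe, Submodule.mem_comap]
  refine map_mem_of_groupTuple (ezComponent k S G m l h ∘ₗ
    (TensorProduct.mk k (Bar k (MonoidAlgebra k G) m) (Bar k S l)).flip (Bar.tuple k S w))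
    (fun γ => ?_) b
  change ezComponent k S G m l h (groupTuple k γ ⊗ₜ Bar.tuple k S w) ∈ _
  rw [ezComponent_tmul]
  exact ezTerm_mem_degreePart hact h γ hw

/-- The components of `AW` of a homogeneous tensor are sums of tensors with homogeneous second
factor of the same degree. -/
theorem AW_tuple_mem [Fintype G] [DecidableEq Γ] [GradedAlgebra 𝒮]
    (hact : ∀ (g : G) (e : Γ), ∀ s ∈ 𝒮 e, g • s ∈ 𝒮 e) {v : Fin (n + 2) → SkewMonoidAlgebra S G}
    {e : Fin (n + 2) → Γ} (hv : ∀ i, v i ∈ skewDegreePart 𝒮 (e i)) (p : Bidegree n) :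
    AW k S n (Bar.tuple k (SkewMonoidAlgebra S G) v) p ∈ LinearMap.range
      ((Bar.degreePart 𝒮 p.1.2 (∑ i, e i)).subtype.lTensor (Bar k (MonoidAlgebra k G) p.1.1)) := by
  rw [AW_tuple]
  refine Submodule.sum_mem _ fun γ _ => ?_
  rw [awTerm_apply]
  refine Submodule.smul_mem _ _ ⟨groupTuple k (blockProd (backMap p.add_eq) γ) ⊗ₜ
    ⟨Bar.tuple k S (blockProd (frontMap p.add_eq) fun i =>
      (tailProd γ i)⁻¹ • skewCoeff k S G (γ i) (v i)), Submodule.subset_span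
    ⟨fun j => ∑ i, if frontMap p.add_eq i = j then e i else 0, _, fun j => prodOver_mem 𝒮 _ fun i =>
      hact _ _ _ ((Submodule.mem_iInf _).mp (hv i) (γ i)), ?_, rfl⟩⟩, rfl⟩
  rw [Finset.sum_comm]
  simp

end Grading

/-! ### The bimodule structures of the twisted product -/

/-- The tensor product of two chain maps is a chain map. -/
theorem Total.isChainMap_map {k : Type*} [Field k] {X Y X' Y' : ℕ → Type*}
    [∀ n, AddCommGroup (X n)] [∀ n, Module k (X n)] [∀ n, AddCommGroup (Y n)] [∀ n, Module k (Y n)]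
    [∀ n, AddCommGroup (X' n)] [∀ n, Module k (X' n)]
    [∀ n, AddCommGroup (Y' n)] [∀ n, Module k (Y' n)]
    {dX : ∀ n, X (n + 1) →ₗ[k] X n} {dY : ∀ n, Y (n + 1) →ₗ[k] Y n}
    {dX' : ∀ n, X' (n + 1) →ₗ[k] X' n} {dY' : ∀ n, Y' (n + 1) →ₗ[k] Y' n}
    {f : ∀ n, X n →ₗ[k] X' n} {g : ∀ n, Y n →ₗ[k] Y' n} (hf : IsChainMap dX dX' f)
    (hg : IsChainMap dY dY' g) :
    IsChainMap (Total.d dX dY) (Total.d dX' dY') (Total.map f g) := by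
  have hf' : ∀ n, f n ∘ₗ dX n = dX' n ∘ₗ f (n + 1) := fun n => LinearMap.ext (hf n)
  have hg' : ∀ n, g n ∘ₗ dY n = dY' n ∘ₗ g (n + 1) := fun n => LinearMap.ext (hg n)
  have key : ∀ (i j : ℕ) (a : X (i + 1) ⊗[k] Y j) (b : X i ⊗[k] Y (j + 1)),
      TensorProduct.map (f i) (g j) ((dX i).rTensor (Y j) a +
        (-1 : k) ^ i • (dY j).lTensor (X i) b) =
      (dX' i).rTensor (Y' j) (TensorProduct.map (f (i + 1)) (g j) a) +
        (-1 : k) ^ i • (dY' j).lTensor (X' i) (TensorProduct.map (f i) (g (j + 1)) b) := by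
    intro i j a b
    rw [map_add, map_smul, ← LinearMap.comp_apply, LinearMap.map_comp_rTensor, hf',
      ← LinearMap.comp_apply, LinearMap.map_comp_lTensor, hg', ← LinearMap.rTensor_comp_map,
      ← LinearMap.lTensor_comp_map]
    rfl
  intro n t
  funext p
  exact key p.1.1 p.1.2 _ _

section Transfer

universe u v

variable {k S G : Type*} [Field k] [Ring S] [Algebra k S] [Group G] [DecidableEq G] [Fintype G]
  [MulSemiringAction G S] [SMulCommClass G k S] (C : GroupResolution.{u} k G)
  (D : EquivariantResolution.{v} k S G)

local notation "BG" => fun i : ℕ => Bar k (MonoidAlgebra k G) i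
local notation "BS" => fun j : ℕ => Bar k S j

theorem twistedAug_apply (t : Total k C.X D.X 0) :
    twistedAug C D t = LinearMap.mul' k (SkewMonoidAlgebra S G) (TensorProduct.map
      (groupIncl k G S ∘ₗ C.aug) (SkewMonoidAlgebra.lsingle (R := k) (M := S) 1 ∘ₗ D.aug)
      (t (Bidegree.mk 0 0 rfl))) := by
  refine LinearMap.congr_fun
    (f := TensorProduct.lift ((LinearMap.mul k (SkewMonoidAlgebra S G)).compl₁₂
      (groupIncl k G S ∘ₗ C.aug) (SkewMonoidAlgebra.lsingle (R := k) (M := S) 1 ∘ₗ D.aug)))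
    (g := LinearMap.mul' k (SkewMonoidAlgebra S G) ∘ₗ TensorProduct.map
      (groupIncl k G S ∘ₗ C.aug) (SkewMonoidAlgebra.lsingle (R := k) (M := S) 1 ∘ₗ D.aug))
    (TensorProduct.ext' fun c y => ?_) (t (Bidegree.mk 0 0 rfl))
  rw [LinearMap.comp_apply, TensorProduct.map_tmul, LinearMap.mul'_apply, TensorProduct.lift.tmul]
  rfl

variable {C D}

/-- The left action of `S` on the twisted product depends on the `G`-degree in `C`, so that `ιG` has
to preserve degrees. -/
theorem ezComponent_map_smul {m l n : ℕ} (h : m + l = n)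
    {ιG : C.X m →ₗ[k] Bar k (MonoidAlgebra k G) m} {ιS : D.X l →ₗ[k] Bar k S l}
    (bιG : IsBimoduleMap (MonoidAlgebra k G) ιG) (bιS : IsBimoduleMap S ιS)
    (hgr : ∀ g, ∀ c ∈ C.grade m g, ιG c ∈ Bar.groupPart k m g) (a : SkewMonoidAlgebra S G)
    (z : C.X m ⊗[k] D.X l) :
    ezComponent k S G m l h (TensorProduct.map ιG ιS (a • z)) =
      a • ezComponent k S G m l h (TensorProduct.map ιG ιS z) := by
  induction a with
  | add a a' ha ha' => rw [add_smul, map_add, map_add, ha, ha', add_smul]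
  | single g s =>
    refine LinearMap.congr_fun (f := ezComponent k S G m l h ∘ₗ TensorProduct.map ιG ιS ∘ₗ
        leftAction C D m l (skewSingle g s))
      (g := Bar.leftMul k n (skewSingle g s) ∘ₗ ezComponent k S G m l h ∘ₗ
        TensorProduct.map ιG ιS) (C.ext_homogeneous fun x c hc y => ?_) z
    change ezComponent k S G m l h (TensorProduct.map ιG ιS (skewSingle g s • (c ⊗ₜ[k] y))) =
      skewSingle g s • ezComponent k S G m l h (TensorProduct.map ιG ιS (c ⊗ₜ[k] y))
    rw [single_smul_tmul C D hc, TensorProduct.map_tmul, TensorProduct.map_tmul, bιG.1, bιS.1,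
      ezComponent_smul h g x s (hgr x c hc)]

theorem ezComponent_map_op_smul {m l n : ℕ} (h : m + l = n)
    {ιG : C.X m →ₗ[k] Bar k (MonoidAlgebra k G) m} {ιS : D.X l →ₗ[k] Bar k S l}
    (bιG : IsBimoduleMap (MonoidAlgebra k G) ιG) (bιS : IsBimoduleMap S ιS)
    (gιS : ∀ (g : G) x, ιS (g • x) = Bar.groupAct k S l g (ιS x)) (a : SkewMonoidAlgebra S G)
    (z : C.X m ⊗[k] D.X l) :
    ezComponent k S G m l h (TensorProduct.map ιG ιS (op a • z)) =
      op a • ezComponent k S G m l h (TensorProduct.map ιG ιS z) := by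
  induction a with
  | add a a' ha ha' => rw [op_add, add_smul, map_add, map_add, ha, ha', add_smul]
  | single g s =>
    refine LinearMap.congr_fun (f := ezComponent k S G m l h ∘ₗ TensorProduct.map ιG ιS ∘ₗ
        (rightAction C D m l (skewSingle g s)).unop)
      (g := Bar.rightMul k n (skewSingle g s) ∘ₗ ezComponent k S G m l h ∘ₗ
        TensorProduct.map ιG ιS) (TensorProduct.ext' fun c y => ?_) z
    change ezComponent k S G m l h (TensorProduct.map ιG ιS (op (skewSingle g s) • (c ⊗ₜ[k] y))) =
      op (skewSingle g s) • ezComponent k S G m l h (TensorProduct.map ιG ιS (c ⊗ₜ[k] y))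
    rw [op_single_smul_tmul C D, TensorProduct.map_tmul, TensorProduct.map_tmul, bιG.2, gιS, bιS.2,
      ezComponent_op_smul h g s]

theorem map_AW_smul {n : ℕ} (p : Bidegree n)
    {πG : Bar k (MonoidAlgebra k G) p.1.1 →ₗ[k] C.X p.1.1} {πS : Bar k S p.1.2 →ₗ[k] D.X p.1.2}
    (bπG : IsBimoduleMap (MonoidAlgebra k G) πG) (bπS : IsBimoduleMap S πS)
    (hgr : ∀ g, ∀ b ∈ Bar.groupPart k p.1.1 g, πG b ∈ C.grade p.1.1 g) (a : SkewMonoidAlgebra S G)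
    (b : Bar k (SkewMonoidAlgebra S G) n) :
    TensorProduct.map πG πS (AW k S n (a • b) p) = a • TensorProduct.map πG πS (AW k S n b p) := by
  induction a with
  | add a a' ha ha' => rw [add_smul, map_add, Pi.add_apply, map_add, ha, ha', add_smul]
  | single g s =>
    refine LinearMap.congr_fun (f := TensorProduct.map πG πS ∘ₗ LinearMap.proj p ∘ₗ AW k S n ∘ₗ
        Bar.leftMul k n (skewSingle g s))
      (g := leftAction C D p.1.1 p.1.2 (skewSingle g s) ∘ₗ TensorProduct.map πG πS ∘ₗ
        LinearMap.proj p ∘ₗ AW k S n) (ext_diag fun γ w => ?_) b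
    change TensorProduct.map πG πS
        (AW k S n (skewSingle g s • Bar.tuple k (SkewMonoidAlgebra S G) (diag γ w)) p) =
      leftAction C D p.1.1 p.1.2 (skewSingle g s)
        (TensorProduct.map πG πS (AW k S n (Bar.tuple k (SkewMonoidAlgebra S G) (diag γ w)) p))
    have hc : πG (groupTuple k (blockProd (backMap p.add_eq) γ)) ∈ C.grade p.1.1 (fullProd γ) := by
      rw [← fullProd_blockProd _ (monotone_backMap p.add_eq) γ]
      exact hgr _ _ (groupTuple_mem_groupPart _)
    rw [AW_smul_diag, AW_diag, map_smul, map_smul, map_smul, map_smul]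
    congr 1
    refine Eq.trans ?_ (single_smul_tmul C D hc s g _).symm
    rw [← bπG.1, ← bπS.1]
    rfl

theorem map_AW_op_smul {n : ℕ} (p : Bidegree n)
    {πG : Bar k (MonoidAlgebra k G) p.1.1 →ₗ[k] C.X p.1.1} {πS : Bar k S p.1.2 →ₗ[k] D.X p.1.2}
    (bπG : IsBimoduleMap (MonoidAlgebra k G) πG) (bπS : IsBimoduleMap S πS)
    (gπS : ∀ (g : G) x, πS (Bar.groupAct k S p.1.2 g x) = g • πS x) (a : SkewMonoidAlgebra S G)
    (b : Bar k (SkewMonoidAlgebra S G) n) :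
    TensorProduct.map πG πS (AW k S n (op a • b) p) =
      op a • TensorProduct.map πG πS (AW k S n b p) := by
  induction a with
  | add a a' ha ha' => rw [op_add, add_smul, map_add, Pi.add_apply, map_add, ha, ha', add_smul]
  | single g s =>
    refine (congrArg _ (AW_op_smul g s b p)).trans ?_
    refine LinearMap.congr_fun (f := TensorProduct.map πG πS ∘ₗ
        TensorProduct.map (Bar.rightMul k p.1.1 (MonoidAlgebra.of k G g))
          (Bar.groupAct k S p.1.2 g⁻¹ ∘ₗ Bar.rightMul k p.1.2 s))
      (g := (rightAction C D p.1.1 p.1.2 (skewSingle g s)).unop ∘ₗ TensorProduct.map πG πS)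
      (TensorProduct.ext' fun c y => ?_) (AW k S n b p)
    change πG (op (MonoidAlgebra.of k G g) • c) ⊗ₜ[k] πS (Bar.groupAct k S p.1.2 g⁻¹ (op s • y)) =
      op (skewSingle g s) • (πG c ⊗ₜ[k] πS y)
    rw [op_single_smul_tmul C D, bπG.2, gπS, bπS.2]

end Transfer

/-! ### The maps between the twisted product and the bar resolution -/

theorem map_map_of_forall_eq {k X X' X'' Y Y' Y'' : Type*} [Field k] [AddCommGroup X] [Module k X]
    [AddCommGroup X'] [Module k X'] [AddCommGroup X''] [Module k X''] [AddCommGroup Y] [Module k Y]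
    [AddCommGroup Y'] [Module k Y'] [AddCommGroup Y''] [Module k Y''] {f : X →ₗ[k] X'}
    {f' : X' →ₗ[k] X''} {f'' : X →ₗ[k] X''} {g : Y →ₗ[k] Y'} {g' : Y' →ₗ[k] Y''}
    {g'' : Y →ₗ[k] Y''} (hf : ∀ x, f' (f x) = f'' x) (hg : ∀ y, g' (g y) = g'' y) (z : X ⊗[k] Y) :
    TensorProduct.map f' g' (TensorProduct.map f g z) = TensorProduct.map f'' g'' z := by
  rw [← LinearMap.comp_apply, ← TensorProduct.map_comp, LinearMap.ext (f := f' ∘ₗ f) (g := f'') hf,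
    LinearMap.ext (f := g' ∘ₗ g) (g := g'') hg]

section TransferTotal

universe u v

variable {k S G : Type*} [Field k] [Ring S] [Algebra k S] [Group G] [DecidableEq G] [Fintype G]
  [MulSemiringAction G S] [SMulCommClass G k S] {C : GroupResolution.{u} k G}
  {D : EquivariantResolution.{v} k S G}
  {ιG : ∀ n, C.X n →ₗ[k] Bar k (MonoidAlgebra k G) n}
  {πG : ∀ n, Bar k (MonoidAlgebra k G) n →ₗ[k] C.X n}
  {ιS : ∀ n, D.X n →ₗ[k] Bar k S n} {πS : ∀ n, Bar k S n →ₗ[k] D.X n}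

theorem EZ_map_apply {n : ℕ} (t : Total k C.X D.X n) :
    EZ k S G n (Total.map ιG ιS n t) = ∑ p : Bidegree n,
      ezComponent k S G p.1.1 p.1.2 p.add_eq (TensorProduct.map (ιG p.1.1) (ιS p.1.2) (t p)) :=
  EZ_apply _

theorem map_AW_EZ_map (hG : ∀ n x, πG n (ιG n x) = x) (hS : ∀ n x, πS n (ιS n x) = x) {n : ℕ}
    (t : Total k C.X D.X n) :
    Total.map πG πS n (AW k S n (EZ k S G n (Total.map ιG ιS n t))) = t := by
  rw [AW_EZ]
  funext p
  exact (map_map_of_forall_eq (f'' := LinearMap.id) (g'' := LinearMap.id) (hG _) (hS _) _).trans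
    (LinearMap.congr_fun TensorProduct.map_id (t p))

theorem isBimoduleMap_EZ_map (bιG : ∀ n, IsBimoduleMap (MonoidAlgebra k G) (ιG n))
    (bιS : ∀ n, IsBimoduleMap S (ιS n))
    (gιS : ∀ n (g : G) x, ιS n (g • x) = Bar.groupAct k S n g (ιS n x))
    (hgr : ∀ n g, ∀ c ∈ C.grade n g, ιG n c ∈ Bar.groupPart k n g) (n : ℕ) :
    IsBimoduleMap (SkewMonoidAlgebra S G) (EZ k S G n ∘ₗ Total.map ιG ιS n) := by
  refine ⟨fun a t => ?_, fun a t => ?_⟩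
  · rw [LinearMap.comp_apply, LinearMap.comp_apply, EZ_map_apply, EZ_map_apply, Finset.smul_sum]
    exact Finset.sum_congr rfl fun p _ =>
      ezComponent_map_smul p.add_eq (bιG _) (bιS _) (hgr _) a (t p)
  · rw [LinearMap.comp_apply, LinearMap.comp_apply, EZ_map_apply, EZ_map_apply, Finset.smul_sum]
    exact Finset.sum_congr rfl fun p _ =>
      ezComponent_map_op_smul p.add_eq (bιG _) (bιS _) (gιS _) a (t p)

theorem isBimoduleMap_map_AW (bπG : ∀ n, IsBimoduleMap (MonoidAlgebra k G) (πG n))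
    (bπS : ∀ n, IsBimoduleMap S (πS n))
    (gπS : ∀ n (g : G) x, πS n (Bar.groupAct k S n g x) = g • πS n x)
    (hgr : ∀ n g, ∀ b ∈ Bar.groupPart k n g, πG n b ∈ C.grade n g) (n : ℕ) :
    IsBimoduleMap (SkewMonoidAlgebra S G) (Total.map πG πS n ∘ₗ AW k S n) :=
  ⟨fun a b => funext fun p => map_AW_smul p (bπG _) (bπS _) (hgr _) a b,
    fun a b => funext fun p => map_AW_op_smul p (bπG _) (bπS _) (gπS _) a b⟩

theorem aug_EZ_map (hG : ∀ c, Bar.aug k (MonoidAlgebra k G) (ιG 0 c) = C.aug c)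
    (hS : ∀ x, Bar.aug k S (ιS 0 x) = D.aug x) (t : Total k C.X D.X 0) :
    Bar.aug k (SkewMonoidAlgebra S G) (EZ k S G 0 (Total.map ιG ιS 0 t)) = twistedAug C D t := by
  have hp : ∀ p : Bidegree 0, p = Bidegree.mk 0 0 rfl := fun p => by
    have := p.add_eq
    exact Subtype.ext (Prod.ext (by change p.1.1 = 0; omega) (by change p.1.2 = 0; omega))
  rw [EZ_map_apply, Fintype.sum_eq_single (Bidegree.mk 0 0 rfl) fun p h => absurd (hp p) h]
  refine (aug_ezComponent _).trans (Eq.trans ?_ (twistedAug_apply C D t).symm)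
  exact congrArg _ (map_map_of_forall_eq (f := ιG 0)
    (f' := groupIncl k G S ∘ₗ Bar.aug k (MonoidAlgebra k G)) (g := ιS 0)
    (g' := SkewMonoidAlgebra.lsingle (R := k) (M := S) 1 ∘ₗ Bar.aug k S)
    (fun c => congrArg (groupIncl k G S) (hG c))
    (fun x => congrArg (SkewMonoidAlgebra.lsingle (R := k) (M := S) 1) (hS x)) _)

theorem twistedAug_map_AW (hG : ∀ b, C.aug (πG 0 b) = Bar.aug k (MonoidAlgebra k G) b)
    (hS : ∀ b, D.aug (πS 0 b) = Bar.aug k S b) (b : Bar k (SkewMonoidAlgebra S G) 0) :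
    twistedAug C D (Total.map πG πS 0 (AW k S 0 b)) = Bar.aug k (SkewMonoidAlgebra S G) b := by
  rw [twistedAug_apply, ← aug_AW]
  exact congrArg _ (map_map_of_forall_eq (f := πG 0) (f' := groupIncl k G S ∘ₗ C.aug) (g := πS 0)
    (g' := SkewMonoidAlgebra.lsingle (R := k) (M := S) 1 ∘ₗ D.aug)
    (fun c => congrArg (groupIncl k G S) (hG c))
    (fun x => congrArg (SkewMonoidAlgebra.lsingle (R := k) (M := S) 1) (hS x)) _)

variable {Γ : Type*} [AddCommMonoid Γ] [DecidableEq Γ] {𝒮 : Γ → Submodule k S} [GradedAlgebra 𝒮]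
  {𝒟 : ∀ j, Γ → Submodule k (D.X j)}

theorem EZ_map_mem_degreePart (hact : ∀ (g : G) (m : Γ), ∀ s ∈ 𝒮 m, g • s ∈ 𝒮 m)
    (hιS : ∀ j m, ∀ x ∈ 𝒟 j m, ιS j x ∈ Bar.degreePart 𝒮 j m) {n : ℕ} {m : Γ}
    {t : Total k C.X D.X n} (ht : t ∈ twistedDegreePart C D 𝒟 n m) :
    EZ k S G n (Total.map ιG ιS n t) ∈ Bar.degreePart (skewDegreePart 𝒮) n m := by
  rw [EZ_map_apply]
  refine Submodule.sum_mem _ fun p _ => ?_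
  obtain ⟨u, hu⟩ := ht p (Set.mem_univ p)
  rw [← hu]
  clear hu
  induction u with
  | zero => rw [map_zero, map_zero, map_zero]; exact Submodule.zero_mem _
  | add u u' h h' => rw [map_add, map_add, map_add]; exact Submodule.add_mem _ h h'
  | tmul c x =>
    exact ezComponent_mem_degreePart hact p.add_eq (ιG p.1.1 c) (hιS p.1.2 m x x.2)

theorem map_AW_mem_twistedDegreePart (hact : ∀ (g : G) (m : Γ), ∀ s ∈ 𝒮 m, g • s ∈ 𝒮 m)
    (hπS : ∀ j m, ∀ b ∈ Bar.degreePart 𝒮 j m, πS j b ∈ 𝒟 j m) {n : ℕ} {m : Γ}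
    {b : Bar k (SkewMonoidAlgebra S G) n} (hb : b ∈ Bar.degreePart (skewDegreePart 𝒮) n m) :
    Total.map πG πS n (AW k S n b) ∈ twistedDegreePart C D 𝒟 n m := by
  refine (Submodule.span_le (p := Submodule.comap (Total.map πG πS n ∘ₗ AW k S n)
    (twistedDegreePart C D 𝒟 n m))).mpr ?_ hb
  rintro _ ⟨e, v, hv, rfl, rfl⟩
  intro p _
  obtain ⟨u, hu⟩ := AW_tuple_mem hact hv p
  change TensorProduct.map (πG p.1.1) (πS p.1.2)
    (AW k S n (Bar.tuple k (SkewMonoidAlgebra S G) v) p) ∈ _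
  rw [← hu]
  clear hu
  induction u with
  | zero => rw [map_zero, map_zero]; exact Submodule.zero_mem _
  | add u u' h h' => rw [map_add, map_add]; exact Submodule.add_mem _ h h'
  | tmul c y => exact ⟨πG p.1.1 c ⊗ₜ ⟨πS p.1.2 y, hπS _ _ _ y.2⟩, rfl⟩

end TransferTotal

end GroupTwisted

theorem mainTheorem1 {k S G : Type*} [Field k] [Ring S] [Algebra k S]
    [Group G] [Fintype G] [DecidableEq G] [MulSemiringAction G S] [SMulCommClass G k S]
    (C : GroupTwisted.GroupResolution k G) (D : GroupTwisted.EquivariantResolution k S G)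
    (ιG : ∀ n, C.X n →ₗ[k] GroupTwisted.Bar k (MonoidAlgebra k G) n)
    (πG : ∀ n, GroupTwisted.Bar k (MonoidAlgebra k G) n →ₗ[k] C.X n)
    (ιS : ∀ n, D.X n →ₗ[k] GroupTwisted.Bar k S n)
    (πS : ∀ n, GroupTwisted.Bar k S n →ₗ[k] D.X n)
    -- the four given maps are chain maps of bimodules
    (hιG : GroupTwisted.IsChainMap C.d (GroupTwisted.Bar.d k (MonoidAlgebra k G)) ιG)
    (hπG : GroupTwisted.IsChainMap (GroupTwisted.Bar.d k (MonoidAlgebra k G)) C.d πG)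
    (hιS : GroupTwisted.IsChainMap D.d (GroupTwisted.Bar.d k S) ιS)
    (hπS : GroupTwisted.IsChainMap (GroupTwisted.Bar.d k S) D.d πS)
    (bιG : ∀ n, GroupTwisted.IsBimoduleMap (MonoidAlgebra k G) (ιG n))
    (bπG : ∀ n, GroupTwisted.IsBimoduleMap (MonoidAlgebra k G) (πG n))
    (bιS : ∀ n, GroupTwisted.IsBimoduleMap S (ιS n))
    (bπS : ∀ n, GroupTwisted.IsBimoduleMap S (πS n))
    -- `ιS` and `πS` are `kG`-linear
    (gιS : ∀ n (g : G) x, ιS n (g • x) = GroupTwisted.Bar.groupAct k S n g (ιS n x))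
    (gπS : ∀ n (g : G) x, πS n (GroupTwisted.Bar.groupAct k S n g x) = g • πS n x)
    -- `πG ιG = 1` and `πS ιS = 1`
    (hG : ∀ n x, πG n (ιG n x) = x) (hS : ∀ n x, πS n (ιS n x) = x) :
    ∃ (ι : ∀ n, GroupTwisted.Total k C.X D.X n →ₗ[k]
        GroupTwisted.Bar k (SkewMonoidAlgebra S G) n)
      (π : ∀ n, GroupTwisted.Bar k (SkewMonoidAlgebra S G) n →ₗ[k]
        GroupTwisted.Total k C.X D.X n),
      (∀ n, ι n = GroupTwisted.EZ k S G n ∘ₗ GroupTwisted.Total.map ιG ιS n) ∧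
      (∀ n, π n = GroupTwisted.Total.map πG πS n ∘ₗ GroupTwisted.AW k S n) ∧
      GroupTwisted.IsChainMap (GroupTwisted.Total.d C.d D.d)
        (GroupTwisted.Bar.d k (SkewMonoidAlgebra S G)) ι ∧
      GroupTwisted.IsChainMap (GroupTwisted.Bar.d k (SkewMonoidAlgebra S G))
        (GroupTwisted.Total.d C.d D.d) π ∧
      (∀ n t, π n (ι n t) = t) ∧
      -- `ι` and `π` are maps of `S ⋊ G`-bimodules when `ιG` and `πG` respect the `G`-gradings
      ((∀ n g, ∀ c ∈ C.grade n g, ιG n c ∈ GroupTwisted.Bar.groupPart k n g) →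
        ∀ n, GroupTwisted.IsBimoduleMap (SkewMonoidAlgebra S G) (ι n)) ∧
      ((∀ n g, ∀ b ∈ GroupTwisted.Bar.groupPart k n g, πG n b ∈ C.grade n g) →
        ∀ n, GroupTwisted.IsBimoduleMap (SkewMonoidAlgebra S G) (π n)) ∧
      -- `ι` and `π` lift the identity of `S ⋊ G` when the given maps lift the identities
      ((∀ c, GroupTwisted.Bar.aug k (MonoidAlgebra k G) (ιG 0 c) = C.aug c) →
        (∀ x, GroupTwisted.Bar.aug k S (ιS 0 x) = D.aug x) →
        ∀ t, GroupTwisted.Bar.aug k (SkewMonoidAlgebra S G) (ι 0 t) =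
          GroupTwisted.twistedAug C D t) ∧
      ((∀ b, C.aug (πG 0 b) = GroupTwisted.Bar.aug k (MonoidAlgebra k G) b) →
        (∀ b, D.aug (πS 0 b) = GroupTwisted.Bar.aug k S b) →
        ∀ b, GroupTwisted.twistedAug C D (π 0 b) =
          GroupTwisted.Bar.aug k (SkewMonoidAlgebra S G) b) ∧
      -- gradings: `S` is graded, `G` acts by graded automorphisms and sits in degree zero
      (∀ (Γ : Type*) [AddCommMonoid Γ] [DecidableEq Γ] (𝒮 : Γ → Submodule k S) [GradedAlgebra 𝒮],
        (∀ (g : G) (m : Γ), ∀ s ∈ 𝒮 m, g • s ∈ 𝒮 m) →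
        ∀ 𝒟 : ∀ j, Γ → Submodule k (D.X j), (∀ j, DirectSum.IsInternal (𝒟 j)) →
          ((∀ j m, ∀ x ∈ 𝒟 j m, ιS j x ∈ GroupTwisted.Bar.degreePart 𝒮 j m) →
            ∀ n m, ∀ t ∈ GroupTwisted.twistedDegreePart C D 𝒟 n m,
              ι n t ∈ GroupTwisted.Bar.degreePart (GroupTwisted.skewDegreePart 𝒮) n m) ∧
          ((∀ j m, ∀ b ∈ GroupTwisted.Bar.degreePart 𝒮 j m, πS j b ∈ 𝒟 j m) →
            ∀ n m, ∀ b ∈ GroupTwisted.Bar.degreePart (GroupTwisted.skewDegreePart 𝒮) n m,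
              π n b ∈ GroupTwisted.twistedDegreePart C D 𝒟 n m)) := by
  refine ⟨fun n => GroupTwisted.EZ k S G n ∘ₗ GroupTwisted.Total.map ιG ιS n,
    fun n => GroupTwisted.Total.map πG πS n ∘ₗ GroupTwisted.AW k S n, fun _ => rfl, fun _ => rfl,
    fun n t => ?_, fun n b => ?_, fun n t => GroupTwisted.map_AW_EZ_map hG hS t,
    fun hgr => GroupTwisted.isBimoduleMap_EZ_map bιG bιS gιS hgr,
    fun hgr => GroupTwisted.isBimoduleMap_map_AW bπG bπS gπS hgr,
    GroupTwisted.aug_EZ_map, GroupTwisted.twistedAug_map_AW,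
    fun Γ _ _ 𝒮 _ hact 𝒟 _ => ⟨fun h n m t => GroupTwisted.EZ_map_mem_degreePart hact h,
      fun h n m b => GroupTwisted.map_AW_mem_twistedDegreePart hact h⟩⟩
  · exact (congrArg _ (GroupTwisted.Total.isChainMap_map hιG hιS n t)).trans
      (GroupTwisted.isChainMap_EZ n _)
  · exact (congrArg _ (GroupTwisted.isChainMap_AW n b)).trans
      (GroupTwisted.Total.isChainMap_map hπG hπS n _)
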